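/- Let $V$ be a vector space over a field $\mathbb F$ (of any dimension) with a linearly ordered basis $\mathbb B$, and let $p\in\mathbb F$, $p\neq 0$. For $a,b\in\mathbb B$ put $\theta_{a,b}=1$ if $a>b$ and $\theta_{a,b}=0$ otherwise, and let $\tau\colon V\otimes V\to V\otimes V$ be the braiding $$\tau(a\otimes b)=(p^{\theta_{a,b}}-1)\,a\otimes b-p^{\theta_{b,a}}\,b\otimes a,\qquad a,b\in\mathbb B .$$ The tensor algebra $T(V)$ is a braided Hopf algebra whose braiding is induced by $\tau$ and in which all elements of $V$ are primitive. The Nichols algebra of $(V,\tau)$ is the quotient braided Hopf algebra $\mathfrak B(V)=T(V)/\mathfrak J_V$, where $\mathfrak J_V$ is the largest homogeneous Hopf ideal of $T(V)$ (a two-sided ideal compatible with the coproduct, counit, antipode and braiding) that intersects $V$ trivially. Then the exterior algebra $\bigwedge V$ (with its usual algebra structure) has a unique structure of a braided Hopf algebra in which all elements of $V$ are primitive and whose braiding $\hat\tau$ is induced by $\tau$, i.e. $\hat\tau|_{V\otimes V}=\tau$; denote it by $\Lambda_p(V)$. There is an isomorphism of algebras $$\Lambda_p(V)\;\cong\;\mathfrak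 B(V)=T(V)/\mathfrak J_V$$ which is the identity on $V$ and commutes with the braidings, coproducts, counits and antipodes. Moreover $\Lambda_p(V)$ has no nonzero primitive elements of degree $\ge 2$. -/

import Mathlib

open scoped TensorProduct

noncomputable section

namespace BraidedHopf

/-! ### Braidings -/

section Braiding

variable {F M : Type*} [Field F] [AddCommGroup M] [Module F M]

/-- `β ⊗ id` on `M ⊗ M ⊗ M` (bracketed to the left). -/
def onFirst (β : M ⊗[F] M →ₗ[F] M ⊗[F] M) :
    (M ⊗[F] M) ⊗[F] M →ₗ[F] (M ⊗[F] M) ⊗[F] M :=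
  β.rTensor M

/-- `id ⊗ β` on `M ⊗ M ⊗ M` (bracketed to the left). -/
def onSecond (β : M ⊗[F] M →ₗ[F] M ⊗[F] M) :
    (M ⊗[F] M) ⊗[F] M →ₗ[F] (M ⊗[F] M) ⊗[F] M :=
  (TensorProduct.assoc F M M M).symm.toLinearMap ∘ₗ β.lTensor M ∘ₗ
    (TensorProduct.assoc F M M M).toLinearMap

/-- `β` is a braiding on `M`: an automorphism of `M ⊗ M` satisfying the Yang--Baxter equation. -/
structure IsBraiding (β : M ⊗[F] M →ₗ[F] M ⊗[F] M) : Prop where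
  bijective : Function.Bijective β
  yangBaxter : onFirst β ∘ₗ onSecond β ∘ₗ onFirst β = onSecond β ∘ₗ onFirst β ∘ₗ onSecond β

end Braiding

/-! ### Braided Hopf algebras -/

/-- A braiding, a coproduct, a counit and an antipode on an algebra `H`
(the product and the unit are those of the algebra `H`). -/
@[ext]
structure BraidedHopfData (F H : Type*) [Field F] [Ring H] [Algebra F H] where
  braiding : H ⊗[F] H →ₗ[F] H ⊗[F] H
  comul : H →ₗ[F] H ⊗[F] H
  counit : H →ₗ[F] F
  antipode : H →ₗ[F] H

namespace BraidedHopfData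

variable {F H : Type*} [Field F] [Ring H] [Algebra F H]

/-- The product of `H ⊗ H` twisted by the braiding,
`(∇ ⊗ ∇) (id ⊗ β ⊗ id) : (H ⊗ H) ⊗ (H ⊗ H) → H ⊗ H`. -/
def braidedMul (D : BraidedHopfData F H) :
    (H ⊗[F] H) ⊗[F] (H ⊗[F] H) →ₗ[F] H ⊗[F] H :=
  TensorProduct.map (LinearMap.mul' F H) (LinearMap.mul' F H) ∘ₗ
    (TensorProduct.tensorTensorTensorAssoc F H H H H).symm.toLinearMap ∘ₗ
    (D.braiding.lTensor H).rTensor H ∘ₗ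
    (TensorProduct.tensorTensorTensorAssoc F H H H H).toLinearMap

/-- The axioms of a braided Hopf algebra: a Hopf object in a braided category of vector spaces
whose braiding on `H ⊗ H` is `D.braiding`.  The associativity and the unitality of the product are
those of the algebra `H`; the last group of axioms says that all structure maps (including the
braiding itself) are braided linear maps. -/
structure IsBraidedHopfAlgebra (D : BraidedHopfData F H) : Prop where
  -- coalgebra
  coassoc : (TensorProduct.assoc F H H H).toLinearMap ∘ₗ D.comul.rTensor H ∘ₗ D.comul =
    D.comul.lTensor H ∘ₗ D.comul
  counit_left : (TensorProduct.lid F H).toLinearMap ∘ₗ D.counit.rTensor H ∘ₗ D.comul =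
    LinearMap.id
  counit_right : (TensorProduct.rid F H).toLinearMap ∘ₗ D.counit.lTensor H ∘ₗ D.comul =
    LinearMap.id
  -- the coproduct and the counit are compatible with the product and the unit
  comul_mul : D.comul ∘ₗ LinearMap.mul' F H = D.braidedMul ∘ₗ TensorProduct.map D.comul D.comul
  comul_one : D.comul 1 = 1 ⊗ₜ[F] 1
  counit_mul : ∀ x y : H, D.counit (x * y) = D.counit x * D.counit y
  counit_one : D.counit 1 = 1
  -- antipode
  antipode_left : LinearMap.mul' F H ∘ₗ D.antipode.rTensor H ∘ₗ D.comul =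
    Algebra.linearMap F H ∘ₗ D.counit
  antipode_right : LinearMap.mul' F H ∘ₗ D.antipode.lTensor H ∘ₗ D.comul =
    Algebra.linearMap F H ∘ₗ D.counit
  -- braided linearity of the structure maps
  isBraiding : IsBraiding D.braiding
  braiding_one_left : ∀ x : H, D.braiding (1 ⊗ₜ[F] x) = x ⊗ₜ[F] 1
  braiding_one_right : ∀ x : H, D.braiding (x ⊗ₜ[F] 1) = 1 ⊗ₜ[F] x
  braiding_mul_left : D.braiding ∘ₗ (LinearMap.mul' F H).rTensor H =
    (LinearMap.mul' F H).lTensor H ∘ₗ (TensorProduct.assoc F H H H).toLinearMap ∘ₗ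
      onFirst D.braiding ∘ₗ onSecond D.braiding
  braiding_mul_right : D.braiding ∘ₗ (LinearMap.mul' F H).lTensor H ∘ₗ
      (TensorProduct.assoc F H H H).toLinearMap =
    (LinearMap.mul' F H).rTensor H ∘ₗ onSecond D.braiding ∘ₗ onFirst D.braiding
  braiding_counit_left : (TensorProduct.lid F H).toLinearMap ∘ₗ D.counit.rTensor H ∘ₗ D.braiding =
    (TensorProduct.rid F H).toLinearMap ∘ₗ D.counit.lTensor H
  braiding_counit_right : (TensorProduct.rid F H).toLinearMap ∘ₗ D.counit.lTensor H ∘ₗ D.braiding =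
    (TensorProduct.lid F H).toLinearMap ∘ₗ D.counit.rTensor H
  braiding_comul_left : D.comul.rTensor H ∘ₗ D.braiding =
    onSecond D.braiding ∘ₗ onFirst D.braiding ∘ₗ
      (TensorProduct.assoc F H H H).symm.toLinearMap ∘ₗ D.comul.lTensor H
  braiding_comul_right :
    (TensorProduct.assoc F H H H).symm.toLinearMap ∘ₗ D.comul.lTensor H ∘ₗ D.braiding =
    onFirst D.braiding ∘ₗ onSecond D.braiding ∘ₗ D.comul.rTensor H
  braiding_antipode_left : D.braiding ∘ₗ D.antipode.rTensor H = D.antipode.lTensor H ∘ₗ D.braiding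
  braiding_antipode_right : D.braiding ∘ₗ D.antipode.lTensor H = D.antipode.rTensor H ∘ₗ D.braiding

/-- `x` is primitive: `Δ x = x ⊗ 1 + 1 ⊗ x`. -/
def IsPrimitive (D : BraidedHopfData F H) (x : H) : Prop :=
  D.comul x = x ⊗ₜ[F] 1 + 1 ⊗ₜ[F] x

/-- The algebra map `f` commutes with the braidings, coproducts, counits and antipodes. -/
structure IsHom {H' : Type*} [Ring H'] [Algebra F H']
    (D : BraidedHopfData F H) (D' : BraidedHopfData F H') (f : H →ₐ[F] H') : Prop where
  braiding : D'.braiding ∘ₗ TensorProduct.map f.toLinearMap f.toLinearMap =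
    TensorProduct.map f.toLinearMap f.toLinearMap ∘ₗ D.braiding
  comul : D'.comul ∘ₗ f.toLinearMap = TensorProduct.map f.toLinearMap f.toLinearMap ∘ₗ D.comul
  counit : D'.counit ∘ₗ f.toLinearMap = D.counit
  antipode : D'.antipode ∘ₗ f.toLinearMap = f.toLinearMap ∘ₗ D.antipode

/-- With respect to the linear map `j : V → H`, the data `D` make `H` a braided Hopf algebra in
which all elements of `V` are primitive and whose braiding is induced by `τ`. -/
structure IsInducedBy {V : Type*} [AddCommGroup V] [Module F V] (D : BraidedHopfData F H)
    (j : V →ₗ[F] H) (τ : V ⊗[F] V →ₗ[F] V ⊗[F] V) : Prop where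
  isBraidedHopfAlgebra : D.IsBraidedHopfAlgebra
  isPrimitive : ∀ v : V, D.IsPrimitive (j v)
  braiding : D.braiding ∘ₗ TensorProduct.map j j = TensorProduct.map j j ∘ₗ τ

end BraidedHopfData

/-! ### Hopf ideals and quotients -/

section Quotient

variable {F H : Type*} [Field F] [Ring H] [Algebra F H]

/-- The subspace `J ⊗ H` of `H ⊗ H`. -/
def tensorLeft (F : Type*) {H : Type*} [Field F] [Ring H] [Algebra F H] (J : Ideal H) :
    Submodule F (H ⊗[F] H) :=
  LinearMap.range ((J.restrictScalars F).subtype.rTensor H)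

/-- The subspace `H ⊗ J` of `H ⊗ H`. -/
def tensorRight (F : Type*) {H : Type*} [Field F] [Ring H] [Algebra F H] (J : Ideal H) :
    Submodule F (H ⊗[F] H) :=
  LinearMap.range ((J.restrictScalars F).subtype.lTensor H)

/-- Hopf ideals of a braided Hopf algebra: two-sided ideals `J` with `Δ J ⊆ J ⊗ H + H ⊗ J`,
`ε J = 0` and `S J ⊆ J`, which are compatible with the braiding in the sense that it exchanges
`J ⊗ H` and `H ⊗ J`, so that all structure maps descend to `H / J`. -/
structure IsHopfIdeal (D : BraidedHopfData F H) (J : Ideal H) : Prop where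
  isTwoSided : J.IsTwoSided
  comul_mem : ∀ x ∈ J, D.comul x ∈ tensorLeft F J ⊔ tensorRight F J
  counit_eq_zero : ∀ x ∈ J, D.counit x = 0
  antipode_mem : ∀ x ∈ J, D.antipode x ∈ J
  map_braiding_left : (tensorLeft F J).map D.braiding = tensorRight F J
  map_braiding_right : (tensorRight F J).map D.braiding = tensorLeft F J

/-- The factorisation of `f` through a surjective linear map `g`. -/
def descend {M N P : Type*} [AddCommGroup M] [Module F M] [AddCommGroup N] [Module F N]
    [AddCommGroup P] [Module F P] (g : M →ₗ[F] N) (hg : Function.Surjective g)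
    (f : M →ₗ[F] P) (h : LinearMap.ker g ≤ LinearMap.ker f) : N →ₗ[F] P :=
  (LinearMap.ker g).liftQ f h ∘ₗ (g.quotKerEquivOfSurjective hg).symm.toLinearMap

theorem descend_apply {M N P : Type*} [AddCommGroup M] [Module F M] [AddCommGroup N] [Module F N]
    [AddCommGroup P] [Module F P] (g : M →ₗ[F] N) (hg : Function.Surjective g)
    (f : M →ₗ[F] P) (h : LinearMap.ker g ≤ LinearMap.ker f) (x : M) :
    descend g hg f h (g x) = f x := by
  have : (g.quotKerEquivOfSurjective hg).symm (g x) = (LinearMap.ker g).mkQ x := by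
    rw [LinearEquiv.symm_apply_eq]; rfl
  simp [descend, this]

/-- The projection `H → H / J` as a linear map. -/
def projection (F : Type*) {H : Type*} [Field F] [Ring H] [Algebra F H] (J : Ideal H)
    [J.IsTwoSided] : H →ₗ[F] H ⧸ J :=
  (Ideal.Quotient.mkₐ F J).toLinearMap

theorem projection_surjective (J : Ideal H) [J.IsTwoSided] :
    Function.Surjective (projection F J) :=
  Ideal.Quotient.mkₐ_surjective F J

theorem mem_ker_projection (J : Ideal H) [J.IsTwoSided] (x : H) :
    x ∈ LinearMap.ker (projection F J) ↔ x ∈ J := by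
  simp [projection, Ideal.Quotient.eq_zero_iff_mem]

theorem ker_map_projection (J : Ideal H) [J.IsTwoSided] :
    LinearMap.ker (TensorProduct.map (projection F J) (projection F J)) =
      tensorLeft F J ⊔ tensorRight F J := by
  have hex : Function.Exact (J.restrictScalars F).subtype (projection F J) := by
    intro x
    rw [← LinearMap.mem_ker, mem_ker_projection]
    simp
  rw [TensorProduct.map_ker hex (projection_surjective J) hex (projection_surjective J), sup_comm]
  rfl

theorem IsHopfIdeal.braiding_descends {D : BraidedHopfData F H} {J : Ideal H} [J.IsTwoSided]
    (hJ : IsHopfIdeal D J) :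
    LinearMap.ker (TensorProduct.map (projection F J) (projection F J)) ≤
      LinearMap.ker (TensorProduct.map (projection F J) (projection F J) ∘ₗ D.braiding) := by
  rw [LinearMap.ker_comp, ker_map_projection, ← Submodule.map_le_iff_le_comap,
    Submodule.map_sup, hJ.map_braiding_left, hJ.map_braiding_right, sup_comm]

theorem IsHopfIdeal.comul_descends {D : BraidedHopfData F H} {J : Ideal H} [J.IsTwoSided]
    (hJ : IsHopfIdeal D J) :
    LinearMap.ker (projection F J) ≤
      LinearMap.ker (TensorProduct.map (projection F J) (projection F J) ∘ₗ D.comul) := by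
  intro x hx
  rw [LinearMap.ker_comp, ker_map_projection]
  exact hJ.comul_mem x ((mem_ker_projection J x).1 hx)

theorem IsHopfIdeal.counit_descends {D : BraidedHopfData F H} {J : Ideal H} [J.IsTwoSided]
    (hJ : IsHopfIdeal D J) : LinearMap.ker (projection F J) ≤ LinearMap.ker D.counit :=
  fun x hx => hJ.counit_eq_zero x ((mem_ker_projection J x).1 hx)

theorem IsHopfIdeal.antipode_descends {D : BraidedHopfData F H} {J : Ideal H} [J.IsTwoSided]
    (hJ : IsHopfIdeal D J) :
    LinearMap.ker (projection F J) ≤ LinearMap.ker (projection F J ∘ₗ D.antipode) := by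
  intro x hx
  rw [LinearMap.ker_comp]
  exact (mem_ker_projection J _).2 (hJ.antipode_mem x ((mem_ker_projection J x).1 hx))

/-- The structure maps induced on the quotient by a Hopf ideal. -/
def quotientData (D : BraidedHopfData F H) (J : Ideal H) [J.IsTwoSided] (hJ : IsHopfIdeal D J) :
    BraidedHopfData F (H ⧸ J) where
  braiding := descend (TensorProduct.map (projection F J) (projection F J))
    (TensorProduct.map_surjective (projection_surjective J) (projection_surjective J))
    (TensorProduct.map (projection F J) (projection F J) ∘ₗ D.braiding) hJ.braiding_descends
  comul := descend (projection F J) (projection_surjective J)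
    (TensorProduct.map (projection F J) (projection F J) ∘ₗ D.comul) hJ.comul_descends
  counit := descend (projection F J) (projection_surjective J) D.counit hJ.counit_descends
  antipode := descend (projection F J) (projection_surjective J) (projection F J ∘ₗ D.antipode)
    hJ.antipode_descends

/-- The projection onto the quotient by a Hopf ideal commutes with all structure maps. -/
theorem quotientData_isHom (D : BraidedHopfData F H) (J : Ideal H) [J.IsTwoSided]
    (hJ : IsHopfIdeal D J) :
    BraidedHopfData.IsHom D (quotientData D J hJ) (Ideal.Quotient.mkₐ F J) := by
  constructor <;> refine LinearMap.ext fun x => ?_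
  · exact descend_apply (TensorProduct.map (projection F J) (projection F J))
      (TensorProduct.map_surjective (projection_surjective J) (projection_surjective J))
      (TensorProduct.map (projection F J) (projection F J) ∘ₗ D.braiding) hJ.braiding_descends x
  · exact descend_apply (projection F J) (projection_surjective J)
      (TensorProduct.map (projection F J) (projection F J) ∘ₗ D.comul) hJ.comul_descends x
  · exact descend_apply (projection F J) (projection_surjective J) D.counit hJ.counit_descends x
  · exact descend_apply (projection F J) (projection_surjective J)
      (projection F J ∘ₗ D.antipode) hJ.antipode_descends x

theorem tensorLeft_mono {J K : Ideal H} (h : J ≤ K) : tensorLeft F J ≤ tensorLeft F K := by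
  rintro _ ⟨z, rfl⟩
  refine ⟨(Submodule.inclusion (p := J.restrictScalars F) (p' := K.restrictScalars F) h).rTensor
    H z, ?_⟩
  rw [← LinearMap.comp_apply, ← LinearMap.rTensor_comp]
  rfl

theorem tensorRight_mono {J K : Ideal H} (h : J ≤ K) : tensorRight F J ≤ tensorRight F K := by
  rintro _ ⟨z, rfl⟩
  refine ⟨(Submodule.inclusion (p := J.restrictScalars F) (p' := K.restrictScalars F) h).lTensor
    H z, ?_⟩
  rw [← LinearMap.comp_apply, ← LinearMap.lTensor_comp]
  rfl

theorem tensorLeft_sSup (s : Set (Ideal H)) :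
    tensorLeft F (sSup s) = ⨆ J ∈ s, tensorLeft F J := by
  refine le_antisymm ?_ (iSup₂_le fun J hJ => tensorLeft_mono (le_sSup hJ))
  rintro _ ⟨z, rfl⟩
  induction z with
  | zero => simp
  | add x y hx hy => rw [map_add]; exact add_mem hx hy
  | tmul x y =>
    obtain ⟨x, hx⟩ := x
    have hx' : x ∈ sSup s := hx
    change x ⊗ₜ[F] y ∈ _
    rw [sSup_eq_iSup'] at hx'
    induction hx' using Submodule.iSup_induction' with
    | zero => simp
    | add a b ha hb iha ihb =>
      rw [TensorProduct.add_tmul]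
      exact add_mem (iha (by rw [sSup_eq_iSup']; exact ha)) (ihb (by rw [sSup_eq_iSup']; exact hb))
    | mem i a ha =>
      exact (le_iSup₂_of_le (f := fun J (_ : J ∈ s) => tensorLeft F J) i.1 i.2 le_rfl)
        ⟨⟨a, ha⟩ ⊗ₜ y, rfl⟩

theorem tensorRight_sSup (s : Set (Ideal H)) :
    tensorRight F (sSup s) = ⨆ J ∈ s, tensorRight F J := by
  refine le_antisymm ?_ (iSup₂_le fun J hJ => tensorRight_mono (le_sSup hJ))
  rintro _ ⟨z, rfl⟩
  induction z with
  | zero => simp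
  | add x y hx hy => rw [map_add]; exact add_mem hx hy
  | tmul y x =>
    obtain ⟨x, hx⟩ := x
    have hx' : x ∈ sSup s := hx
    change y ⊗ₜ[F] x ∈ _
    rw [sSup_eq_iSup'] at hx'
    induction hx' using Submodule.iSup_induction' with
    | zero => simp
    | add a b ha hb iha ihb =>
      rw [TensorProduct.tmul_add]
      exact add_mem (iha (by rw [sSup_eq_iSup']; exact ha)) (ihb (by rw [sSup_eq_iSup']; exact hb))
    | mem i a ha =>
      exact (le_iSup₂_of_le (f := fun J (_ : J ∈ s) => tensorRight F J) i.1 i.2 le_rfl)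
        ⟨y ⊗ₜ ⟨a, ha⟩, rfl⟩

/-- A sum of Hopf ideals is a Hopf ideal. -/
theorem isHopfIdeal_sSup (D : BraidedHopfData F H) (s : Set (Ideal H))
    (hs : ∀ J ∈ s, IsHopfIdeal D J) : IsHopfIdeal D (sSup s) where
  isTwoSided := ⟨fun {a} b ha => by
    rw [sSup_eq_iSup'] at ha ⊢
    induction ha using Submodule.iSup_induction' with
    | zero => simp
    | add x y hx hy ihx ihy => rw [add_mul]; exact add_mem ihx ihy
    | mem i x hx =>
      exact Submodule.mem_iSup_of_mem i ((hs i.1 i.2).isTwoSided.mul_mem_of_left b hx)⟩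
  comul_mem x hx := by
    rw [sSup_eq_iSup'] at hx
    induction hx using Submodule.iSup_induction' with
    | zero => simp
    | add x y hx hy ihx ihy => rw [map_add]; exact add_mem ihx ihy
    | mem i x hx =>
      have h : tensorLeft F i.1 ⊔ tensorRight F i.1 ≤
          tensorLeft F (sSup s) ⊔ tensorRight F (sSup s) :=
        sup_le_sup (tensorLeft_mono (le_sSup i.2)) (tensorRight_mono (le_sSup i.2))
      exact h ((hs i.1 i.2).comul_mem x hx)
  counit_eq_zero x hx := by
    rw [sSup_eq_iSup'] at hx
    induction hx using Submodule.iSup_induction' with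
    | zero => simp
    | add x y hx hy ihx ihy => rw [map_add, ihx, ihy, add_zero]
    | mem i x hx => exact (hs i.1 i.2).counit_eq_zero x hx
  antipode_mem x hx := by
    rw [sSup_eq_iSup'] at hx ⊢
    induction hx using Submodule.iSup_induction' with
    | zero => simp
    | add x y hx hy ihx ihy => rw [map_add]; exact add_mem ihx ihy
    | mem i x hx => exact Submodule.mem_iSup_of_mem i ((hs i.1 i.2).antipode_mem x hx)
  map_braiding_left := by
    rw [tensorLeft_sSup, tensorRight_sSup, Submodule.map_iSup]
    refine iSup_congr fun J => ?_
    rw [Submodule.map_iSup]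
    exact iSup_congr fun hJ => (hs J hJ).map_braiding_left
  map_braiding_right := by
    rw [tensorLeft_sSup, tensorRight_sSup, Submodule.map_iSup]
    refine iSup_congr fun J => ?_
    rw [Submodule.map_iSup]
    exact iSup_congr fun hJ => (hs J hJ).map_braiding_right

end Quotient

/-! ### The braided Hopf algebra `T(V)` and the Nichols algebra -/

section Tensor

open TensorAlgebra (ι)

variable {F V : Type*} [Field F] [AddCommGroup V] [Module F V]

/-- The linear map `(T(V) ⊗ V) ⊗ V → T(V) ⊗ V` that sends `(t ⊗ v) ⊗ w` to `∑ (t * wᵢ) ⊗ vᵢ`, where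
`τ (v ⊗ w) = ∑ wᵢ ⊗ vᵢ`. -/
def stepRight (τ : V ⊗[F] V →ₗ[F] V ⊗[F] V) :
    (TensorAlgebra F V ⊗[F] V) ⊗[F] V →ₗ[F] TensorAlgebra F V ⊗[F] V :=
  (LinearMap.mul' F (TensorAlgebra F V)).rTensor V ∘ₗ
    (TensorProduct.assoc F (TensorAlgebra F V) (TensorAlgebra F V) V).symm.toLinearMap ∘ₗ
    ((ι F).rTensor V ∘ₗ τ).lTensor (TensorAlgebra F V) ∘ₗ
    (TensorProduct.assoc F (TensorAlgebra F V) V V).toLinearMap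

/-- The right action of the algebra `T(V)` on `T(V) ⊗ V` in which elements of `V` act by
`stepRight`. -/
def rightAction (τ : V ⊗[F] V →ₗ[F] V ⊗[F] V) :
    TensorAlgebra F V →ₐ[F] (Module.End F (TensorAlgebra F V ⊗[F] V))ᵐᵒᵖ :=
  TensorAlgebra.lift F
    ((MulOpposite.opLinearEquiv F).toLinearMap ∘ₗ (TensorProduct.curry (stepRight τ)).flip)

/-- The braiding `c : V ⊗ T(V) → T(V) ⊗ V` induced by `τ`: `c (v ⊗ y)` is the result of the right
action of `y` on `1 ⊗ v`.  In other words `c (v ⊗ 1) = 1 ⊗ v`, and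
`c (v ⊗ w y) = (∇ ⊗ id) (id ⊗ c) (τ (v ⊗ w) ⊗ y)` for `v, w ∈ V`. -/
def braidVector (τ : V ⊗[F] V →ₗ[F] V ⊗[F] V) :
    V ⊗[F] TensorAlgebra F V →ₗ[F] TensorAlgebra F V ⊗[F] V :=
  TensorProduct.lift <| LinearMap.flip <|
    LinearMap.lcomp F (TensorAlgebra F V ⊗[F] V) (TensorProduct.mk F (TensorAlgebra F V) V 1) ∘ₗ
      (MulOpposite.opLinearEquiv F).symm.toLinearMap ∘ₗ (rightAction τ).toLinearMap

/-- The linear map `v ⊗ (y ⊗ x) ↦ ∑ yᵢ ⊗ (vᵢ * x)`, where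
`c (v ⊗ y) = ∑ yᵢ ⊗ vᵢ`. -/
def stepLeft (τ : V ⊗[F] V →ₗ[F] V ⊗[F] V) :
    V ⊗[F] (TensorAlgebra F V ⊗[F] TensorAlgebra F V) →ₗ[F]
      TensorAlgebra F V ⊗[F] TensorAlgebra F V :=
  (LinearMap.mul' F (TensorAlgebra F V) ∘ₗ (ι F).rTensor (TensorAlgebra F V)).lTensor
      (TensorAlgebra F V) ∘ₗ
    (TensorProduct.assoc F (TensorAlgebra F V) V (TensorAlgebra F V)).toLinearMap ∘ₗ
    (braidVector τ).rTensor (TensorAlgebra F V) ∘ₗ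
    (TensorProduct.assoc F V (TensorAlgebra F V) (TensorAlgebra F V)).symm.toLinearMap

/-- The left action of the algebra `T(V)` on `T(V) ⊗ T(V)` in which elements of `V` act by
`stepLeft`. -/
def leftAction (τ : V ⊗[F] V →ₗ[F] V ⊗[F] V) :
    TensorAlgebra F V →ₐ[F] Module.End F (TensorAlgebra F V ⊗[F] TensorAlgebra F V) :=
  TensorAlgebra.lift F (TensorProduct.curry (stepLeft τ))

/-- The braiding `τ̂` of `T(V)` induced by `τ`: `τ̂ (x ⊗ y)` is the result of the left action of `x`
on `y ⊗ 1`.  In other words `τ̂ (1 ⊗ y) = y ⊗ 1`, and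
`τ̂ (v x ⊗ y) = (id ⊗ ∇) (c ⊗ id) (v ⊗ τ̂ (x ⊗ y))` for `v ∈ V`. -/
def tensorBraiding (τ : V ⊗[F] V →ₗ[F] V ⊗[F] V) :
    TensorAlgebra F V ⊗[F] TensorAlgebra F V →ₗ[F] TensorAlgebra F V ⊗[F] TensorAlgebra F V :=
  TensorProduct.lift <|
    LinearMap.lcomp F (TensorAlgebra F V ⊗[F] TensorAlgebra F V)
      ((TensorProduct.mk F (TensorAlgebra F V) (TensorAlgebra F V)).flip 1) ∘ₗ
      (leftAction τ).toLinearMap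

/-- Left multiplication by `v ⊗ 1 + 1 ⊗ v` in the algebra `T(V) ⊗ T(V)` with the product twisted by
`τ̂`: the linear map `v ⊗ (x ⊗ y) ↦ v x ⊗ y + τ̂ (v ⊗ x) (1 ⊗ y)`. -/
def primitiveMul (τ : V ⊗[F] V →ₗ[F] V ⊗[F] V) :
    V ⊗[F] (TensorAlgebra F V ⊗[F] TensorAlgebra F V) →ₗ[F]
      TensorAlgebra F V ⊗[F] TensorAlgebra F V :=
  ((LinearMap.mul' F (TensorAlgebra F V)).rTensor (TensorAlgebra F V) +
      (LinearMap.mul' F (TensorAlgebra F V)).lTensor (TensorAlgebra F V) ∘ₗ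
        (TensorProduct.assoc F (TensorAlgebra F V) (TensorAlgebra F V)
          (TensorAlgebra F V)).toLinearMap ∘ₗ
        (tensorBraiding τ).rTensor (TensorAlgebra F V)) ∘ₗ
    ((ι F).rTensor (TensorAlgebra F V)).rTensor (TensorAlgebra F V) ∘ₗ
    (TensorProduct.assoc F V (TensorAlgebra F V) (TensorAlgebra F V)).symm.toLinearMap

/-- The coproduct of `T(V)`: it is multiplicative for the product of `T(V) ⊗ T(V)` twisted by `τ̂`,
and `Δ v = v ⊗ 1 + 1 ⊗ v` for `v ∈ V`.  In other words `Δ 1 = 1 ⊗ 1` and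
`Δ (v x) = (v ⊗ 1 + 1 ⊗ v) Δ x`. -/
def tensorComul (τ : V ⊗[F] V →ₗ[F] V ⊗[F] V) :
    TensorAlgebra F V →ₗ[F] TensorAlgebra F V ⊗[F] TensorAlgebra F V :=
  LinearMap.applyₗ (1 ⊗ₜ[F] 1) ∘ₗ
    (TensorAlgebra.lift F (TensorProduct.curry (primitiveMul τ))).toLinearMap

/-- The antipode of `T(V)`: it is determined by `S 1 = 1`, `S v = -v` for `v ∈ V`, and
`S ∇ = ∇ τ̂ (S ⊗ S)`.  In other words `S (v x) = -∇ (τ̂ (v ⊗ S x))` for `v ∈ V`. -/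
def tensorAntipode (τ : V ⊗[F] V →ₗ[F] V ⊗[F] V) :
    TensorAlgebra F V →ₗ[F] TensorAlgebra F V :=
  LinearMap.applyₗ 1 ∘ₗ
    (TensorAlgebra.lift F (TensorProduct.curry
      (-(LinearMap.mul' F (TensorAlgebra F V) ∘ₗ tensorBraiding τ ∘ₗ
        (ι F).rTensor (TensorAlgebra F V))))).toLinearMap

/-- The structure maps of the braided Hopf algebra `T(V)` of a braided vector space `(V, τ)`. -/
def tensorData (τ : V ⊗[F] V →ₗ[F] V ⊗[F] V) : BraidedHopfData F (TensorAlgebra F V) where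
  braiding := tensorBraiding τ
  comul := tensorComul τ
  counit := TensorAlgebra.algebraMapInv.toLinearMap
  antipode := tensorAntipode τ

/-! The recursive descriptions stated in the comments above. -/

theorem braidVector_one (τ : V ⊗[F] V →ₗ[F] V ⊗[F] V) (v : V) :
    braidVector τ (v ⊗ₜ 1) = 1 ⊗ₜ v := by
  simp [braidVector]

theorem braidVector_ι_mul (τ : V ⊗[F] V →ₗ[F] V ⊗[F] V) (v w : V) (y : TensorAlgebra F V) :
    braidVector τ (v ⊗ₜ (ι F w * y)) =
      (LinearMap.mul' F (TensorAlgebra F V)).rTensor V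
        ((TensorProduct.assoc F (TensorAlgebra F V) (TensorAlgebra F V) V).symm
          (TensorProduct.map (ι F) (braidVector τ)
            (TensorProduct.assoc F V V (TensorAlgebra F V) (τ (v ⊗ₜ w) ⊗ₜ y)))) := by
  have key : ∀ (t : TensorAlgebra F V) (z : TensorAlgebra F V ⊗[F] V),
      ((rightAction τ y).unop (((LinearMap.mulLeft F t).rTensor V) z)) =
        (LinearMap.mulLeft F t).rTensor V ((rightAction τ y).unop z) := by
    intro t
    induction y using TensorAlgebra.induction with
    | algebraMap r => intro z; simp [AlgHom.commutes, MulOpposite.algebraMap_apply]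
    | ι x =>
      intro z
      induction z with
      | zero => simp
      | add a b ha hb => simp only [map_add, ha, hb]
      | tmul s u =>
        simp only [rightAction, TensorAlgebra.lift_ι_apply, LinearMap.comp_apply,
          LinearEquiv.coe_coe, MulOpposite.coe_opLinearEquiv, MulOpposite.unop_op,
          LinearMap.flip_apply, TensorProduct.curry_apply, LinearMap.rTensor_tmul, stepRight,
          TensorProduct.assoc_tmul, LinearMap.lTensor_tmul]
        induction τ (u ⊗ₜ x) with
        | zero => simp
        | add a b ha hb => simp only [map_add, TensorProduct.tmul_add, ha, hb]
        | tmul a b => simp [mul_assoc]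
    | mul a b ha hb => intro z; simp [ha, hb]
    | add a b ha hb => intro z; simp [ha, hb]
  simp only [braidVector, TensorProduct.lift.tmul, LinearMap.flip_apply, LinearMap.comp_apply,
    AlgHom.toLinearMap_apply, map_mul, LinearEquiv.coe_coe, LinearMap.lcomp_apply,
    TensorProduct.mk_apply, MulOpposite.coe_opLinearEquiv_symm, MulOpposite.unop_mul,
    Module.End.mul_apply]
  conv_lhs => enter [2]; simp only [rightAction, TensorAlgebra.lift_ι_apply, LinearMap.comp_apply,
          LinearEquiv.coe_coe, MulOpposite.coe_opLinearEquiv, MulOpposite.unop_op,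
          LinearMap.flip_apply, TensorProduct.curry_apply, LinearMap.rTensor_tmul, stepRight,
          TensorProduct.assoc_tmul, LinearMap.lTensor_tmul]
  induction τ (v ⊗ₜ w) with
  | zero => simp
  | add a b ha hb => simp only [map_add, TensorProduct.tmul_add, TensorProduct.add_tmul, ha, hb]
  | tmul a b =>
    have := key (ι F a) (1 ⊗ₜ b)
    simp only [LinearMap.rTensor_tmul, LinearMap.mulLeft_apply, mul_one] at this
    simp [this]
    induction ((rightAction τ y).unop (1 ⊗ₜ b)) with
    | zero => simp
    | add a b ha hb => simp only [map_add, TensorProduct.tmul_add, ha, hb]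
    | tmul a b => simp

theorem tensorBraiding_one (τ : V ⊗[F] V →ₗ[F] V ⊗[F] V) (y : TensorAlgebra F V) :
    tensorBraiding τ (1 ⊗ₜ y) = y ⊗ₜ 1 := by
  simp [tensorBraiding]

theorem tensorBraiding_ι_mul (τ : V ⊗[F] V →ₗ[F] V ⊗[F] V) (v : V) (x y : TensorAlgebra F V) :
    tensorBraiding τ ((ι F v * x) ⊗ₜ y) = stepLeft τ (v ⊗ₜ tensorBraiding τ (x ⊗ₜ y)) := by
  simp [tensorBraiding, leftAction]

theorem tensorBraiding_ι_ι (τ : V ⊗[F] V →ₗ[F] V ⊗[F] V) (v w : V) :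
    tensorBraiding τ (ι F v ⊗ₜ ι F w) = TensorProduct.map (ι F) (ι F) (τ (v ⊗ₜ w)) := by
  have h := tensorBraiding_ι_mul τ v 1 (ι F w)
  have h' := braidVector_ι_mul τ v w 1
  rw [mul_one] at h h'
  rw [h, tensorBraiding_one]
  simp only [stepLeft, LinearMap.comp_apply, LinearEquiv.coe_coe, TensorProduct.assoc_symm_tmul,
    LinearMap.rTensor_tmul, h']
  induction τ (v ⊗ₜ w) with
  | zero => simp
  | add a b ha hb => simp only [map_add, TensorProduct.add_tmul, ha, hb]
  | tmul a b => simp [braidVector_one]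

theorem tensorComul_one (τ : V ⊗[F] V →ₗ[F] V ⊗[F] V) : tensorComul τ 1 = 1 ⊗ₜ 1 := by
  simp [tensorComul]

theorem tensorComul_ι_mul (τ : V ⊗[F] V →ₗ[F] V ⊗[F] V) (v : V) (x : TensorAlgebra F V) :
    tensorComul τ (ι F v * x) = primitiveMul τ (v ⊗ₜ tensorComul τ x) := by
  simp [tensorComul]

theorem tensorComul_ι (τ : V ⊗[F] V →ₗ[F] V ⊗[F] V) (v : V) :
    tensorComul τ (ι F v) = ι F v ⊗ₜ 1 + 1 ⊗ₜ ι F v := by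
  have h := tensorComul_ι_mul τ v 1
  have h1 := tensorBraiding_ι_mul τ v 1 1
  rw [mul_one] at h h1
  rw [h, tensorComul_one]
  simp [primitiveMul, h1, tensorBraiding_one, stepLeft, braidVector_one]

theorem tensorAntipode_one (τ : V ⊗[F] V →ₗ[F] V ⊗[F] V) : tensorAntipode τ 1 = 1 := by
  simp [tensorAntipode]

theorem tensorAntipode_ι_mul (τ : V ⊗[F] V →ₗ[F] V ⊗[F] V) (v : V) (x : TensorAlgebra F V) :
    tensorAntipode τ (ι F v * x) =
      -LinearMap.mul' F (TensorAlgebra F V) (tensorBraiding τ (ι F v ⊗ₜ tensorAntipode τ x)) := by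
  simp [tensorAntipode]

/-! The Nichols algebra. -/

/-- The grading of `T(V)`: its component of degree `n` is `Tⁿ(V)`. -/
abbrev tensorGrading (F V : Type*) [Field F] [AddCommGroup V] [Module F V] :
    ℕ → Submodule F (TensorAlgebra F V) :=
  (LinearMap.range (ι F : V →ₗ[F] TensorAlgebra F V) ^ ·)

/-- The ideals of which `𝔍_V` is the largest one: the homogeneous Hopf ideals of `T(V)` that
intersect `V` trivially. -/
structure IsNicholsCandidate (τ : V ⊗[F] V →ₗ[F] V ⊗[F] V) (J : Ideal (TensorAlgebra F V)) :
    Prop where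
  isHopfIdeal : IsHopfIdeal (tensorData τ) J
  isHomogeneous : J.IsHomogeneous (tensorGrading F V)
  trivial_inter : ∀ v : V, ι F v ∈ J → ι F v = 0

/-- The ideal `𝔍_V` of `T(V)`. -/
def nicholsIdeal (τ : V ⊗[F] V →ₗ[F] V ⊗[F] V) : Ideal (TensorAlgebra F V) :=
  sSup {J | IsNicholsCandidate τ J}

theorem nicholsIdeal_isHopfIdeal (τ : V ⊗[F] V →ₗ[F] V ⊗[F] V) :
    IsHopfIdeal (tensorData τ) (nicholsIdeal τ) :=
  isHopfIdeal_sSup _ _ fun _ hJ => hJ.isHopfIdeal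

instance (τ : V ⊗[F] V →ₗ[F] V ⊗[F] V) : (nicholsIdeal τ).IsTwoSided :=
  (nicholsIdeal_isHopfIdeal τ).isTwoSided

/-- `𝔍_V` is the largest homogeneous Hopf ideal of `T(V)` that intersects `V` trivially. -/
theorem nicholsIdeal_isGreatest (τ : V ⊗[F] V →ₗ[F] V ⊗[F] V) :
    IsGreatest {J | IsNicholsCandidate τ J} (nicholsIdeal τ) := by
  refine ⟨⟨nicholsIdeal_isHopfIdeal τ, ?_, ?_⟩, fun J hJ => le_sSup hJ⟩
  · rw [nicholsIdeal, sSup_eq_iSup']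
    exact Ideal.IsHomogeneous.iSup fun J => J.2.isHomogeneous
  · intro v hv
    -- every candidate is annihilated by the projection onto degree one
    have hproj : ∀ x ∈ nicholsIdeal τ, GradedRing.proj (tensorGrading F V) 1 x = 0 := by
      intro x hx
      rw [nicholsIdeal, sSup_eq_iSup'] at hx
      induction hx using Submodule.iSup_induction' with
      | zero => simp
      | add x y hx hy ihx ihy => rw [map_add, ihx, ihy, add_zero]
      | mem i x hx =>
        have h1 : GradedRing.proj (tensorGrading F V) 1 x ∈ i.1 := i.2.isHomogeneous 1 hx
        have h2 : GradedRing.proj (tensorGrading F V) 1 x ∈ tensorGrading F V 1 :=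
          SetLike.coe_mem _
        simp only [tensorGrading, pow_one] at h2
        obtain ⟨w, hw⟩ := h2
        rw [← hw] at h1 ⊢
        exact i.2.trivial_inter w h1
    have h := hproj _ hv
    rw [GradedRing.proj_apply, DirectSum.decompose_of_mem_same] at h
    · exact h
    · simp [tensorGrading]

/-- The Nichols algebra `𝔅(V) = T(V) / 𝔍_V` of `(V, τ)`. -/
abbrev NicholsAlgebra (τ : V ⊗[F] V →ₗ[F] V ⊗[F] V) : Type _ :=
  TensorAlgebra F V ⧸ nicholsIdeal τ

/-- The structure maps of `𝔅(V)`, induced by those of `T(V)`. -/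
def nicholsData (τ : V ⊗[F] V →ₗ[F] V ⊗[F] V) : BraidedHopfData F (NicholsAlgebra τ) :=
  quotientData (tensorData τ) (nicholsIdeal τ) (nicholsIdeal_isHopfIdeal τ)

end Tensor

/-! ### The braiding attached to a linearly ordered basis -/

section Hecke

variable {F V I : Type*} [Field F] [AddCommGroup V] [Module F V] [LinearOrder I]

/-- The Heaviside symbol: `1` if `a > b` and `0` otherwise. -/
def heaviside (a b : I) : ℕ :=
  if b < a then 1 else 0

/-- The braiding `τ (a ⊗ b) = (p ^ θ(a,b) - 1) a ⊗ b - p ^ θ(b,a) b ⊗ a` on basis vectors. -/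
def heckeBraiding (B : Module.Basis I F V) (p : F) : V ⊗[F] V →ₗ[F] V ⊗[F] V :=
  (B.tensorProduct B).constr F fun ij : I × I =>
    (p ^ heaviside ij.1 ij.2 - 1) • (B ij.1 ⊗ₜ[F] B ij.2) -
      p ^ heaviside ij.2 ij.1 • (B ij.2 ⊗ₜ[F] B ij.1)

theorem heckeBraiding_apply (B : Module.Basis I F V) (p : F) (a b : I) :
    heckeBraiding B p (B a ⊗ₜ B b) =
      (p ^ heaviside a b - 1) • (B a ⊗ₜ[F] B b) - p ^ heaviside b a • (B b ⊗ₜ[F] B a) := by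
  have h := (B.tensorProduct B).constr_basis F (fun ij : I × I =>
    (p ^ heaviside ij.1 ij.2 - 1) • (B ij.1 ⊗ₜ[F] B ij.2) -
      p ^ heaviside ij.2 ij.1 • (B ij.2 ⊗ₜ[F] B ij.1)) (a, b)
  rwa [Module.Basis.tensorProduct_apply] at h

/-- The Hecke relation `(τ + 1) (τ - p) = 0`. -/
theorem heckeBraiding_hecke (B : Module.Basis I F V) (p : F) :
    heckeBraiding B p ∘ₗ heckeBraiding B p =
      (p - 1) • heckeBraiding B p + p • LinearMap.id := by
  refine (B.tensorProduct B).ext fun ij => ?_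
  rcases ij with ⟨a, b⟩
  rw [Module.Basis.tensorProduct_apply]
  simp only [LinearMap.comp_apply, LinearMap.add_apply, LinearMap.smul_apply, LinearMap.id_apply,
    heckeBraiding_apply, map_sub, map_smul]
  rcases lt_trichotomy a b with h | rfl | h
  · simp only [heaviside, h, h.not_gt, if_true, if_false]; module
  · simp only [heaviside, lt_irrefl, if_false]; module
  · simp only [heaviside, h, h.not_gt, if_true, if_false]; module

/-- `(V, τ)` is a braided vector space. -/
theorem heckeBraiding_isBraiding (B : Module.Basis I F V) (p : F) (hp : p ≠ 0) :
    IsBraiding (heckeBraiding B p) where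
  bijective := by
    have h := heckeBraiding_hecke B p
    have h' : ∀ x, heckeBraiding B p (heckeBraiding B p x) =
        (p - 1) • heckeBraiding B p x + p • x := fun x => LinearMap.congr_fun h x
    refine Function.bijective_iff_has_inverse.2
      ⟨fun x => p⁻¹ • (heckeBraiding B p x - (p - 1) • x), fun x => ?_, fun x => ?_⟩
    · simp only [h', add_sub_cancel_left, smul_smul, inv_mul_cancel₀ hp, one_smul]
    · simp only [map_smul, map_sub, h', add_sub_cancel_left, smul_smul, inv_mul_cancel₀ hp,
        one_smul]
  yangBaxter := by
    refine ((B.tensorProduct B).tensorProduct B).ext fun ijk => ?_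
    rcases ijk with ⟨⟨a, b⟩, c⟩
    simp only [Module.Basis.tensorProduct_apply, LinearMap.comp_apply]
    have h1 : ∀ x y z : I, onFirst (heckeBraiding B p) (B x ⊗ₜ B y ⊗ₜ B z) =
        (p ^ heaviside x y - 1) • (B x ⊗ₜ[F] B y ⊗ₜ[F] B z) -
          p ^ heaviside y x • (B y ⊗ₜ[F] B x ⊗ₜ[F] B z) := by
      intro x y z
      simp [onFirst, heckeBraiding_apply, TensorProduct.sub_tmul, TensorProduct.smul_tmul']
    have h2 : ∀ x y z : I, onSecond (heckeBraiding B p) (B x ⊗ₜ B y ⊗ₜ B z) =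
        (p ^ heaviside y z - 1) • (B x ⊗ₜ[F] B y ⊗ₜ[F] B z) -
          p ^ heaviside z y • (B x ⊗ₜ[F] B z ⊗ₜ[F] B y) := by
      intro x y z
      simp [onSecond, heckeBraiding_apply, TensorProduct.tmul_sub]
    simp only [h1, h2, map_sub, map_smul]
    have tri : ∀ x y : I, (x < y ∧ heaviside x y = 0 ∧ heaviside y x = 1) ∨
        (x = y ∧ heaviside x y = 0 ∧ heaviside y x = 0) ∨
        (y < x ∧ heaviside x y = 1 ∧ heaviside y x = 0) := by
      intro x y
      rcases lt_trichotomy x y with h | h | h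
      · simp [heaviside, h, h.not_gt]
      · simp [heaviside, h]
      · simp [heaviside, h, h.not_gt]
    rcases tri a b with ⟨hab, e1, e2⟩ | ⟨hab, e1, e2⟩ | ⟨hab, e1, e2⟩ <;>
      rcases tri b c with ⟨hbc, e3, e4⟩ | ⟨hbc, e3, e4⟩ | ⟨hbc, e3, e4⟩ <;>
      rcases tri a c with ⟨hac, e5, e6⟩ | ⟨hac, e5, e6⟩ | ⟨hac, e5, e6⟩ <;>
      first
      | (exfalso; order)
      | (simp only [e1, e2, e3, e4, e5, e6]; module)
      | (subst_vars; simp only [e1, e2, e3, e4, e5, e6]; module)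

end Hecke

end BraidedHopf

/-! Two properties of τ carry the theorem: `1 + τ` is an alternating map with the right kernel, and
`τ (a ⊗ b) = -p b ⊗ a` whenever `a < b`.

Existence. The kernel of `T(V) → ⋀ V` is the ideal generated by `ker (1 + τ)`: each `v ⊗ v` lies in
that kernel (`heckeBraiding_tmul_self`), and the product `V ⊗ V → ⋀ V` factors through `1 + τ`
(`isQuadraticCover_exterior`). In `T(V)` the coproduct of a quadratic element `r` is `r ⊗ 1 + 1 ⊗ r
+ (1 + τ) r`, so these relations are primitive. By the Yang–Baxter equation, pulling a relation
across any tensor gives relations again. Hence they generate a Hopf ideal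
(`IsQuadraticCover.isHopfIdeal`), and the structure of `T(V)` descends to `⋀ V`.

The axioms themselves are never checked on the quotient. `IsPrimitivelyGenerated` isolates what the
recursive definitions on `T(V)` provide; it passes to quotients and, together with bijectivity of
the braiding, implies every axiom (`IsPrimitivelyGenerated.isBraidedHopfAlgebra`). The proofs are
inductions on left multiplication by a generator, carried out as rewriting of braid words with a
spectator factor `X` on the right.

Uniqueness. Any structure induced by τ makes the surjection `T(V) → ⋀ V` a morphism
(`IsInducedBy.lift_isHom`), and a surjective morphism determines the structure on its target.

Nichols algebra and primitives. Let `∂ : ⋀ V → V ⊗ ⋀ V` be the component of the coproduct with first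
leg in `V`. If `a` is smaller than all elements of `s`, the twisted Leibniz rule gives `∂ (a ∧ e_s)
= a ⊗ e_s` plus a combination of terms `b ⊗ e_{a ∪ u}` with `b > a`. The map that sends `b ⊗ e_u` to
`e_{b ∪ u}` when `b < u` and to `0` otherwise therefore recovers `x - ε(x)` from `∂ x`
(`eq_algebraMap_add_integral`). This triangularity needs no division, so the characteristic of the
field and the order of `p` play no role. A primitive `x` of degree at least two has `ε(x) = 0` and
`∂ x = 0`, hence vanishes.

A homogeneous Hopf ideal `J` that meets `V` trivially has an image in `⋀ V` that is killed by `ε`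
and stable under all partial derivatives. Since these lower the degree, the image is zero, that is,
`J ⊆ ker (T(V) → ⋀ V)`. As this kernel is itself such an ideal, it is `𝔍_V`. -/

namespace BraidedHopf

/-! ### Operators on the leading factors of a right-nested tensor product -/

section Head

variable {F M N : Type*} [Field F] [AddCommGroup M] [Module F M] [AddCommGroup N] [Module F N]
variable {X Y : Type*} [AddCommGroup X] [Module F X] [AddCommGroup Y] [Module F Y]
variable {H : Type*} [Ring H] [Algebra F H]

/-- `β ⊗ id` on `M ⊗ (M ⊗ X)`. -/
def braidHead (β : M ⊗[F] M →ₗ[F] M ⊗[F] M) (X : Type*) [AddCommGroup X] [Module F X] :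
    M ⊗[F] (M ⊗[F] X) →ₗ[F] M ⊗[F] (M ⊗[F] X) :=
  (TensorProduct.assoc F M M X).toLinearMap ∘ₗ β.rTensor X ∘ₗ
    (TensorProduct.assoc F M M X).symm.toLinearMap

/-- `∇ ⊗ id : H ⊗ (H ⊗ X) → H ⊗ X`. -/
def mulHead (F H : Type*) [Field F] [Ring H] [Algebra F H] (X : Type*) [AddCommGroup X]
    [Module F X] : H ⊗[F] (H ⊗[F] X) →ₗ[F] H ⊗[F] X :=
  (LinearMap.mul' F H).rTensor X ∘ₗ (TensorProduct.assoc F H H X).symm.toLinearMap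

/-- `Δ ⊗ id : H ⊗ X → H ⊗ (H ⊗ X)`. -/
def comulHead (Δ : M →ₗ[F] M ⊗[F] M) (X : Type*) [AddCommGroup X] [Module F X] :
    M ⊗[F] X →ₗ[F] M ⊗[F] (M ⊗[F] X) :=
  (TensorProduct.assoc F M M X).toLinearMap ∘ₗ Δ.rTensor X

theorem braidHead_assoc (β : M ⊗[F] M →ₗ[F] M ⊗[F] M) (t : M ⊗[F] M) (x : X) :
    braidHead β X (TensorProduct.assoc F M M X (t ⊗ₜ x)) =
      TensorProduct.assoc F M M X (β t ⊗ₜ x) := by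
  simp [braidHead]

theorem braidHead_tmul (β : M ⊗[F] M →ₗ[F] M ⊗[F] M) (a b : M) (x : X) :
    braidHead β X (a ⊗ₜ (b ⊗ₜ x)) = TensorProduct.assoc F M M X (β (a ⊗ₜ b) ⊗ₜ x) := by
  simp [braidHead]

theorem mulHead_tmul (a b : H) (x : X) :
    mulHead F H X (a ⊗ₜ (b ⊗ₜ x)) = (a * b) ⊗ₜ x := by
  simp [mulHead]

theorem mulHead_assoc (t : H ⊗[F] H) (x : X) :
    mulHead F H X (TensorProduct.assoc F H H X (t ⊗ₜ x)) = LinearMap.mul' F H t ⊗ₜ x := by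
  simp [mulHead]

theorem comulHead_tmul (Δ : M →ₗ[F] M ⊗[F] M) (a : M) (x : X) :
    comulHead Δ X (a ⊗ₜ x) = TensorProduct.assoc F M M X (Δ a ⊗ₜ x) := by
  simp [comulHead]

theorem lTensor_lTensor_assoc (g : X →ₗ[F] Y) (t : M ⊗[F] N) (x : X) :
    (g.lTensor N).lTensor M (TensorProduct.assoc F M N X (t ⊗ₜ x)) =
      TensorProduct.assoc F M N Y (t ⊗ₜ g x) := by
  induction t with
  | zero => simp
  | add a b ha hb => simp only [map_add, TensorProduct.add_tmul, ha, hb]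
  | tmul a b => simp

/-- Taking for `g` an operator on strands further to the right, this is the far commutation relation
of braid words. The analogues for the product and the coproduct serve the same purpose. -/
theorem braidHead_natural (β : M ⊗[F] M →ₗ[F] M ⊗[F] M) (g : X →ₗ[F] Y)
    (t : M ⊗[F] (M ⊗[F] X)) :
    braidHead β Y ((g.lTensor M).lTensor M t) = (g.lTensor M).lTensor M (braidHead β X t) := by
  obtain ⟨t, rfl⟩ := (TensorProduct.assoc F M M X).surjective t
  induction t with
  | zero => simp
  | add a b ha hb => simp only [map_add, ha, hb]
  | tmul a b => rw [lTensor_lTensor_assoc, braidHead_assoc, braidHead_assoc, lTensor_lTensor_assoc]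

theorem mulHead_natural (g : X →ₗ[F] Y) (t : H ⊗[F] (H ⊗[F] X)) :
    mulHead F H Y ((g.lTensor H).lTensor H t) = g.lTensor H (mulHead F H X t) := by
  obtain ⟨t, rfl⟩ := (TensorProduct.assoc F H H X).surjective t
  induction t with
  | zero => simp
  | add a b ha hb => simp only [map_add, ha, hb]
  | tmul a b => rw [lTensor_lTensor_assoc, mulHead_assoc, mulHead_assoc, LinearMap.lTensor_tmul]

theorem comulHead_natural (Δ : M →ₗ[F] M ⊗[F] M) (g : X →ₗ[F] Y) (t : M ⊗[F] X) :
    comulHead Δ Y (g.lTensor M t) = (g.lTensor M).lTensor M (comulHead Δ X t) := by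
  induction t with
  | zero => simp
  | add a b ha hb => simp only [map_add, ha, hb]
  | tmul a b => rw [LinearMap.lTensor_tmul, comulHead_tmul, comulHead_tmul, lTensor_lTensor_assoc]

theorem rTensor_lTensor_apply (f : M →ₗ[F] N) (g : X →ₗ[F] Y) (t : M ⊗[F] X) :
    f.rTensor Y (g.lTensor M t) = g.lTensor N (f.rTensor X t) := by
  rw [← LinearMap.comp_apply, ← LinearMap.comp_apply, LinearMap.rTensor_comp_lTensor,
    LinearMap.lTensor_comp_rTensor]

theorem mulHead_mulHead (t : H ⊗[F] (H ⊗[F] (H ⊗[F] X))) :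
    mulHead F H X (mulHead F H (H ⊗[F] X) t) =
      mulHead F H X ((mulHead F H X).lTensor H t) := by
  induction t with
  | zero => simp
  | add a b ha hb => simp only [map_add, ha, hb]
  | tmul a t =>
    induction t with
    | zero => simp
    | add a b ha hb => simp only [map_add, TensorProduct.tmul_add, ha, hb]
    | tmul b t =>
      induction t with
      | zero => simp
      | add a b ha hb => simp only [map_add, TensorProduct.tmul_add, ha, hb]
      | tmul c x => simp only [mulHead_tmul, LinearMap.lTensor_tmul, mul_assoc]

/-! Relations between composites of linear maps are preserved by `lTensor`. -/

section Shift

variable (M)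
variable {A₁ A₂ A₃ A₄ A₅ : Type*} [AddCommGroup A₁] [Module F A₁]
  [AddCommGroup A₂] [Module F A₂] [AddCommGroup A₃] [Module F A₃] [AddCommGroup A₄] [Module F A₄]
  [AddCommGroup A₅] [Module F A₅]

theorem lTensor_shift₂₂ {f : A₂ →ₗ[F] A₃} {g : A₁ →ₗ[F] A₂} {f' : A₄ →ₗ[F] A₃}
    {g' : A₁ →ₗ[F] A₄} (h : ∀ t, f (g t) = f' (g' t)) (t : M ⊗[F] A₁) :
    f.lTensor M (g.lTensor M t) = f'.lTensor M (g'.lTensor M t) := by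
  have : f ∘ₗ g = f' ∘ₗ g' := LinearMap.ext h
  simp only [← LinearMap.comp_apply, ← LinearMap.lTensor_comp, this]

theorem lTensor_shift₂₃ {f : A₂ →ₗ[F] A₃} {g : A₁ →ₗ[F] A₂} {f' : A₅ →ₗ[F] A₃}
    {g' : A₄ →ₗ[F] A₅} {k' : A₁ →ₗ[F] A₄} (h : ∀ t, f (g t) = f' (g' (k' t))) (t : M ⊗[F] A₁) :
    f.lTensor M (g.lTensor M t) = f'.lTensor M (g'.lTensor M (k'.lTensor M t)) := by
  have : f ∘ₗ g = f' ∘ₗ g' ∘ₗ k' := LinearMap.ext h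
  simp only [← LinearMap.comp_apply, ← LinearMap.lTensor_comp, this]

end Shift

/-- Appending the vector `x` after two factors. -/
theorem lTensor_mk_eq_assoc (t : M ⊗[F] N) (x : X) :
    ((TensorProduct.mk F N X).flip x).lTensor M t = TensorProduct.assoc F M N X (t ⊗ₜ x) := by
  induction t with
  | zero => simp
  | add a b ha hb => simp only [map_add, TensorProduct.add_tmul, ha, hb]
  | tmul a b => simp

theorem braidHead_append (β : M ⊗[F] M →ₗ[F] M ⊗[F] M) (t : M ⊗[F] M) (x : X) :
    braidHead β X (((TensorProduct.mk F M X).flip x).lTensor M t) =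
      ((TensorProduct.mk F M X).flip x).lTensor M (β t) := by
  rw [lTensor_mk_eq_assoc, lTensor_mk_eq_assoc, braidHead_assoc]

theorem mulHead_append (t : H ⊗[F] H) (x : X) :
    mulHead F H X (((TensorProduct.mk F H X).flip x).lTensor H t) =
      (TensorProduct.mk F H X).flip x (LinearMap.mul' F H t) := by
  rw [lTensor_mk_eq_assoc, mulHead_assoc]; rfl

theorem mulHead_append_apply (x : X) (t : H ⊗[F] H) :
    mulHead F H X (((TensorProduct.mk F H X).flip x).lTensor H t) =
      (TensorProduct.mk F H X).flip x (LinearMap.mul' F H t) :=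
  mulHead_append t x

theorem comulHead_append (Δ : M →ₗ[F] M ⊗[F] M) (a : M) (x : X) :
    comulHead Δ X ((TensorProduct.mk F M X).flip x a) =
      ((TensorProduct.mk F M X).flip x).lTensor M (Δ a) := by
  rw [lTensor_mk_eq_assoc, ← comulHead_tmul]; rfl

/-- Cancels the spectator factor: an identity proved for every `X` is specialised to `X = F` and
stripped of the trailing `1`. -/
theorem append_one_injective : Function.Injective ((TensorProduct.mk F M F).flip 1) := by
  intro a b h
  simpa using congrArg (TensorProduct.rid F M) h

theorem lTensor_append_one_injective :
    Function.Injective (((TensorProduct.mk F N F).flip 1).lTensor M) :=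
  Module.Flat.lTensor_preserves_injective_linearMap _ append_one_injective

theorem lTensor_lTensor_append_one_injective :
    Function.Injective ((((TensorProduct.mk F N F).flip 1).lTensor M).lTensor X) :=
  Module.Flat.lTensor_preserves_injective_linearMap _ lTensor_append_one_injective

/-- Linear maps out of `M ⊗ (M ⊗ (M ⊗ X))` agree if they do so after appending a vector. -/
theorem ext_append₃ {A : Type*} [AddCommGroup A] [Module F A]
    {f g : M ⊗[F] (M ⊗[F] (M ⊗[F] X)) →ₗ[F] A}
    (h : ∀ (x : X) (t : M ⊗[F] (M ⊗[F] M)),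
      f ((((TensorProduct.mk F M X).flip x).lTensor M).lTensor M t) =
        g ((((TensorProduct.mk F M X).flip x).lTensor M).lTensor M t)) (t) : f t = g t := by
  induction t with
  | zero => simp
  | add a b ha hb => simp only [map_add, ha, hb]
  | tmul a t =>
    induction t with
    | zero => simp
    | add a b ha hb => simp only [map_add, TensorProduct.tmul_add, ha, hb]
    | tmul b t =>
      induction t with
      | zero => simp
      | add a b ha hb => simp only [map_add, TensorProduct.tmul_add, ha, hb]
      | tmul c x => exact h x (a ⊗ₜ (b ⊗ₜ c))

end Head

/-! ### Braidings compatible with a product -/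

section MulBraiding

variable {F H : Type*} [Field F] [Ring H] [Algebra F H]
variable {X : Type*} [AddCommGroup X] [Module F X]

/-- The linear map `c` on `H ⊗ H` commutes with the product and the unit of `H`. -/
structure IsMulBraiding (c : H ⊗[F] H →ₗ[F] H ⊗[F] H) : Prop where
  one_left : ∀ x : H, c (1 ⊗ₜ[F] x) = x ⊗ₜ[F] 1
  one_right : ∀ x : H, c (x ⊗ₜ[F] 1) = 1 ⊗ₜ[F] x
  mul_left : ∀ t : H ⊗[F] (H ⊗[F] H), c (mulHead F H H t) =
    (LinearMap.mul' F H).lTensor H (braidHead c H (c.lTensor H t))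
  mul_right : ∀ t : H ⊗[F] (H ⊗[F] H), c ((LinearMap.mul' F H).lTensor H t) =
    mulHead F H H (c.lTensor H (braidHead c H t))

/-- Only the left product rule is assumed, because for the tensor algebra this version is already
needed in the proof of the right rule. -/
theorem mul_left_head_of_mul_left {c : H ⊗[F] H →ₗ[F] H ⊗[F] H}
    (hc : ∀ t : H ⊗[F] (H ⊗[F] H), c (mulHead F H H t) =
      (LinearMap.mul' F H).lTensor H (braidHead c H (c.lTensor H t)))
    (t : H ⊗[F] (H ⊗[F] (H ⊗[F] X))) :
    braidHead c X (mulHead F H (H ⊗[F] X) t) =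
      (mulHead F H X).lTensor H (braidHead c (H ⊗[F] X) ((braidHead c X).lTensor H t)) := by
  refine ext_append₃ (f := braidHead c X ∘ₗ mulHead F H (H ⊗[F] X))
    (g := (mulHead F H X).lTensor H ∘ₗ braidHead c (H ⊗[F] X) ∘ₗ (braidHead c X).lTensor H)
    (fun x t => ?_) t
  simp only [LinearMap.comp_apply]
  rw [mulHead_natural, braidHead_append, hc,
    lTensor_shift₂₂ H (braidHead_append (X := X) c · x), braidHead_natural,
    lTensor_shift₂₂ H (mulHead_append_apply (F := F) (H := H) x)]

namespace IsMulBraiding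

variable {c : H ⊗[F] H →ₗ[F] H ⊗[F] H}

theorem one_left_head (hc : IsMulBraiding c) (t : H ⊗[F] X) :
    braidHead c X (1 ⊗ₜ t) = ((TensorProduct.mk F H X) 1).lTensor H t := by
  induction t with
  | zero => simp
  | add a b ha hb => simp only [map_add, TensorProduct.tmul_add, ha, hb]
  | tmul a x => simp [braidHead_tmul, hc.one_left]

theorem one_right_head (hc : IsMulBraiding c) (x : H) (t : X) :
    braidHead c X (x ⊗ₜ (1 ⊗ₜ t)) = 1 ⊗ₜ (x ⊗ₜ t) := by
  simp [braidHead_tmul, hc.one_right]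

theorem mul_left_head (hc : IsMulBraiding c) (t : H ⊗[F] (H ⊗[F] (H ⊗[F] X))) :
    braidHead c X (mulHead F H (H ⊗[F] X) t) =
      (mulHead F H X).lTensor H (braidHead c (H ⊗[F] X) ((braidHead c X).lTensor H t)) :=
  mul_left_head_of_mul_left hc.mul_left t

theorem mul_right_head (hc : IsMulBraiding c) (t : H ⊗[F] (H ⊗[F] (H ⊗[F] X))) :
    braidHead c X ((mulHead F H X).lTensor H t) =
      mulHead F H (H ⊗[F] X) ((braidHead c X).lTensor H (braidHead c (H ⊗[F] X) t)) := by
  refine ext_append₃ (f := braidHead c X ∘ₗ (mulHead F H X).lTensor H)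
    (g := mulHead F H (H ⊗[F] X) ∘ₗ (braidHead c X).lTensor H ∘ₗ braidHead c (H ⊗[F] X))
    (fun x t => ?_) t
  simp only [LinearMap.comp_apply]
  rw [lTensor_shift₂₂ H (mulHead_append_apply (F := F) (H := H) x), braidHead_append, hc.mul_right,
    braidHead_natural, lTensor_shift₂₂ H (braidHead_append (X := X) c · x), mulHead_natural]

end IsMulBraiding

/-! ### The Yang--Baxter equation in right-nested form -/

theorem onFirst_assoc_symm {M : Type*} [AddCommGroup M] [Module F M]
    (β : M ⊗[F] M →ₗ[F] M ⊗[F] M) (t : M ⊗[F] (M ⊗[F] M)) :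
    onFirst β ((TensorProduct.assoc F M M M).symm t) =
      (TensorProduct.assoc F M M M).symm (braidHead β M t) := by
  simp [onFirst, braidHead]

theorem onSecond_assoc_symm {M : Type*} [AddCommGroup M] [Module F M]
    (β : M ⊗[F] M →ₗ[F] M ⊗[F] M) (t : M ⊗[F] (M ⊗[F] M)) :
    onSecond β ((TensorProduct.assoc F M M M).symm t) =
      (TensorProduct.assoc F M M M).symm (β.lTensor M t) := by
  simp [onSecond]

namespace IsMulBraiding

variable {c : H ⊗[F] H →ₗ[F] H ⊗[F] H}

theorem braiding_mul_left (hc : IsMulBraiding c) : c ∘ₗ (LinearMap.mul' F H).rTensor H =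
    (LinearMap.mul' F H).lTensor H ∘ₗ (TensorProduct.assoc F H H H).toLinearMap ∘ₗ
      onFirst c ∘ₗ onSecond c := by
  refine LinearMap.ext fun t => ?_
  obtain ⟨t, rfl⟩ := (TensorProduct.assoc F H H H).symm.surjective t
  simp only [LinearMap.comp_apply, LinearEquiv.coe_coe, onFirst_assoc_symm, onSecond_assoc_symm,
    LinearEquiv.apply_symm_apply]
  exact hc.mul_left t

theorem braiding_mul_right (hc : IsMulBraiding c) :
    c ∘ₗ (LinearMap.mul' F H).lTensor H ∘ₗ (TensorProduct.assoc F H H H).toLinearMap =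
      (LinearMap.mul' F H).rTensor H ∘ₗ onSecond c ∘ₗ onFirst c := by
  refine LinearMap.ext fun t => ?_
  obtain ⟨t, rfl⟩ := (TensorProduct.assoc F H H H).symm.surjective t
  simp only [LinearMap.comp_apply, LinearEquiv.coe_coe, onFirst_assoc_symm, onSecond_assoc_symm,
    LinearEquiv.apply_symm_apply]
  exact hc.mul_right t

end IsMulBraiding

theorem BraidedHopfData.IsBraidedHopfAlgebra.isMulBraiding {D : BraidedHopfData F H}
    (hD : D.IsBraidedHopfAlgebra) : IsMulBraiding D.braiding where
  one_left := hD.braiding_one_left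
  one_right := hD.braiding_one_right
  mul_left t := by
    have := LinearMap.congr_fun hD.braiding_mul_left ((TensorProduct.assoc F H H H).symm t)
    simp only [LinearMap.comp_apply, LinearEquiv.coe_coe, onFirst_assoc_symm,
      onSecond_assoc_symm, LinearEquiv.apply_symm_apply] at this
    exact this
  mul_right t := by
    have := LinearMap.congr_fun hD.braiding_mul_right ((TensorProduct.assoc F H H H).symm t)
    simp only [LinearMap.comp_apply, LinearEquiv.coe_coe, onFirst_assoc_symm,
      onSecond_assoc_symm, LinearEquiv.apply_symm_apply] at this
    exact this

/-- The Yang--Baxter equation for `β` at the element `t` of `M ⊗ (M ⊗ (M ⊗ X))`. -/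
def YangBaxterAt {M : Type*} [AddCommGroup M] [Module F M]
    (β : M ⊗[F] M →ₗ[F] M ⊗[F] M) (t : M ⊗[F] (M ⊗[F] (M ⊗[F] X))) : Prop :=
  braidHead β (M ⊗[F] X) ((braidHead β X).lTensor M (braidHead β (M ⊗[F] X) t)) =
    (braidHead β X).lTensor M (braidHead β (M ⊗[F] X) ((braidHead β X).lTensor M t))

theorem yangBaxter_iff {M : Type*} [AddCommGroup M] [Module F M]
    (β : M ⊗[F] M →ₗ[F] M ⊗[F] M) :
    onFirst β ∘ₗ onSecond β ∘ₗ onFirst β = onSecond β ∘ₗ onFirst β ∘ₗ onSecond β ↔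
      ∀ t : M ⊗[F] (M ⊗[F] M), braidHead β M (β.lTensor M (braidHead β M t)) =
        β.lTensor M (braidHead β M (β.lTensor M t)) := by
  constructor
  · intro h t
    have := LinearMap.congr_fun h ((TensorProduct.assoc F M M M).symm t)
    simpa only [LinearMap.comp_apply, onFirst_assoc_symm, onSecond_assoc_symm,
      EmbeddingLike.apply_eq_iff_eq] using this
  · intro h
    refine LinearMap.ext fun t => ?_
    obtain ⟨t, rfl⟩ := (TensorProduct.assoc F M M M).symm.surjective t
    simp only [LinearMap.comp_apply, onFirst_assoc_symm, onSecond_assoc_symm, h]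

theorem yangBaxterAt_append_iff {M : Type*} [AddCommGroup M] [Module F M]
    (β : M ⊗[F] M →ₗ[F] M ⊗[F] M) (t : M ⊗[F] (M ⊗[F] M)) :
    YangBaxterAt β ((((TensorProduct.mk F M F).flip 1).lTensor M).lTensor M t) ↔
      braidHead β M (β.lTensor M (braidHead β M t)) =
        β.lTensor M (braidHead β M (β.lTensor M t)) := by
  rw [YangBaxterAt, braidHead_natural, lTensor_shift₂₂ M (braidHead_append (X := F) β · 1),
    lTensor_shift₂₂ M (braidHead_append (X := F) β · 1), braidHead_natural, braidHead_natural,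
    lTensor_shift₂₂ M (braidHead_append (X := F) β · 1)]
  exact lTensor_lTensor_append_one_injective.eq_iff

theorem yangBaxter_iff_yangBaxterAt {M : Type*} [AddCommGroup M] [Module F M]
    (β : M ⊗[F] M →ₗ[F] M ⊗[F] M) :
    onFirst β ∘ₗ onSecond β ∘ₗ onFirst β = onSecond β ∘ₗ onFirst β ∘ₗ onSecond β ↔
      ∀ t : M ⊗[F] (M ⊗[F] (M ⊗[F] F)), YangBaxterAt β t := by
  rw [yangBaxter_iff]
  refine ⟨fun h t => ?_, fun h t => (yangBaxterAt_append_iff β t).1 (h _)⟩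
  refine ext_append₃ (f := braidHead β (M ⊗[F] F) ∘ₗ (braidHead β F).lTensor M ∘ₗ
      braidHead β (M ⊗[F] F)) (g := (braidHead β F).lTensor M ∘ₗ braidHead β (M ⊗[F] F) ∘ₗ
      (braidHead β F).lTensor M) (fun x t => ?_) t
  have := (yangBaxterAt_append_iff β t).2 (h t)
  -- With `X = F` every trailing vector is a multiple of `1`, and both sides are linear.
  have hx : (TensorProduct.mk F M F).flip x = x • (TensorProduct.mk F M F).flip 1 := by
    rw [← map_smul, smul_eq_mul, mul_one]
  rw [hx]
  simp only [LinearMap.lTensor_smul, LinearMap.smul_apply, map_smul, LinearMap.comp_apply]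
  exact congrArg _ this

/-- The Yang--Baxter equation at a tensor depends on its first three factors only. -/
theorem YangBaxterAt.natural {M Y : Type*} [AddCommGroup M] [Module F M] [AddCommGroup Y]
    [Module F Y] {β : M ⊗[F] M →ₗ[F] M ⊗[F] M} {t : M ⊗[F] (M ⊗[F] (M ⊗[F] X))}
    (h : YangBaxterAt β t) (g : X →ₗ[F] Y) :
    YangBaxterAt β (((g.lTensor M).lTensor M).lTensor M t) := by
  rw [YangBaxterAt] at h ⊢
  rw [braidHead_natural, lTensor_shift₂₂ M (braidHead_natural β g),
    lTensor_shift₂₂ M (braidHead_natural β g), braidHead_natural, braidHead_natural, h,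
    lTensor_shift₂₂ M (braidHead_natural β g)]

/-- Every `x` is the image of `1` under a linear map `F → X`, so a trailing `1` is the universal
case. -/
theorem YangBaxterAt.of_tmul {M : Type*} [AddCommGroup M] [Module F M]
    {β : M ⊗[F] M →ₗ[F] M ⊗[F] M} {a b c : M}
    (h : YangBaxterAt β (a ⊗ₜ[F] (b ⊗ₜ[F] (c ⊗ₜ[F] (1 : F))))) (x : X) :
    YangBaxterAt β (a ⊗ₜ[F] (b ⊗ₜ[F] (c ⊗ₜ[F] x))) := by
  simpa using h.natural (LinearMap.toSpanSingleton F X x)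

theorem YangBaxterAt.add {M : Type*} [AddCommGroup M] [Module F M]
    {β : M ⊗[F] M →ₗ[F] M ⊗[F] M} {s t : M ⊗[F] (M ⊗[F] (M ⊗[F] X))}
    (hs : YangBaxterAt β s) (ht : YangBaxterAt β t) : YangBaxterAt β (s + t) := by
  rw [YangBaxterAt] at *
  simp only [map_add, hs, ht]

theorem YangBaxterAt.smul {M : Type*} [AddCommGroup M] [Module F M]
    {β : M ⊗[F] M →ₗ[F] M ⊗[F] M} {t : M ⊗[F] (M ⊗[F] (M ⊗[F] X))} (r : F)
    (ht : YangBaxterAt β t) : YangBaxterAt β (r • t) := by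
  rw [YangBaxterAt] at *
  simp only [map_smul, ht]

theorem YangBaxterAt.zero {M : Type*} [AddCommGroup M] [Module F M]
    {β : M ⊗[F] M →ₗ[F] M ⊗[F] M} : YangBaxterAt β (0 : M ⊗[F] (M ⊗[F] (M ⊗[F] X))) := by
  rw [YangBaxterAt]
  simp only [map_zero]

end MulBraiding

/-! ### The Yang--Baxter equation on an algebra generated by a braided vector space -/

section Functoriality

variable {F M N : Type*} [Field F] [AddCommGroup M] [Module F M] [AddCommGroup N] [Module F N]
variable {X Y : Type*} [AddCommGroup X] [Module F X] [AddCommGroup Y] [Module F Y]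

theorem map_map_assoc {M' N' : Type*} [AddCommGroup M'] [Module F M'] [AddCommGroup N']
    [Module F N'] (f : M →ₗ[F] M') (k : N →ₗ[F] N') (g : X →ₗ[F] Y) (t : M ⊗[F] N) (x : X) :
    TensorProduct.map f (TensorProduct.map k g) (TensorProduct.assoc F M N X (t ⊗ₜ x)) =
      TensorProduct.assoc F M' N' Y (TensorProduct.map f k t ⊗ₜ g x) := by
  induction t with
  | zero => simp
  | add a b ha hb => simp only [map_add, TensorProduct.add_tmul, ha, hb]
  | tmul a b => simp

theorem braidHead_map {β : M ⊗[F] M →ₗ[F] M ⊗[F] M} {γ : N ⊗[F] N →ₗ[F] N ⊗[F] N}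
    {f : M →ₗ[F] N} (h : γ ∘ₗ TensorProduct.map f f = TensorProduct.map f f ∘ₗ β)
    (g : X →ₗ[F] Y) (t : M ⊗[F] (M ⊗[F] X)) :
    braidHead γ Y (TensorProduct.map f (TensorProduct.map f g) t) =
      TensorProduct.map f (TensorProduct.map f g) (braidHead β X t) := by
  obtain ⟨t, rfl⟩ := (TensorProduct.assoc F M M X).surjective t
  induction t with
  | zero => simp
  | add a b ha hb => simp only [map_add, ha, hb]
  | tmul a b =>
    have := LinearMap.congr_fun h a
    rw [LinearMap.comp_apply, LinearMap.comp_apply] at this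
    rw [map_map_assoc, braidHead_assoc, braidHead_assoc, map_map_assoc, this]

theorem lTensor_map_shift {A B A' B' : Type*} [AddCommGroup A] [Module F A] [AddCommGroup B]
    [Module F B] [AddCommGroup A'] [Module F A'] [AddCommGroup B'] [Module F B']
    {k : A' →ₗ[F] B'} {k' : A →ₗ[F] B} {g : A →ₗ[F] A'} {g' : B →ₗ[F] B'} (f : M →ₗ[F] N)
    (h : ∀ t, k (g t) = g' (k' t)) (t : M ⊗[F] A) :
    k.lTensor N (TensorProduct.map f g t) = TensorProduct.map f g' (k'.lTensor M t) := by
  have : k ∘ₗ g = g' ∘ₗ k' := LinearMap.ext h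
  rw [← LinearMap.comp_apply, ← LinearMap.comp_apply, LinearMap.lTensor_comp_map,
    LinearMap.map_comp_lTensor, this]

theorem YangBaxterAt.map {β : M ⊗[F] M →ₗ[F] M ⊗[F] M} {γ : N ⊗[F] N →ₗ[F] N ⊗[F] N}
    {f : M →ₗ[F] N} (h : γ ∘ₗ TensorProduct.map f f = TensorProduct.map f f ∘ₗ β)
    (g : X →ₗ[F] Y) {t : M ⊗[F] (M ⊗[F] (M ⊗[F] X))} (ht : YangBaxterAt β t) :
    YangBaxterAt γ (TensorProduct.map f (TensorProduct.map f (TensorProduct.map f g)) t) := by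
  rw [YangBaxterAt] at ht ⊢
  rw [braidHead_map h, lTensor_map_shift f (braidHead_map h g), braidHead_map h, ht,
    lTensor_map_shift f (braidHead_map h g), braidHead_map h,
    lTensor_map_shift f (braidHead_map h g)]

end Functoriality

/-! ### Propagation from generators to products -/

section Generated

variable {F V H : Type*} [Field F] [AddCommGroup V] [Module F V] [Ring H] [Algebra F H]
variable {X : Type*} [AddCommGroup X] [Module F X]
variable {c : H ⊗[F] H →ₗ[F] H ⊗[F] H} {j : V →ₗ[F] H} {τ : V ⊗[F] V →ₗ[F] V ⊗[F] V}

/-- Induction in an algebra generated by the range of `j`. -/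
theorem generated_induction (hj : Algebra.adjoin F (Set.range j) = ⊤) {P : H → Prop}
    (one : P 1) (gen : ∀ v, P (j v)) (add : ∀ x y, P x → P y → P (x + y))
    (smul : ∀ (r : F) x, P x → P (r • x)) (mul : ∀ x y, P x → P y → P (x * y)) (x : H) : P x := by
  have hx : x ∈ Algebra.adjoin F (Set.range j) := hj ▸ Algebra.mem_top
  induction hx using Algebra.adjoin_induction with
  | mem x hx => obtain ⟨v, rfl⟩ := hx; exact gen v
  | algebraMap r => rw [Algebra.algebraMap_eq_smul_one]; exact smul r 1 one
  | add x y _ _ hx hy => exact add x y hx hy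
  | mul x y _ _ hx hy => exact mul x y hx hy

/-- Induction by multiplication with generators from the left. -/
theorem generated_induction_left (hj : Algebra.adjoin F (Set.range j) = ⊤) {P : H → Prop}
    (one : P 1) (gen_mul : ∀ v x, P x → P (j v * x)) (add : ∀ x y, P x → P y → P (x + y))
    (smul : ∀ (r : F) x, P x → P (r • x)) (x : H) : P x := by
  suffices h : ∀ y, P y → P (x * y) by simpa using h 1 one
  refine generated_induction hj (P := fun x => ∀ y, P y → P (x * y)) ?_ gen_mul ?_ ?_ ?_ x
  · intro y hy; rwa [one_mul]
  · intro a b ha hb y hy; rw [add_mul]; exact add _ _ (ha y hy) (hb y hy)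
  · intro r a ha y hy; rw [smul_mul_assoc]; exact smul _ _ (ha y hy)
  · intro a b ha hb y hy; rw [mul_assoc]; exact ha _ (hb y hy)

namespace IsMulBraiding

/-- Crossing a product `y y'` means crossing `y` and then `y'`, and a crossing with a generator
leaves a vector of `V` because τ does. The recursions for the structure maps are known only for
vectors of `V`, and this fact keeps them applicable after a crossing. -/
theorem apply_gen_mem_range (hc : IsMulBraiding c) (hj : Algebra.adjoin F (Set.range j) = ⊤)
    (hτ : c ∘ₗ TensorProduct.map j j = TensorProduct.map j j ∘ₗ τ) (v : V) (y : H) :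
    c (j v ⊗ₜ y) ∈ LinearMap.range (j.lTensor H) := by
  refine generated_induction hj
    (P := fun y => ∀ v, c (j v ⊗ₜ y) ∈ LinearMap.range (j.lTensor H)) ?_ ?_ ?_ ?_ ?_ y v
  · intro v; exact ⟨1 ⊗ₜ v, by rw [hc.one_right, LinearMap.lTensor_tmul]⟩
  · intro w v
    refine ⟨j.rTensor V (τ (v ⊗ₜ w)), ?_⟩
    have := LinearMap.congr_fun hτ (v ⊗ₜ w)
    simp only [LinearMap.comp_apply, TensorProduct.map_tmul] at this
    rw [this, ← LinearMap.comp_apply, LinearMap.lTensor_comp_rTensor]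
  · intro a b ha hb v; rw [TensorProduct.tmul_add, map_add]; exact add_mem (ha v) (hb v)
  · intro r a ha v; rw [TensorProduct.tmul_smul, map_smul]; exact Submodule.smul_mem _ _ (ha v)
  · intro y y' hy hy' v
    have h := hc.mul_right (j v ⊗ₜ (y ⊗ₜ y'))
    rw [LinearMap.lTensor_tmul, LinearMap.mul'_apply, braidHead_tmul] at h
    rw [h]
    obtain ⟨z, hz⟩ := hy v
    rw [← hz]
    clear hz
    induction z with
    | zero => simp
    | add a b ha hb => simp only [map_add, TensorProduct.add_tmul]; exact add_mem ha hb
    | tmul a w =>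
      obtain ⟨z', hz'⟩ := hy' w
      rw [LinearMap.lTensor_tmul, TensorProduct.assoc_tmul, LinearMap.lTensor_tmul, ← hz']
      clear hz'
      induction z' with
      | zero => simp
      | add a b ha hb => simp only [map_add, TensorProduct.tmul_add]; exact add_mem ha hb
      | tmul b u => exact ⟨(a * b) ⊗ₜ u, by simp [mulHead_tmul]⟩

/-- The mirror image: a product `x x'` crosses `v` with `x'` first and then `x`. -/
theorem apply_tmul_gen_mem_range (hc : IsMulBraiding c)
    (hj : Algebra.adjoin F (Set.range j) = ⊤)
    (hτ : c ∘ₗ TensorProduct.map j j = TensorProduct.map j j ∘ₗ τ) (x : H) (v : V) :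
    c (x ⊗ₜ j v) ∈ LinearMap.range (j.rTensor H) := by
  refine generated_induction hj
    (P := fun x => ∀ v, c (x ⊗ₜ j v) ∈ LinearMap.range (j.rTensor H)) ?_ ?_ ?_ ?_ ?_ x v
  · intro v; exact ⟨v ⊗ₜ 1, by rw [hc.one_left, LinearMap.rTensor_tmul]⟩
  · intro w v
    refine ⟨j.lTensor V (τ (w ⊗ₜ v)), ?_⟩
    have := LinearMap.congr_fun hτ (w ⊗ₜ v)
    simp only [LinearMap.comp_apply, TensorProduct.map_tmul] at this
    rw [this, ← LinearMap.comp_apply, LinearMap.rTensor_comp_lTensor]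
  · intro a b ha hb v; rw [TensorProduct.add_tmul, map_add]; exact add_mem (ha v) (hb v)
  · intro r a ha v
    rw [← TensorProduct.smul_tmul', map_smul]; exact Submodule.smul_mem _ _ (ha v)
  · intro x x' hx hx' v
    have h := hc.mul_left (x ⊗ₜ (x' ⊗ₜ j v))
    rw [LinearMap.lTensor_tmul, mulHead_tmul] at h
    rw [h]
    obtain ⟨z, hz⟩ := hx' v
    rw [← hz]
    clear hz
    induction z with
    | zero => simp
    | add a b ha hb => simp only [map_add, TensorProduct.tmul_add]; exact add_mem ha hb
    | tmul w a =>
      obtain ⟨z', hz'⟩ := hx w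
      rw [LinearMap.rTensor_tmul, braidHead_tmul, ← hz']
      clear hz'
      induction z' with
      | zero => simp
      | add a b ha hb => simp only [map_add, TensorProduct.add_tmul]; exact add_mem ha hb
      | tmul u b => exact ⟨u ⊗ₜ (b * a), by simp⟩

/-- To prove a property of `c (v ⊗ y) ⊗ x`, it suffices to consider `h ⊗ (w ⊗ x)`. -/
theorem braidHead_gen_induction (hc : IsMulBraiding c)
    (hj : Algebra.adjoin F (Set.range j) = ⊤)
    (hτ : c ∘ₗ TensorProduct.map j j = TensorProduct.map j j ∘ₗ τ)
    {P : H ⊗[F] (H ⊗[F] X) → Prop} (v : V) (y : H) (x : X) (zero : P 0)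
    (add : ∀ s t, P s → P t → P (s + t)) (tmul : ∀ h w, P (h ⊗ₜ (j w ⊗ₜ x))) :
    P (braidHead c X (j v ⊗ₜ (y ⊗ₜ x))) := by
  obtain ⟨z, hz⟩ := hc.apply_gen_mem_range hj hτ v y
  rw [braidHead_tmul, ← hz]
  clear hz
  induction z with
  | zero => simpa using zero
  | add a b ha hb => simp only [map_add, TensorProduct.add_tmul]; exact add _ _ ha hb
  | tmul h w => simpa using tmul h w

theorem braidHead_tmul_gen_induction (hc : IsMulBraiding c)
    (hj : Algebra.adjoin F (Set.range j) = ⊤)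
    (hτ : c ∘ₗ TensorProduct.map j j = TensorProduct.map j j ∘ₗ τ)
    {P : H ⊗[F] (H ⊗[F] X) → Prop} (y : H) (v : V) (x : X) (zero : P 0)
    (add : ∀ s t, P s → P t → P (s + t)) (tmul : ∀ w h, P (j w ⊗ₜ (h ⊗ₜ x))) :
    P (braidHead c X (y ⊗ₜ (j v ⊗ₜ x))) := by
  obtain ⟨z, hz⟩ := hc.apply_tmul_gen_mem_range hj hτ y v
  rw [braidHead_tmul, ← hz]
  clear hz
  induction z with
  | zero => simpa using zero
  | add a b ha hb => simp only [map_add, TensorProduct.add_tmul]; exact add _ _ ha hb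
  | tmul h w => simpa using tmul h w

/-- To prove a property of `(c ⊗ id) (v ⊗ s)`, it suffices to consider `h ⊗ (w ⊗ x)`. -/
theorem braidHead_gen_induction' (hc : IsMulBraiding c)
    (hj : Algebra.adjoin F (Set.range j) = ⊤)
    (hτ : c ∘ₗ TensorProduct.map j j = TensorProduct.map j j ∘ₗ τ)
    {P : H ⊗[F] (H ⊗[F] X) → Prop} (v : V) (s : H ⊗[F] X) (zero : P 0)
    (add : ∀ s t, P s → P t → P (s + t)) (tmul : ∀ h w x, P (h ⊗ₜ (j w ⊗ₜ x))) :
    P (braidHead c X (j v ⊗ₜ s)) := by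
  induction s with
  | zero => simpa using zero
  | add a b ha hb => simpa only [TensorProduct.tmul_add, map_add] using add _ _ ha hb
  | tmul y x => exact hc.braidHead_gen_induction hj hτ v y x zero add fun h w => tmul h w x

/-- The unit crosses freely, so both sides reduce to one crossing of the other two strands; likewise
for the unit in the middle or on the left. -/
theorem yangBaxterAt_one_right (hc : IsMulBraiding c) (a b : H) (x : X) :
    YangBaxterAt c (a ⊗ₜ[F] (b ⊗ₜ[F] ((1 : H) ⊗ₜ[F] x))) := by
  rw [YangBaxterAt, LinearMap.lTensor_tmul, hc.one_right_head, hc.one_right_head,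
    LinearMap.lTensor_tmul, braidHead_tmul, braidHead_tmul]
  induction c (a ⊗ₜ b) with
  | zero => simp
  | add a b ha hb => simp only [map_add, TensorProduct.add_tmul, TensorProduct.tmul_add, ha, hb]
  | tmul a b =>
    rw [TensorProduct.assoc_tmul, LinearMap.lTensor_tmul, hc.one_right_head, hc.one_right_head,
      TensorProduct.assoc_tmul]

theorem yangBaxterAt_one_middle (hc : IsMulBraiding c) (a b : H) (x : X) :
    YangBaxterAt c (a ⊗ₜ[F] ((1 : H) ⊗ₜ[F] (b ⊗ₜ[F] x))) := by
  rw [YangBaxterAt, LinearMap.lTensor_tmul, hc.one_right_head, LinearMap.lTensor_tmul,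
    hc.one_left_head, hc.one_left_head]
  rw [LinearMap.lTensor_tmul, TensorProduct.mk_apply, braidHead_tmul, braidHead_tmul]
  induction c (a ⊗ₜ b) with
  | zero => simp
  | add a b ha hb => simp only [map_add, TensorProduct.add_tmul, ha, hb]
  | tmul a b =>
    rw [TensorProduct.assoc_tmul, TensorProduct.assoc_tmul,
      LinearMap.lTensor_tmul, LinearMap.lTensor_tmul, TensorProduct.mk_apply, hc.one_right_head]

theorem yangBaxterAt_one_left (hc : IsMulBraiding c) (a b : H) (x : X) :
    YangBaxterAt c ((1 : H) ⊗ₜ[F] (a ⊗ₜ[F] (b ⊗ₜ[F] x))) := by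
  simp only [YangBaxterAt, LinearMap.lTensor_tmul, hc.one_left_head, TensorProduct.mk_apply,
    braidHead_tmul c a b]
  induction c (a ⊗ₜ b) with
  | zero => simp
  | add a b ha hb => simp only [map_add, TensorProduct.add_tmul, ha, hb]
  | tmul a b =>
    simp only [TensorProduct.assoc_tmul, LinearMap.lTensor_tmul, TensorProduct.mk_apply,
      hc.one_left_head]

end IsMulBraiding

-- The index is the position of the first strand on which the operator acts, so that identities read
-- as words: `c₁` crosses strands one and two, `c₂` strands two and three, and `m₃` multiplies
-- strands three and four.
local notation "c₁" => braidHead c _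
local notation "c₂" => LinearMap.lTensor H (braidHead c _)
local notation "c₃" => LinearMap.lTensor H (LinearMap.lTensor H (braidHead c _))
local notation "m₁" => mulHead F H _
local notation "m₂" => LinearMap.lTensor H (mulHead F H _)
local notation "m₃" => LinearMap.lTensor H (LinearMap.lTensor H (mulHead F H _))

namespace IsMulBraiding

/-- Pulling the product out to the front turns both sides into words on four strands. They differ by
the relation on strands one to three (`h`) followed by the relation on strands two to four (`h'`).
Both are required only at the elements that occur, since in the induction below they are not yet
known everywhere. -/
theorem yangBaxterAt_mul_right (hc : IsMulBraiding c)
    (t : H ⊗[F] (H ⊗[F] (H ⊗[F] (H ⊗[F] X)))) (h : YangBaxterAt c t)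
    (h' : c₂ (c₃ (c₂ (c₁ (c₂ t)))) = c₃ (c₂ (c₃ (c₁ (c₂ t))))) :
    YangBaxterAt c (m₃ t) := by
  rw [YangBaxterAt] at h ⊢
  rw [braidHead_natural, lTensor_shift₂₃ H hc.mul_right_head, hc.mul_right_head,
    braidHead_natural c (braidHead c X), h, h',
    lTensor_shift₂₃ H hc.mul_right_head, hc.mul_right_head,
    ← mulHead_natural (braidHead c X), braidHead_natural c (braidHead c X)]

theorem yangBaxterAt_mul_middle (hc : IsMulBraiding c)
    (t : H ⊗[F] (H ⊗[F] (H ⊗[F] (H ⊗[F] X)))) (h : YangBaxterAt c (c₃ t))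
    (h' : c₂ (c₃ (c₂ (c₁ t))) = c₃ (c₂ (c₃ (c₁ t)))) :
    YangBaxterAt c (m₂ t) := by
  rw [YangBaxterAt] at h ⊢
  rw [hc.mul_right_head, ← mulHead_natural (braidHead c X), hc.mul_left_head, h',
    lTensor_shift₂₃ H hc.mul_left_head, braidHead_natural c (mulHead F H X),
    lTensor_shift₂₃ H hc.mul_right_head, ← h, braidHead_natural c (braidHead c X),
    braidHead_natural c (braidHead c X)]

theorem yangBaxterAt_mul_left (hc : IsMulBraiding c)
    (t : H ⊗[F] (H ⊗[F] (H ⊗[F] (H ⊗[F] X)))) (h : YangBaxterAt c (c₃ (c₂ t)))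
    (h' : c₂ (c₃ (c₂ t)) = c₃ (c₂ (c₃ t))) :
    YangBaxterAt c (m₁ t) := by
  rw [YangBaxterAt] at h ⊢
  rw [hc.mul_left_head, lTensor_shift₂₃ H hc.mul_left_head, braidHead_natural c (mulHead F H X),
    ← braidHead_natural c (braidHead c X), h, ← mulHead_natural (braidHead c X),
    hc.mul_left_head, lTensor_shift₂₃ H hc.mul_left_head, ← braidHead_natural c (braidHead c X),
    ← h']

/-- The Yang--Baxter equation passes from the generators to the whole algebra. -/
theorem yangBaxterAt (hc : IsMulBraiding c) (hj : Algebra.adjoin F (Set.range j) = ⊤)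
    (hτ : c ∘ₗ TensorProduct.map j j = TensorProduct.map j j ∘ₗ τ)
    (hYB : onFirst τ ∘ₗ onSecond τ ∘ₗ onFirst τ = onSecond τ ∘ₗ onFirst τ ∘ₗ onSecond τ)
    (t : H ⊗[F] (H ⊗[F] (H ⊗[F] X))) : YangBaxterAt c t := by
  -- The third strand is freed first, then the second, then the first. A strand that is still a
  -- generator remains one after its crossings, so the previous stage keeps applying.
  have step₁ : ∀ (z : H) (v w : V),
      YangBaxterAt c (j v ⊗ₜ[F] (j w ⊗ₜ[F] (z ⊗ₜ[F] (1 : F)))) := by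
    intro z
    refine generated_induction hj (P := fun z => ∀ (v w : V),
      YangBaxterAt c (j v ⊗ₜ[F] (j w ⊗ₜ[F] (z ⊗ₜ[F] (1 : F))))) ?_ ?_ ?_ ?_ ?_ z
    · intro v w; exact hc.yangBaxterAt_one_right _ _ _
    · intro u v w
      simpa using ((yangBaxter_iff_yangBaxterAt τ).1 hYB
        (v ⊗ₜ (w ⊗ₜ (u ⊗ₜ 1)))).map hτ LinearMap.id
    · intro a b ha hb v w
      simpa only [TensorProduct.tmul_add, TensorProduct.add_tmul] using (ha v w).add (hb v w)
    · intro r a ha v w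
      simpa only [← TensorProduct.smul_tmul', TensorProduct.tmul_smul] using (ha v w).smul r
    · intro z z' hz hz' v w
      have := hc.yangBaxterAt_mul_right (j v ⊗ₜ[F] (j w ⊗ₜ[F] (z ⊗ₜ[F] (z' ⊗ₜ[F] (1 : F)))))
        ((hz v w).of_tmul _) ?_
      · simpa [mulHead_tmul] using this
      rw [LinearMap.lTensor_tmul]
      -- After `w` and then `v` have crossed `z`, they are replaced by vectors `w'` and `v'` of `V`,
      -- and what is left is the hypothesis for `z'`.
      refine hc.braidHead_gen_induction hj hτ w z _ (P := fun s =>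
        c₂ (c₃ (c₂ (c₁ (j v ⊗ₜ[F] s)))) = c₃ (c₂ (c₃ (c₁ (j v ⊗ₜ[F] s))))) (by simp)
        (fun s t hs ht => by simp only [TensorProduct.tmul_add, map_add, hs, ht]) fun h w' => ?_
      refine hc.braidHead_gen_induction hj hτ v h _ (P := fun s =>
        c₂ (c₃ (c₂ s)) = c₃ (c₂ (c₃ s))) (by simp)
        (fun s t hs ht => by simp only [map_add, hs, ht]) fun h v' => ?_
      simp only [LinearMap.lTensor_tmul]
      exact congrArg _ (hz' v' w')
  have step₂ : ∀ (y : H) (v : V) (z : H),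
      YangBaxterAt c (j v ⊗ₜ[F] (y ⊗ₜ[F] (z ⊗ₜ[F] (1 : F)))) := by
    intro y
    refine generated_induction hj (P := fun y => ∀ (v : V) (z : H),
      YangBaxterAt c (j v ⊗ₜ[F] (y ⊗ₜ[F] (z ⊗ₜ[F] (1 : F))))) ?_ ?_ ?_ ?_ ?_ y
    · intro v z; exact hc.yangBaxterAt_one_middle _ _ _
    · intro w v z; exact step₁ z v w
    · intro a b ha hb v z
      simpa only [TensorProduct.tmul_add, TensorProduct.add_tmul] using (ha v z).add (hb v z)
    · intro r a ha v w
      simpa only [← TensorProduct.smul_tmul', TensorProduct.tmul_smul] using (ha v w).smul r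
    · intro y y' hy hy' v z
      have := hc.yangBaxterAt_mul_middle (j v ⊗ₜ[F] (y ⊗ₜ[F] (y' ⊗ₜ[F] (z ⊗ₜ[F] (1 : F)))))
        ?_ ?_
      · simpa [mulHead_tmul] using this
      · simp only [LinearMap.lTensor_tmul, braidHead_tmul]
        induction c (y' ⊗ₜ z) with
        | zero => simpa using YangBaxterAt.zero
        | add a b ha hb =>
          simpa only [TensorProduct.add_tmul, map_add, TensorProduct.tmul_add] using ha.add hb
        | tmul a b => exact (hy v a).of_tmul _
      -- Once `v` has crossed `y` it is again some `v'` in `V`, so the hypothesis for `y'` closes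
      -- the goal.
      · refine hc.braidHead_gen_induction hj hτ v y _ (P := fun s =>
          c₂ (c₃ (c₂ s)) = c₃ (c₂ (c₃ s))) (by simp)
          (fun s t hs ht => by simp only [map_add, hs, ht]) fun h v' => ?_
        simp only [LinearMap.lTensor_tmul]
        exact congrArg _ (hy' v' z)
  have step₃ : ∀ (x y z : H), YangBaxterAt c (x ⊗ₜ[F] (y ⊗ₜ[F] (z ⊗ₜ[F] (1 : F)))) := by
    intro x
    refine generated_induction hj (P := fun x => ∀ (y z : H),
      YangBaxterAt c (x ⊗ₜ[F] (y ⊗ₜ[F] (z ⊗ₜ[F] (1 : F))))) ?_ ?_ ?_ ?_ ?_ x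
    · intro y z; exact hc.yangBaxterAt_one_left _ _ _
    · intro v y z; exact step₂ y v z
    · intro a b ha hb y z
      simpa only [TensorProduct.add_tmul] using (ha y z).add (hb y z)
    · intro r a ha v w
      simpa only [← TensorProduct.smul_tmul'] using (ha v w).smul r
    · intro x x' hx hx' y z
      have := hc.yangBaxterAt_mul_left (x ⊗ₜ[F] (x' ⊗ₜ[F] (y ⊗ₜ[F] (z ⊗ₜ[F] (1 : F)))))
        ?_ ?_
      · simpa [mulHead_tmul] using this
      · rw [LinearMap.lTensor_tmul, LinearMap.lTensor_tmul]
        generalize LinearMap.lTensor H (braidHead c F)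
          (braidHead c (H ⊗[F] F) (x' ⊗ₜ[F] (y ⊗ₜ[F] (z ⊗ₜ[F] (1 : F))))) = s
        induction s with
        | zero => simpa using YangBaxterAt.zero
        | add a b ha hb => simpa only [TensorProduct.tmul_add] using ha.add hb
        | tmul a s =>
          induction s with
          | zero => simpa using YangBaxterAt.zero
          | add a b ha hb => simpa only [TensorProduct.tmul_add] using ha.add hb
          | tmul b s => exact (hx a b).of_tmul _
      · simp only [LinearMap.lTensor_tmul]
        exact congrArg _ (hx' y z)
  induction t with
  | zero => exact YangBaxterAt.zero
  | add a b ha hb => exact ha.add hb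
  | tmul x t =>
    induction t with
    | zero => simpa using YangBaxterAt.zero
    | add a b ha hb => simpa only [TensorProduct.tmul_add] using ha.add hb
    | tmul y t =>
      induction t with
      | zero => simpa using YangBaxterAt.zero
      | add a b ha hb => simpa only [TensorProduct.tmul_add] using ha.add hb
      | tmul z u => exact (step₃ x y z).of_tmul _

end IsMulBraiding

end Generated

/-! ### Braided Hopf algebras generated by primitive elements -/

section Counit

variable {F M N : Type*} [Field F] [AddCommGroup M] [Module F M] [AddCommGroup N] [Module F N]
variable {X Y : Type*} [AddCommGroup X] [Module F X] [AddCommGroup Y] [Module F Y]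

/-- `ε ⊗ id : M ⊗ X → X`. -/
def counitHead (ε : M →ₗ[F] F) (X : Type*) [AddCommGroup X] [Module F X] : M ⊗[F] X →ₗ[F] X :=
  (TensorProduct.lid F X).toLinearMap ∘ₗ ε.rTensor X

theorem counitHead_tmul (ε : M →ₗ[F] F) (m : M) (x : X) :
    counitHead ε X (m ⊗ₜ x) = ε m • x := by
  simp [counitHead]

theorem counitHead_natural (ε : M →ₗ[F] F) (g : X →ₗ[F] Y) (t : M ⊗[F] X) :
    counitHead ε Y (g.lTensor M t) = g (counitHead ε X t) := by
  induction t with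
  | zero => simp
  | add a b ha hb => simp only [map_add, ha, hb]
  | tmul a b => simp [counitHead_tmul]

end Counit

/-! ### The Hopf axioms from the recursion on generators -/

section Generated

variable {F V H : Type*} [Field F] [AddCommGroup V] [Module F V] [Ring H] [Algebra F H]
variable {X : Type*} [AddCommGroup X] [Module F X]

/-- The algebra `H` is generated by the image of the braided vector space `(V, τ)`, its braiding is
induced by `τ`, and the coproduct, counit and antipode are given by the recursion in which the
elements of `V` are primitive. -/
structure IsPrimitivelyGenerated (D : BraidedHopfData F H) (j : V →ₗ[F] H)
    (τ : V ⊗[F] V →ₗ[F] V ⊗[F] V) : Prop where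
  adjoin_range : Algebra.adjoin F (Set.range j) = ⊤
  yangBaxter : onFirst τ ∘ₗ onSecond τ ∘ₗ onFirst τ = onSecond τ ∘ₗ onFirst τ ∘ₗ onSecond τ
  isMulBraiding : IsMulBraiding D.braiding
  braiding : D.braiding ∘ₗ TensorProduct.map j j = TensorProduct.map j j ∘ₗ τ
  comul_one : D.comul 1 = 1 ⊗ₜ[F] 1
  comul_gen_mul : ∀ v x, D.comul (j v * x) = mulHead F H H (j v ⊗ₜ D.comul x) +
    (LinearMap.mul' F H).lTensor H (braidHead D.braiding H (j v ⊗ₜ D.comul x))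
  counit_one : D.counit 1 = 1
  counit_mul : ∀ x y, D.counit (x * y) = D.counit x * D.counit y
  counit_gen : ∀ v, D.counit (j v) = 0
  antipode_one : D.antipode 1 = 1
  antipode_gen_mul : ∀ v x, D.antipode (j v * x) =
    -LinearMap.mul' F H (D.braiding (j v ⊗ₜ D.antipode x))

variable {D : BraidedHopfData F H} {j : V →ₗ[F] H} {τ : V ⊗[F] V →ₗ[F] V ⊗[F] V}

local notation "c₁" => braidHead D.braiding _
local notation "c₂" => LinearMap.lTensor H (braidHead D.braiding _)
local notation "c₃" => LinearMap.lTensor H (LinearMap.lTensor H (braidHead D.braiding _))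
local notation "m₁" => mulHead F H _
local notation "m₂" => LinearMap.lTensor H (mulHead F H _)
local notation "m₃" => LinearMap.lTensor H (LinearMap.lTensor H (mulHead F H _))
local notation "m₄" => LinearMap.lTensor H (LinearMap.lTensor H (LinearMap.lTensor H (mulHead F H _)))
local notation "Δ₁" => comulHead D.comul _
local notation "Δ₂" => LinearMap.lTensor H (comulHead D.comul _)
local notation "Δ₃" => LinearMap.lTensor H (LinearMap.lTensor H (comulHead D.comul _))
local notation "ε₁" => counitHead D.counit _
local notation "ε₂" => LinearMap.lTensor H (counitHead D.counit _)
local notation "S₁" => LinearMap.rTensor _ D.antipode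
local notation "S₂" => LinearMap.lTensor H (LinearMap.rTensor _ D.antipode)
local notation "S₃" => LinearMap.lTensor H (LinearMap.lTensor H (LinearMap.rTensor _ D.antipode))

namespace IsPrimitivelyGenerated

theorem yangBaxterAt (h : IsPrimitivelyGenerated D j τ) (t : H ⊗[F] (H ⊗[F] (H ⊗[F] X))) :
    c₁ (c₂ (c₁ t)) = c₂ (c₁ (c₂ t)) :=
  h.isMulBraiding.yangBaxterAt h.adjoin_range h.braiding h.yangBaxter t

theorem comul_gen_mul_head (h : IsPrimitivelyGenerated D j τ) (v : V) (s : H ⊗[F] X) :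
    Δ₁ (m₁ (j v ⊗ₜ s)) = m₁ (j v ⊗ₜ Δ₁ s) + m₂ (c₁ (j v ⊗ₜ Δ₁ s)) := by
  induction s with
  | zero => simp
  | add a b ha hb => simp only [map_add, TensorProduct.tmul_add, ha, hb]; abel
  | tmul y x =>
    have e : ∀ z : H, comulHead D.comul X (z ⊗ₜ x) =
        ((TensorProduct.mk F H X).flip x).lTensor H (D.comul z) :=
      fun z => comulHead_append D.comul z x
    rw [mulHead_tmul, e, e, h.comul_gen_mul, map_add, ← mulHead_natural, LinearMap.lTensor_tmul,
      ← lTensor_shift₂₂ H (mulHead_append_apply (F := F) (H := H) x), ← braidHead_natural,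
      LinearMap.lTensor_tmul]

theorem antipode_gen_mul_head (h : IsPrimitivelyGenerated D j τ) (v : V) (s : H ⊗[F] X) :
    S₁ (m₁ (j v ⊗ₜ s)) = -m₁ (c₁ (j v ⊗ₜ S₁ s)) := by
  induction s with
  | zero => simp
  | add a b ha hb => simp only [map_add, TensorProduct.tmul_add, ha, hb]; abel
  | tmul y x =>
    rw [mulHead_tmul, LinearMap.rTensor_tmul, LinearMap.rTensor_tmul, braidHead_tmul,
      mulHead_assoc, h.antipode_gen_mul, TensorProduct.neg_tmul]

theorem counit_mul_head (h : IsPrimitivelyGenerated D j τ) (s : H ⊗[F] (H ⊗[F] X)) :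
    ε₁ (m₁ s) = ε₁ (ε₁ s) := by
  induction s with
  | zero => simp
  | add a b ha hb => simp only [map_add, ha, hb]
  | tmul a s =>
    induction s with
    | zero => simp
    | add a b ha hb => simp only [map_add, TensorProduct.tmul_add, ha, hb]
    | tmul b x => simp [mulHead_tmul, counitHead_tmul, h.counit_mul, mul_smul]

/-- The structure maps are known through left multiplication by generators only, hence this form of
induction. The inductive step is posed for an arbitrary tensor `s`, so that it can be written with
the operators on strands. -/
theorem induction_left_head (h : IsPrimitivelyGenerated D j τ) {P : H ⊗[F] X → Prop}
    (zero : P 0) (one : ∀ x, P (1 ⊗ₜ x)) (gen_mul : ∀ v s, P s → P (m₁ (j v ⊗ₜ s)))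
    (add : ∀ s t, P s → P t → P (s + t)) (smul : ∀ (r : F) s, P s → P (r • s)) (s : H ⊗[F] X) :
    P s := by
  induction s with
  | zero => exact zero
  | add a b ha hb => exact add _ _ ha hb
  | tmul y x =>
    refine generated_induction_left h.adjoin_range (P := fun y => P (y ⊗ₜ x)) (one x) ?_ ?_ ?_ y
    · intro v y hy; simpa only [mulHead_tmul] using gen_mul v _ hy
    · intro a b ha hb; rw [TensorProduct.add_tmul]; exact add _ _ ha hb
    · intro r a ha; rw [← TensorProduct.smul_tmul']; exact smul r _ ha

/-! Compatibility of the braiding with the counit. -/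

theorem counit_gen_tmul (h : IsPrimitivelyGenerated D j τ) (v : V) (s : X) :
    ε₁ (j v ⊗ₜ s) = 0 := by
  rw [counitHead_tmul, h.counit_gen, zero_smul]

theorem counit_braiding_left (h : IsPrimitivelyGenerated D j τ) (x : H) (s : H ⊗[F] X) :
    ε₁ (c₁ (x ⊗ₜ s)) = x ⊗ₜ ε₁ s := by
  revert x
  refine h.induction_left_head (P := fun s => ∀ x, ε₁ (c₁ (x ⊗ₜ s)) = x ⊗ₜ ε₁ s)
    ?_ ?_ ?_ ?_ ?_ s
  · simp
  · intro t x
    rw [h.isMulBraiding.one_right_head, counitHead_tmul, counitHead_tmul, h.counit_one, one_smul,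
      one_smul]
  · intro v s _ x
    rw [h.counit_mul_head, h.counit_gen_tmul, map_zero, TensorProduct.tmul_zero,
      ← LinearMap.lTensor_tmul, h.isMulBraiding.mul_right_head, h.counit_mul_head]
    -- The right side has become zero because `ε(v) = 0`. On the left, `x` crosses `v` and leaves a
    -- vector of `V` in front, which `ε` kills too.
    refine h.isMulBraiding.braidHead_tmul_gen_induction h.adjoin_range h.braiding x v _
      (P := fun u => ε₁ (ε₁ (c₂ u)) = 0) (by simp)
      (fun s t hs ht => by simp only [map_add, hs, ht, add_zero]) fun w z => ?_
    rw [LinearMap.lTensor_tmul, h.counit_gen_tmul, map_zero]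
  · intro a b ha hb x; simp only [map_add, TensorProduct.tmul_add, ha, hb]
  · intro r a ha x; simp only [map_smul, TensorProduct.tmul_smul, ha]

theorem counit_braiding_right (h : IsPrimitivelyGenerated D j τ) (s : H ⊗[F] (H ⊗[F] X)) :
    ε₂ (c₁ s) = ε₁ s := by
  refine h.induction_left_head (P := fun s => ε₂ (c₁ s) = ε₁ s) ?_ ?_ ?_ ?_ ?_ s
  · simp
  · intro t
    rw [h.isMulBraiding.one_left_head, counitHead_tmul, h.counit_one, one_smul]
    induction t with
    | zero => simp
    | add a b ha hb => simp only [map_add, ha, hb]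
    | tmul y x => simp [counitHead_tmul, h.counit_one]
  · intro v s _
    rw [h.counit_mul_head, h.counit_gen_tmul, map_zero, h.isMulBraiding.mul_left_head,
      lTensor_shift₂₂ H h.counit_mul_head, LinearMap.lTensor_tmul]
    refine h.isMulBraiding.braidHead_gen_induction' h.adjoin_range h.braiding v _
      (P := fun u => ε₂ (ε₂ u) = 0) (by simp)
      (fun s t hs ht => by simp only [map_add, hs, ht, add_zero]) fun w z x => ?_
    rw [LinearMap.lTensor_tmul, h.counit_gen_tmul, TensorProduct.tmul_zero, map_zero]
  · intro a b ha hb; simp only [map_add, ha, hb]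
  · intro r a ha; simp only [map_smul, ha]

/-! Compatibility of the braiding with the coproduct. -/

theorem comul_one_head (h : IsPrimitivelyGenerated D j τ) (x : X) :
    Δ₁ (1 ⊗ₜ x) = 1 ⊗ₜ (1 ⊗ₜ x) := by
  rw [comulHead_tmul, h.comul_one, TensorProduct.assoc_tmul]

/-- After the crossing a vector of `V` stands in the second place, so the recursion for the
coproduct applies there. -/
theorem comul_mul_shift (h : IsPrimitivelyGenerated D j τ) (v : V) (s : H ⊗[F] (H ⊗[F] X)) :
    Δ₂ (m₂ (c₁ (j v ⊗ₜ s))) = m₂ (Δ₃ (c₁ (j v ⊗ₜ s))) + m₃ (c₂ (Δ₃ (c₁ (j v ⊗ₜ s)))) := by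
  refine h.isMulBraiding.braidHead_gen_induction' h.adjoin_range h.braiding v _
    (P := fun u => Δ₂ (m₂ u) = m₂ (Δ₃ u) + m₃ (c₂ (Δ₃ u))) (by simp)
    (fun s t hs ht => by simp only [map_add, hs, ht]; abel) fun y w x => ?_
  simp only [LinearMap.lTensor_tmul, h.comul_gen_mul_head, TensorProduct.tmul_add]

theorem comul_braiding_left (h : IsPrimitivelyGenerated D j τ) (x : H) (s : H ⊗[F] X) :
    Δ₁ (c₁ (x ⊗ₜ s)) = c₂ (c₁ (x ⊗ₜ Δ₁ s)) := by
  revert x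
  refine h.induction_left_head (P := fun s => ∀ x, Δ₁ (c₁ (x ⊗ₜ s)) = c₂ (c₁ (x ⊗ₜ Δ₁ s)))
    ?_ ?_ ?_ ?_ ?_ s
  · simp
  · intro t x
    rw [h.isMulBraiding.one_right_head, h.comul_one_head, h.comul_one_head,
      h.isMulBraiding.one_right_head, LinearMap.lTensor_tmul, h.isMulBraiding.one_right_head]
  · intro v s hs x
    have key : Δ₁ (m₁ (c₂ (c₁ (x ⊗ₜ (j v ⊗ₜ s))))) =
        m₁ (c₃ (c₂ (Δ₃ (c₁ (x ⊗ₜ (j v ⊗ₜ s)))))) +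
          m₂ (c₁ (c₃ (c₂ (Δ₃ (c₁ (x ⊗ₜ (j v ⊗ₜ s))))))) := by
      refine h.isMulBraiding.braidHead_tmul_gen_induction h.adjoin_range h.braiding x v _
        (P := fun u => Δ₁ (m₁ (c₂ u)) = m₁ (c₃ (c₂ (Δ₃ u))) + m₂ (c₁ (c₃ (c₂ (Δ₃ u)))))
        (by simp) (fun s t hs ht => by simp only [map_add, hs, ht]; abel) fun w z => ?_
      rw [LinearMap.lTensor_tmul, h.comul_gen_mul_head, hs]
      simp only [LinearMap.lTensor_tmul]
    have word₁ : ∀ w : H ⊗[F] (H ⊗[F] (H ⊗[F] (H ⊗[F] X))),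
        c₂ (c₁ (m₂ w)) = m₁ (c₃ (c₂ (c₁ w))) := fun w => by
      rw [h.isMulBraiding.mul_right_head, ← mulHead_natural]
    -- In this summand of `Δ (v s)` the vector `v` has crossed the first leg of `Δ s`; the
    -- Yang–Baxter equation is used for `x`, `v` and that leg.
    have word₂ : ∀ w : H ⊗[F] (H ⊗[F] (H ⊗[F] (H ⊗[F] X))),
        c₂ (c₁ (m₃ (c₂ w))) = m₂ (c₁ (c₃ (c₂ (c₁ w)))) := fun w => by
      rw [braidHead_natural _ (mulHead F H X), lTensor_shift₂₃ H h.isMulBraiding.mul_right_head,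
        ← h.yangBaxterAt, ← braidHead_natural _ (braidHead D.braiding X)]
    rw [← LinearMap.lTensor_tmul, h.isMulBraiding.mul_right_head, key, ← braidHead_natural,
      ← word₁, ← word₂, ← map_add, ← map_add, h.comul_gen_mul_head]
    simp only [LinearMap.lTensor_tmul, TensorProduct.tmul_add]
  · intro a b ha hb x; simp only [map_add, TensorProduct.tmul_add, ha, hb]
  · intro r a ha x; simp only [map_smul, TensorProduct.tmul_smul, ha]

theorem comul_braiding_right (h : IsPrimitivelyGenerated D j τ) (s : H ⊗[F] (H ⊗[F] X)) :
    Δ₂ (c₁ s) = c₁ (c₂ (Δ₁ s)) := by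
  refine h.induction_left_head (P := fun s => Δ₂ (c₁ s) = c₁ (c₂ (Δ₁ s))) ?_ ?_ ?_ ?_ ?_ s
  · simp
  · intro t
    rw [h.isMulBraiding.one_left_head, h.comul_one_head, LinearMap.lTensor_tmul,
      h.isMulBraiding.one_left_head, h.isMulBraiding.one_left_head]
    refine lTensor_shift₂₂ H (fun t => ?_) t
    rw [TensorProduct.mk_apply, h.comul_one_head]; rfl
  · intro v s hs
    rw [h.isMulBraiding.mul_left_head, LinearMap.lTensor_tmul, h.comul_mul_shift,
      ← braidHead_natural, LinearMap.lTensor_tmul, hs, h.comul_gen_mul_head, map_add, map_add,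
      ← mulHead_natural, h.isMulBraiding.mul_left_head,
      lTensor_shift₂₃ H h.isMulBraiding.mul_left_head, braidHead_natural _ (mulHead F H X),
      ← braidHead_natural _ (braidHead D.braiding X), h.yangBaxterAt]
    simp only [LinearMap.lTensor_tmul]
  · intro a b ha hb; simp only [map_add, ha, hb]
  · intro r a ha; simp only [map_smul, ha]

/-! The coalgebra axioms. -/

/-- Applied twice to `v s`, the recursion gives on both sides three terms, in which `v` is
multiplied into the first, second or third leg of the iterated coproduct of `s`. -/
theorem coassoc_head (h : IsPrimitivelyGenerated D j τ) (s : H ⊗[F] X) :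
    Δ₁ (Δ₁ s) = Δ₂ (Δ₁ s) := by
  refine h.induction_left_head (P := fun s => Δ₁ (Δ₁ s) = Δ₂ (Δ₁ s)) ?_ ?_ ?_ ?_ ?_ s
  · simp
  · intro t
    rw [h.comul_one_head, h.comul_one_head, LinearMap.lTensor_tmul, h.comul_one_head]
  · intro v s hs
    rw [h.comul_gen_mul_head, map_add, map_add, h.comul_gen_mul_head, ← mulHead_natural,
      comulHead_natural, h.comul_braiding_left, h.comul_mul_shift, ← braidHead_natural,
      LinearMap.lTensor_tmul, ← hs, add_assoc]
  · intro a b ha hb; simp only [map_add, ha, hb]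
  · intro r a ha; simp only [map_smul, ha]

theorem counit_left_head (h : IsPrimitivelyGenerated D j τ) (s : H ⊗[F] X) :
    ε₁ (Δ₁ s) = s := by
  refine h.induction_left_head (P := fun s => ε₁ (Δ₁ s) = s) ?_ ?_ ?_ ?_ ?_ s
  · simp
  · intro t
    rw [h.comul_one_head, counitHead_tmul, h.counit_one, one_smul]
  · intro v s hs
    rw [h.comul_gen_mul_head, map_add, h.counit_mul_head, h.counit_gen_tmul, map_zero, zero_add,
      counitHead_natural, h.counit_braiding_left, hs]
  · intro a b ha hb; simp only [map_add, ha, hb]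
  · intro r a ha; simp only [map_smul, ha]

theorem counit_right_head (h : IsPrimitivelyGenerated D j τ) (s : H ⊗[F] X) :
    ε₂ (Δ₁ s) = s := by
  refine h.induction_left_head (P := fun s => ε₂ (Δ₁ s) = s) ?_ ?_ ?_ ?_ ?_ s
  · simp
  · intro t
    rw [h.comul_one_head, LinearMap.lTensor_tmul, counitHead_tmul, h.counit_one, one_smul]
  · intro v s hs
    have key : ε₂ (m₂ (c₁ (j v ⊗ₜ Δ₁ s))) = 0 := by
      refine h.isMulBraiding.braidHead_gen_induction' h.adjoin_range h.braiding v _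
        (P := fun u => ε₂ (m₂ u) = 0) (by simp)
        (fun s t hs ht => by simp only [map_add, hs, ht, add_zero]) fun w z x => ?_
      rw [LinearMap.lTensor_tmul, LinearMap.lTensor_tmul, h.counit_mul_head, h.counit_gen_tmul,
        map_zero, TensorProduct.tmul_zero]
    rw [h.comul_gen_mul_head, map_add, key, add_zero, ← mulHead_natural, LinearMap.lTensor_tmul,
      hs]
  · intro a b ha hb; simp only [map_add, ha, hb]
  · intro r a ha; simp only [map_smul, ha]

/-- Induction on the left factor. The recursion is the case of a generator, and the step from `s` to
`v s` is associativity of the twisted product, treated in `word₁` for the summand `v ⊗ 1` of `Δ v`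
and in `word₂` for `1 ⊗ v`. -/
theorem comul_mul_head (h : IsPrimitivelyGenerated D j τ) (s : H ⊗[F] (H ⊗[F] X)) :
    Δ₁ (m₁ s) = m₁ (m₃ (c₂ (Δ₁ (Δ₂ s)))) := by
  refine h.induction_left_head (P := fun s => Δ₁ (m₁ s) = m₁ (m₃ (c₂ (Δ₁ (Δ₂ s)))))
    ?_ ?_ ?_ ?_ ?_ s
  · simp
  · intro t
    rw [LinearMap.lTensor_tmul, h.comul_one_head, LinearMap.lTensor_tmul,
      h.isMulBraiding.one_left_head, LinearMap.lTensor_tmul]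
    induction t with
    | zero => simp
    | add a b ha hb => simp only [map_add, TensorProduct.tmul_add, ha, hb]
    | tmul y x =>
      rw [mulHead_tmul, one_mul]
      induction comulHead D.comul X (y ⊗ₜ x) with
      | zero => simp
      | add a b ha hb =>
        simp only [map_add, TensorProduct.tmul_add] at ha hb ⊢
        rw [← ha, ← hb]
      | tmul a s =>
        induction s with
        | zero => simp
        | add a b ha hb =>
          simp only [map_add, TensorProduct.tmul_add] at ha hb ⊢
          rw [← ha, ← hb]
        | tmul b s => simp [mulHead_tmul]
  · intro v s hs
    have word₁ : ∀ r : H ⊗[F] (H ⊗[F] (H ⊗[F] (H ⊗[F] (H ⊗[F] X)))),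
        m₁ (m₂ (m₄ (c₃ r))) = m₁ (m₃ (c₂ (m₁ r))) := fun r => by
      rw [← mulHead_mulHead, mulHead_natural ((mulHead F H X).lTensor H),
        mulHead_natural (braidHead D.braiding (H ⊗[F] X))]
    have word₂ : ∀ r : H ⊗[F] (H ⊗[F] (H ⊗[F] (H ⊗[F] (H ⊗[F] X)))),
        m₂ (c₁ (m₂ (m₄ (c₃ r)))) = m₁ (m₃ (c₂ (m₂ (c₁ r)))) := fun r => by
      rw [h.isMulBraiding.mul_right_head, ← mulHead_natural (mulHead F H X),
        braidHead_natural _ ((mulHead F H X).lTensor H),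
        lTensor_shift₂₂ H (braidHead_natural D.braiding (mulHead F H X)),
        braidHead_natural _ (braidHead D.braiding (H ⊗[F] X)),
        lTensor_shift₂₃ H h.isMulBraiding.mul_left_head,
        lTensor_shift₂₂ H (lTensor_shift₂₂ H (mulHead_mulHead (F := F) (H := H) (X := X)))]
    rw [mulHead_mulHead, LinearMap.lTensor_tmul, h.comul_gen_mul_head, hs,
      ← mulHead_natural (comulHead D.comul X), LinearMap.lTensor_tmul, h.comul_gen_mul_head,
      map_add, map_add, map_add, ← word₁, ← word₂]
    simp only [LinearMap.lTensor_tmul]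
  · intro a b ha hb; simp only [map_add, ha, hb]
  · intro r a ha; simp only [map_smul, ha]

/-! The antipode. -/

theorem antipode_one_head (h : IsPrimitivelyGenerated D j τ) (x : X) :
    S₁ (1 ⊗ₜ[F] x) = 1 ⊗ₜ x := by
  rw [LinearMap.rTensor_tmul, h.antipode_one]

/-- The recursion for the antipode in the second place, where the crossing has put a vector of `V`.
-/
theorem antipode_mul_shift (h : IsPrimitivelyGenerated D j τ) (v : V)
    (s : H ⊗[F] (H ⊗[F] X)) :
    S₂ (m₂ (c₁ (j v ⊗ₜ s))) = -m₂ (c₂ (S₃ (c₁ (j v ⊗ₜ s)))) := by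
  refine h.isMulBraiding.braidHead_gen_induction' h.adjoin_range h.braiding v _
    (P := fun u => S₂ (m₂ u) = -m₂ (c₂ (S₃ u))) (by simp)
    (fun s t hs ht => by simp only [map_add, hs, ht]; abel) fun y w x => ?_
  simp only [LinearMap.lTensor_tmul, h.antipode_gen_mul_head, TensorProduct.tmul_neg]

theorem braiding_antipode_left (h : IsPrimitivelyGenerated D j τ) (s : H ⊗[F] (H ⊗[F] X)) :
    c₁ (S₁ s) = S₂ (c₁ s) := by
  refine h.induction_left_head (P := fun s => c₁ (S₁ s) = S₂ (c₁ s)) ?_ ?_ ?_ ?_ ?_ s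
  · simp
  · intro t
    rw [h.antipode_one_head, h.isMulBraiding.one_left_head]
    induction t with
    | zero => simp
    | add a b ha hb => simp only [map_add, ← ha, ← hb]
    | tmul y x => simp [h.antipode_one]
  · intro v s hs
    rw [h.antipode_gen_mul_head, map_neg, h.isMulBraiding.mul_left_head, h.yangBaxterAt,
      LinearMap.lTensor_tmul, hs, h.isMulBraiding.mul_left_head, LinearMap.lTensor_tmul,
      h.antipode_mul_shift, ← braidHead_natural]
    simp only [LinearMap.lTensor_tmul]
  · intro a b ha hb; simp only [map_add, ha, hb]
  · intro r a ha; simp only [map_smul, ha]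

theorem braiding_antipode_right (h : IsPrimitivelyGenerated D j τ) (x : H) (s : H ⊗[F] X) :
    c₁ (x ⊗ₜ S₁ s) = S₁ (c₁ (x ⊗ₜ s)) := by
  revert x
  refine h.induction_left_head (P := fun s => ∀ x, c₁ (x ⊗ₜ S₁ s) = S₁ (c₁ (x ⊗ₜ s)))
    ?_ ?_ ?_ ?_ ?_ s
  · simp
  · intro t x
    rw [h.antipode_one_head, h.isMulBraiding.one_right_head, h.antipode_one_head]
  · intro v s hs x
    have key : S₁ (m₁ (c₂ (c₁ (x ⊗ₜ (j v ⊗ₜ s))))) =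
        -m₁ (c₁ (c₂ (S₃ (c₁ (x ⊗ₜ (j v ⊗ₜ s)))))) := by
      refine h.isMulBraiding.braidHead_tmul_gen_induction h.adjoin_range h.braiding x v _
        (P := fun u => S₁ (m₁ (c₂ u)) = -m₁ (c₁ (c₂ (S₃ u)))) (by simp)
        (fun s t hs ht => by simp only [map_add, hs, ht]; abel) fun w z => ?_
      rw [LinearMap.lTensor_tmul, h.antipode_gen_mul_head, ← hs]
      simp only [LinearMap.lTensor_tmul]
    have e : x ⊗ₜ m₁ (c₁ (j v ⊗ₜ S₁ s)) = m₂ (c₂ (S₃ (x ⊗ₜ[F] (j v ⊗ₜ[F] s)))) := by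
      simp only [LinearMap.lTensor_tmul]
    rw [h.antipode_gen_mul_head, TensorProduct.tmul_neg, map_neg, e,
      h.isMulBraiding.mul_right_head, ← h.yangBaxterAt, braidHead_natural,
      ← LinearMap.lTensor_tmul, h.isMulBraiding.mul_right_head, key]
  · intro a b ha hb x; simp only [map_add, TensorProduct.tmul_add, ha, hb]
  · intro r a ha x; simp only [map_smul, TensorProduct.tmul_smul, ha]

/-- The two terms of `Δ (v s)` cancel by associativity alone: the recursion for `S` and the
commutation of `S` with the braiding give the same crossing of `v` with opposite signs. -/
theorem antipode_left_head (h : IsPrimitivelyGenerated D j τ) (s : H ⊗[F] X) :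
    m₁ (S₁ (Δ₁ s)) = 1 ⊗ₜ ε₁ s := by
  refine h.induction_left_head (P := fun s => m₁ (S₁ (Δ₁ s)) = 1 ⊗ₜ ε₁ s) ?_ ?_ ?_ ?_ ?_ s
  · simp
  · intro t
    rw [h.comul_one_head, h.antipode_one_head, mulHead_tmul, counitHead_tmul, h.counit_one,
      one_smul, one_mul]
  · intro v s _
    rw [h.comul_gen_mul_head, map_add, h.antipode_gen_mul_head, rTensor_lTensor_apply,
      h.braiding_antipode_right, h.counit_mul_head, h.counit_gen_tmul, map_zero,
      TensorProduct.tmul_zero, map_add, map_neg, mulHead_mulHead, neg_add_cancel]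
  · intro a b ha hb; simp only [map_add, TensorProduct.tmul_add, ha, hb]
  · intro r a ha; simp only [map_smul, TensorProduct.tmul_smul, ha]

/-- Here the hypothesis for `s` is needed: it turns the two terms of `Δ (v s)` into `v ε(s)` and its
negative. -/
theorem antipode_right_head (h : IsPrimitivelyGenerated D j τ) (s : H ⊗[F] X) :
    m₁ (S₂ (Δ₁ s)) = 1 ⊗ₜ ε₁ s := by
  refine h.induction_left_head (P := fun s => m₁ (S₂ (Δ₁ s)) = 1 ⊗ₜ ε₁ s) ?_ ?_ ?_ ?_ ?_ s
  · simp
  · intro t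
    rw [h.comul_one_head, LinearMap.lTensor_tmul, h.antipode_one_head, mulHead_tmul,
      counitHead_tmul, h.counit_one, one_smul, one_mul]
  · intro v s hs
    rw [h.comul_gen_mul_head, map_add, h.antipode_mul_shift, ← mulHead_natural,
      ← braidHead_natural, LinearMap.lTensor_tmul, map_add, map_neg,
      ← mulHead_mulHead, ← h.isMulBraiding.mul_right_head, mulHead_mulHead,
      LinearMap.lTensor_tmul, hs,
      h.counit_mul_head, h.counit_gen_tmul, map_zero, TensorProduct.tmul_zero,
      h.isMulBraiding.one_right_head, mulHead_tmul, mulHead_tmul, one_mul, mul_one,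
      add_neg_cancel]
  · intro a b ha hb; simp only [map_add, TensorProduct.tmul_add, ha, hb]
  · intro r a ha; simp only [map_smul, TensorProduct.tmul_smul, ha]

/-- The antipode reverses products up to the braiding. -/
theorem antipode_mul_head (h : IsPrimitivelyGenerated D j τ) (s : H ⊗[F] (H ⊗[F] X)) :
    S₁ (m₁ s) = m₁ (c₁ (S₁ (S₂ s))) := by
  refine h.induction_left_head (P := fun s => S₁ (m₁ s) = m₁ (c₁ (S₁ (S₂ s)))) ?_ ?_ ?_ ?_ ?_ s
  · simp
  · intro t
    rw [LinearMap.lTensor_tmul, h.antipode_one_head, h.isMulBraiding.one_left_head]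
    induction t with
    | zero => simp
    | add a b ha hb => simp only [map_add, TensorProduct.tmul_add, ha, hb]
    | tmul y x => simp [mulHead_tmul]
  · intro v s hs
    have e : j v ⊗ₜ m₁ (c₁ (S₁ (S₂ s))) = m₂ (c₂ (j v ⊗ₜ[F] (S₁ (S₂ s)))) := by
      simp only [LinearMap.lTensor_tmul]
    rw [mulHead_mulHead, LinearMap.lTensor_tmul, h.antipode_gen_mul_head, hs, e,
      h.isMulBraiding.mul_right_head, ← mulHead_natural, LinearMap.lTensor_tmul,
      LinearMap.lTensor_tmul, h.antipode_gen_mul_head, map_neg, map_neg, h.isMulBraiding.mul_left_head,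
      ← mulHead_mulHead, h.yangBaxterAt]
    simp only [LinearMap.lTensor_tmul]
  · intro a b ha hb; simp only [map_add, ha, hb]
  · intro r a ha; simp only [map_smul, ha]

/-! The axioms of a braided Hopf algebra, from their versions with a further tensor factor. -/

local notation "α" => LinearMap.flip (TensorProduct.mk F H F) 1
local notation "α₂" => LinearMap.lTensor H (LinearMap.flip (TensorProduct.mk F H F) 1)

theorem antipode_append (x : H) : S₁ (α x) = α (D.antipode x) := by
  simp

theorem counitHead_append (x : H) : counitHead D.counit F (α x) = D.counit x := by
  simp [counitHead_tmul]

theorem append_braidedMul (s t : H ⊗[F] H) :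
    α₂ (D.braidedMul (s ⊗ₜ t)) = m₁ (m₃ (c₂ (TensorProduct.assoc F H H _ (s ⊗ₜ α₂ t)))) := by
  induction s with
  | zero => simp
  | add a b ha hb => simp only [map_add, TensorProduct.add_tmul, ha, hb]
  | tmul a b =>
    induction t with
    | zero => simp
    | add a b ha hb => simp only [map_add, TensorProduct.tmul_add, ha, hb]
    | tmul e f =>
      simp only [BraidedHopfData.braidedMul, LinearMap.comp_apply, LinearEquiv.coe_coe,
        TensorProduct.tensorTensorTensorAssoc_tmul, LinearMap.rTensor_tmul,
        LinearMap.lTensor_tmul, TensorProduct.assoc_tmul, braidHead_tmul]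
      induction D.braiding (b ⊗ₜ e) with
      | zero => simp
      | add a b ha hb => simp only [map_add, TensorProduct.tmul_add, TensorProduct.add_tmul, ha, hb]
      | tmul e b => simp [mulHead_tmul]

theorem comul_mul (h : IsPrimitivelyGenerated D j τ) (x y : H) :
    D.comul (x * y) = D.braidedMul (D.comul x ⊗ₜ D.comul y) := by
  refine lTensor_append_one_injective ?_
  rw [append_braidedMul, ← comulHead_append, ← comulHead_append, ← comulHead_tmul]
  have := h.comul_mul_head (X := F) (x ⊗ₜ α y)
  rw [LinearMap.lTensor_tmul] at this
  rw [← this, LinearMap.flip_apply, LinearMap.flip_apply, TensorProduct.mk_apply,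
    TensorProduct.mk_apply, mulHead_tmul]

/-- Each remaining axiom is a spectator version at `X = F`, with the trailing `1` cancelled.
Bijectivity of the braiding is not provided by the recursion and is supplied separately. -/
theorem isBraidedHopfAlgebra (h : IsPrimitivelyGenerated D j τ)
    (hb : Function.Bijective D.braiding) : D.IsBraidedHopfAlgebra where
  coassoc := by
    refine LinearMap.ext fun x => lTensor_lTensor_append_one_injective ?_
    have := h.coassoc_head (α x)
    rw [comulHead_append, comulHead_natural,
      lTensor_shift₂₂ H (comulHead_append (X := F) D.comul · 1)] at this
    exact this
  counit_left := by
    refine LinearMap.ext fun x => append_one_injective (F := F) ?_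
    have := h.counit_left_head (α x)
    rw [comulHead_append, counitHead_natural] at this
    exact this
  counit_right := by
    refine LinearMap.ext fun x => ?_
    have := h.counit_right_head (α x)
    rw [comulHead_append, ← LinearMap.comp_apply, ← LinearMap.lTensor_comp,
      show counitHead D.counit F ∘ₗ α = D.counit from LinearMap.ext counitHead_append] at this
    simpa using congrArg (TensorProduct.rid F H) this
  comul_mul := TensorProduct.ext' fun x y => h.comul_mul x y
  comul_one := h.comul_one
  counit_mul := h.counit_mul
  counit_one := h.counit_one
  antipode_left := by
    refine LinearMap.ext fun x => append_one_injective (F := F) ?_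
    have := h.antipode_left_head (α x)
    rw [comulHead_append, rTensor_lTensor_apply, mulHead_append_apply, counitHead_append] at this
    refine this.trans ?_
    simp [Algebra.algebraMap_eq_smul_one, ← TensorProduct.tmul_smul]
  antipode_right := by
    refine LinearMap.ext fun x => append_one_injective (F := F) ?_
    have := h.antipode_right_head (α x)
    rw [comulHead_append, lTensor_shift₂₂ H antipode_append, mulHead_append_apply,
      counitHead_append] at this
    refine this.trans ?_
    simp [Algebra.algebraMap_eq_smul_one, ← TensorProduct.tmul_smul]
  isBraiding := ⟨hb, (yangBaxter_iff_yangBaxterAt _).2 fun t => h.yangBaxterAt t⟩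
  braiding_one_left := h.isMulBraiding.one_left
  braiding_one_right := h.isMulBraiding.one_right
  braiding_mul_left := h.isMulBraiding.braiding_mul_left
  braiding_mul_right := h.isMulBraiding.braiding_mul_right
  braiding_counit_left := by
    refine TensorProduct.ext' fun x y => append_one_injective (F := F) ?_
    have := h.counit_braiding_left x (α y)
    rw [← LinearMap.lTensor_tmul, braidHead_append, counitHead_natural, counitHead_append] at this
    refine this.trans ?_
    simp [← TensorProduct.tmul_smul]
  braiding_counit_right := by
    refine TensorProduct.ext' fun x y => ?_
    have := h.counit_braiding_right (x ⊗ₜ α y)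
    rw [← LinearMap.lTensor_tmul, braidHead_append, ← LinearMap.comp_apply,
      ← LinearMap.lTensor_comp,
      show counitHead D.counit F ∘ₗ α = D.counit from LinearMap.ext counitHead_append,
      LinearMap.lTensor_tmul, counitHead_tmul] at this
    simpa using congrArg (TensorProduct.rid F H) this
  braiding_comul_left := by
    refine TensorProduct.ext' fun x y => (TensorProduct.assoc F H H H).injective
      (lTensor_lTensor_append_one_injective ?_)
    have := h.comul_braiding_left x (α y)
    rw [comulHead_append, ← LinearMap.lTensor_tmul, ← LinearMap.lTensor_tmul, braidHead_append,
      braidHead_natural, lTensor_shift₂₂ H (braidHead_append (X := F) D.braiding · 1),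
      comulHead_natural] at this
    refine this.trans ?_
    simp only [LinearMap.comp_apply, LinearEquiv.coe_coe, onFirst_assoc_symm, onSecond_assoc_symm,
      LinearEquiv.apply_symm_apply, LinearMap.lTensor_tmul]
  braiding_comul_right := by
    refine TensorProduct.ext' fun x y => (TensorProduct.assoc F H H H).injective ?_
    have := h.comul_braiding_right (x ⊗ₜ α y)
    rw [← LinearMap.lTensor_tmul, braidHead_append, comulHead_natural,
      lTensor_shift₂₂ H (comulHead_append (X := F) D.comul · 1),
      lTensor_shift₂₂ H (braidHead_append (X := F) D.braiding · 1), braidHead_natural] at this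
    rw [LinearMap.comp_apply, LinearMap.comp_apply, LinearEquiv.coe_coe,
      LinearEquiv.apply_symm_apply]
    refine (lTensor_lTensor_append_one_injective this).trans ?_
    obtain ⟨t, ht⟩ := (TensorProduct.assoc F H H H).symm.surjective (D.comul.rTensor H (x ⊗ₜ y))
    simp only [LinearMap.comp_apply, ← ht, onFirst_assoc_symm, onSecond_assoc_symm,
      LinearEquiv.apply_symm_apply]
    rw [comulHead, LinearMap.comp_apply, ← ht, LinearEquiv.coe_coe, LinearEquiv.apply_symm_apply]
  braiding_antipode_left := by
    refine LinearMap.ext fun t => lTensor_append_one_injective ?_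
    have := h.braiding_antipode_left (α₂ t)
    rw [rTensor_lTensor_apply, braidHead_append, braidHead_append,
      lTensor_shift₂₂ H antipode_append] at this
    exact this
  braiding_antipode_right := by
    refine TensorProduct.ext' fun x y => lTensor_append_one_injective ?_
    have := h.braiding_antipode_right x (α y)
    rw [antipode_append, show x ⊗ₜ[F] α (D.antipode y) = α₂ (x ⊗ₜ[F] D.antipode y) from rfl,
      show x ⊗ₜ[F] α y = α₂ (x ⊗ₜ[F] y) from rfl, braidHead_append, braidHead_append,
      rTensor_lTensor_apply] at this
    exact this

end IsPrimitivelyGenerated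

end Generated

/-! ### The tensor algebra of a braided vector space -/

section TensorAlgebra

open TensorAlgebra (ι)

variable {F V : Type*} [Field F] [AddCommGroup V] [Module F V]
variable {X : Type*} [AddCommGroup X] [Module F X]
variable (τ : V ⊗[F] V →ₗ[F] V ⊗[F] V)

theorem adjoin_range_ι : Algebra.adjoin F (Set.range (ι F : V →ₗ[F] TensorAlgebra F V)) = ⊤ :=
  TensorAlgebra.adjoin_range_ι

theorem tensorBraiding_ι (v : V) (y : TensorAlgebra F V) :
    tensorBraiding τ (ι F v ⊗ₜ y) = (ι F).lTensor (TensorAlgebra F V) (braidVector τ (v ⊗ₜ y)) := by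
  have h := tensorBraiding_ι_mul τ v 1 y
  rw [mul_one, tensorBraiding_one] at h
  rw [h]
  simp only [stepLeft, LinearMap.comp_apply, LinearEquiv.coe_coe, TensorProduct.assoc_symm_tmul,
    LinearMap.rTensor_tmul]
  induction braidVector τ (v ⊗ₜ y) with
  | zero => simp
  | add a b ha hb => simp only [map_add, TensorProduct.add_tmul, ha, hb]
  | tmul a b => simp

/-- Rewrites one step of the recursive definition in the shape of the left product rule. -/
theorem stepLeft_eq (v : V) (t : TensorAlgebra F V ⊗[F] TensorAlgebra F V) :
    stepLeft τ (v ⊗ₜ t) = (LinearMap.mul' F (TensorAlgebra F V)).lTensor (TensorAlgebra F V)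
      (braidHead (tensorBraiding τ) (TensorAlgebra F V) (ι F v ⊗ₜ t)) := by
  induction t with
  | zero => simp
  | add a b ha hb => simp only [map_add, TensorProduct.tmul_add, ha, hb]
  | tmul y x =>
    rw [braidHead_tmul, tensorBraiding_ι]
    simp only [stepLeft, LinearMap.comp_apply, LinearEquiv.coe_coe, TensorProduct.assoc_symm_tmul,
      LinearMap.rTensor_tmul]
    induction braidVector τ (v ⊗ₜ y) with
    | zero => simp
    | add a b ha hb => simp only [map_add, TensorProduct.add_tmul, ha, hb]
    | tmul a b => simp

theorem tensorBraiding_one_right (x : TensorAlgebra F V) :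
    tensorBraiding τ (x ⊗ₜ 1) = 1 ⊗ₜ x := by
  refine generated_induction_left adjoin_range_ι
    (P := fun x => tensorBraiding τ (x ⊗ₜ 1) = 1 ⊗ₜ x) ?_ ?_ ?_ ?_ x
  · exact tensorBraiding_one τ 1
  · intro v x hx
    rw [tensorBraiding_ι_mul, hx, stepLeft_eq, braidHead_tmul, tensorBraiding_ι, braidVector_one]
    simp
  · intro x y hx hy; simp only [TensorProduct.add_tmul, TensorProduct.tmul_add, map_add, hx, hy]
  · intro r x hx; rw [← TensorProduct.smul_tmul', map_smul, hx, TensorProduct.tmul_smul]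

/-- The braiding is defined as a left action of its first argument, so a product acts as a
composite. The induction on the left factor transports this from vectors to all of `T(V)`. -/
theorem tensorBraiding_mul_left
    (t : TensorAlgebra F V ⊗[F] (TensorAlgebra F V ⊗[F] TensorAlgebra F V)) :
    tensorBraiding τ (mulHead F (TensorAlgebra F V) (TensorAlgebra F V) t) =
      (LinearMap.mul' F (TensorAlgebra F V)).lTensor (TensorAlgebra F V)
        (braidHead (tensorBraiding τ) (TensorAlgebra F V)
          ((tensorBraiding τ).lTensor (TensorAlgebra F V) t)) := by
  induction t with
  | zero => simp
  | add a b ha hb => simp only [map_add, ha, hb]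
  | tmul x t =>
  refine generated_induction_left adjoin_range_ι (P := fun x => ∀ t,
    tensorBraiding τ (mulHead F (TensorAlgebra F V) (TensorAlgebra F V) (x ⊗ₜ t)) =
      (LinearMap.mul' F (TensorAlgebra F V)).lTensor (TensorAlgebra F V)
        (braidHead (tensorBraiding τ) (TensorAlgebra F V)
          ((tensorBraiding τ).lTensor (TensorAlgebra F V) (x ⊗ₜ t)))) ?_ ?_ ?_ ?_ x t
  · intro t
    induction t with
    | zero => simp
    | add a b ha hb => simp only [map_add, TensorProduct.tmul_add, ha, hb]
    | tmul y z =>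
      rw [mulHead_tmul, one_mul, LinearMap.lTensor_tmul]
      induction tensorBraiding τ (y ⊗ₜ z) with
      | zero => simp
      | add a b ha hb =>
        simp only [map_add, TensorProduct.tmul_add] at ha hb ⊢
        rw [← ha, ← hb]
      | tmul a b => simp [braidHead_tmul, tensorBraiding_one]
  · intro v x hx t
    induction t with
    | zero => simp
    | add a b ha hb => simp only [map_add, TensorProduct.tmul_add, ha, hb]
    | tmul y z =>
      have := hx (y ⊗ₜ z)
      rw [mulHead_tmul, LinearMap.lTensor_tmul] at this
      rw [mulHead_tmul, mul_assoc, tensorBraiding_ι_mul, stepLeft_eq, this, LinearMap.lTensor_tmul]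
      clear this
      induction tensorBraiding τ (y ⊗ₜ z) with
      | zero => simp
      | add a b ha hb => simp only [map_add, TensorProduct.tmul_add, ha, hb]
      | tmul a b =>
        rw [braidHead_tmul, braidHead_tmul, tensorBraiding_ι_mul, stepLeft_eq]
        induction tensorBraiding τ (x ⊗ₜ a) with
        | zero => simp
        | add a b ha hb =>
          simp only [map_add, TensorProduct.tmul_add, TensorProduct.add_tmul, ha, hb]
        | tmul e f =>
          rw [TensorProduct.assoc_tmul, LinearMap.lTensor_tmul, LinearMap.mul'_apply,
            braidHead_tmul, braidHead_tmul]
          induction tensorBraiding τ (ι F v ⊗ₜ e) with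
          | zero => simp
          | add a b ha hb => simp only [map_add, TensorProduct.add_tmul, ha, hb]
          | tmul c d => simp [mul_assoc]
  · intro a b ha hb t; simp only [TensorProduct.add_tmul, map_add, ha, hb]
  · intro r a ha t; simp only [← TensorProduct.smul_tmul', map_smul, ha]

local notation "T" => TensorAlgebra F V
local notation "c₁" => braidHead (tensorBraiding τ) _
local notation "c₂" => LinearMap.lTensor (TensorAlgebra F V) (braidHead (tensorBraiding τ) _)
local notation "m₁" => mulHead F (TensorAlgebra F V) _
local notation "m₂" => LinearMap.lTensor (TensorAlgebra F V) (mulHead F (TensorAlgebra F V) _)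

theorem tensorBraiding_ι_tmul_ι_mul (v w : V) (s : T ⊗[F] X) :
    c₁ (ι F v ⊗ₜ m₁ (ι F w ⊗ₜ s)) = m₁ (c₂ (c₁ (ι F v ⊗ₜ (ι F w ⊗ₜ s)))) := by
  induction s with
  | zero => simp
  | add a b ha hb => simp only [map_add, TensorProduct.tmul_add, ha, hb]
  | tmul y x =>
    rw [mulHead_tmul, braidHead_tmul, tensorBraiding_ι, braidVector_ι_mul, braidHead_tmul,
      tensorBraiding_ι_ι]
    induction τ (v ⊗ₜ w) with
    | zero => simp
    | add a b ha hb => simp only [map_add, TensorProduct.add_tmul, ha, hb]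
    | tmul a b =>
      simp only [TensorProduct.map_tmul, TensorProduct.assoc_tmul, LinearMap.lTensor_tmul,
        braidHead_tmul, tensorBraiding_ι]
      induction braidVector τ (b ⊗ₜ y) with
      | zero => simp
      | add a b ha hb => simp only [map_add, TensorProduct.tmul_add, TensorProduct.add_tmul, ha, hb]
      | tmul c d => simp [mulHead_tmul]

/-- For a generator `w` as the first factor of the product this is the recursion defining `c (v ⊗ w
y)`. The general case peels generators off that factor, and the vector that emerges from each
crossing is again in `V`. -/
theorem tensorBraiding_ι_mul_right (v : V) (s : T ⊗[F] (T ⊗[F] X)) :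
    c₁ (ι F v ⊗ₜ m₁ s) = m₁ (c₂ (c₁ (ι F v ⊗ₜ s))) := by
  induction s with
  | zero => simp
  | add a b ha hb => simp only [map_add, TensorProduct.tmul_add, ha, hb]
  | tmul y s =>
  refine generated_induction_left adjoin_range_ι (P := fun y => ∀ v,
    c₁ (ι F v ⊗ₜ m₁ (y ⊗ₜ s)) = m₁ (c₂ (c₁ (ι F v ⊗ₜ (y ⊗ₜ s))))) ?_ ?_ ?_ ?_ y v
  · intro v
    rw [braidHead_tmul _ _ 1, tensorBraiding_one_right, TensorProduct.assoc_tmul,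
      LinearMap.lTensor_tmul]
    induction s with
    | zero => simp
    | add a b ha hb => simp only [map_add, TensorProduct.tmul_add, ha, hb]
    | tmul z x =>
      rw [mulHead_tmul, one_mul]
      induction c₁ (ι F v ⊗ₜ (z ⊗ₜ x)) with
      | zero => simp
      | add a b ha hb =>
        simp only [map_add, TensorProduct.tmul_add] at ha hb ⊢
        rw [← ha, ← hb]
      | tmul a s => simp [mulHead, TensorProduct.assoc_symm_tmul]
  · intro w y hy v
    have e : m₁ ((ι F w * y) ⊗ₜ s) = m₁ (ι F w ⊗ₜ m₁ (y ⊗ₜ s)) := by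
      rw [← LinearMap.lTensor_tmul, ← mulHead_mulHead, mulHead_tmul]
    have key : c₂ (c₁ (ι F v ⊗ₜ (ι F w ⊗ₜ m₁ (y ⊗ₜ s)))) =
        m₂ (LinearMap.lTensor T c₂ (c₂ (c₁ (ι F v ⊗ₜ (ι F w ⊗ₜ (y ⊗ₜ s)))))) := by
      rw [braidHead_tmul, braidHead_tmul, tensorBraiding_ι_ι]
      induction τ (v ⊗ₜ w) with
      | zero => simp
      | add a b ha hb => simp only [map_add, TensorProduct.add_tmul, ha, hb]
      | tmul a b =>
        simp only [TensorProduct.map_tmul, TensorProduct.assoc_tmul, LinearMap.lTensor_tmul, hy]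
    rw [e, tensorBraiding_ι_tmul_ι_mul, key, ← mulHead_mulHead, mulHead_natural,
      ← tensorBraiding_ι_tmul_ι_mul, mulHead_tmul]
  · intro a b ha hb v; simp only [TensorProduct.add_tmul, TensorProduct.tmul_add, map_add, ha, hb]
  · intro r a ha v
    simp only [← TensorProduct.smul_tmul', TensorProduct.tmul_smul, map_smul, ha]

/-- Generators are now peeled off the element that does the crossing: the left product rule splits
off `v`, for which the right rule is known. -/
theorem tensorBraiding_mul_right_head (t : T ⊗[F] (T ⊗[F] (T ⊗[F] X))) :
    c₁ (m₂ t) = m₁ (c₂ (c₁ t)) := by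
  induction t with
  | zero => simp
  | add a b ha hb => simp only [map_add, ha, hb]
  | tmul x s =>
  refine generated_induction_left adjoin_range_ι (P := fun x => ∀ s : T ⊗[F] (T ⊗[F] X),
    c₁ (m₂ (x ⊗ₜ s)) = m₁ (c₂ (c₁ (x ⊗ₜ s)))) ?_ ?_ ?_ ?_ x s
  · intro s
    induction s with
    | zero => simp
    | add a b ha hb => simp only [map_add, TensorProduct.tmul_add, ha, hb]
    | tmul y s =>
      induction s with
      | zero => simp
      | add a b ha hb => simp only [map_add, TensorProduct.tmul_add, ha, hb]
      | tmul z x => simp [braidHead_tmul, tensorBraiding_one, mulHead_tmul]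
  · intro v x hx s
    have e : m₂ ((ι F v * x) ⊗ₜ s) = m₁ (ι F v ⊗ₜ m₂ (x ⊗ₜ s)) := by
      simp only [LinearMap.lTensor_tmul, mulHead_tmul]
    rw [e, mul_left_head_of_mul_left (tensorBraiding_mul_left τ),
      LinearMap.lTensor_tmul, hx, tensorBraiding_ι_mul_right, ← mulHead_natural, ← mulHead_tmul,
      mul_left_head_of_mul_left (tensorBraiding_mul_left τ),
      lTensor_shift₂₃ T
        (mul_left_head_of_mul_left (tensorBraiding_mul_left τ)),
      ← braidHead_natural]
    simp only [LinearMap.lTensor_tmul]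
  · intro a b ha hb s; simp only [TensorProduct.add_tmul, map_add, ha, hb]
  · intro r a ha s; simp only [← TensorProduct.smul_tmul', map_smul, ha]

theorem tensorBraiding_isMulBraiding : IsMulBraiding (tensorBraiding τ) where
  one_left := tensorBraiding_one τ
  one_right := tensorBraiding_one_right τ
  mul_left := tensorBraiding_mul_left τ
  mul_right t := by
    have := tensorBraiding_mul_right_head τ
      ((((TensorProduct.mk F T F).flip 1).lTensor T).lTensor T t)
    rw [lTensor_shift₂₂ T (mulHead_append_apply (F := F) (H := T) 1), braidHead_append,
      braidHead_natural, lTensor_shift₂₂ T (braidHead_append (X := F) (tensorBraiding τ) · 1),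
      mulHead_natural] at this
    exact lTensor_append_one_injective this

theorem primitiveMul_eq (v : V) (t : T ⊗[F] T) :
    primitiveMul τ (v ⊗ₜ t) = mulHead F T T (ι F v ⊗ₜ t) +
      (LinearMap.mul' F T).lTensor T (braidHead (tensorBraiding τ) T (ι F v ⊗ₜ t)) := by
  induction t with
  | zero => simp
  | add a b ha hb => simp only [map_add, TensorProduct.tmul_add, ha, hb]; abel
  | tmul x y => simp [primitiveMul, mulHead_tmul, braidHead_tmul]

theorem tensorData_isPrimitivelyGenerated
    (hτ : onFirst τ ∘ₗ onSecond τ ∘ₗ onFirst τ = onSecond τ ∘ₗ onFirst τ ∘ₗ onSecond τ) :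
    IsPrimitivelyGenerated (tensorData τ) (ι F) τ where
  adjoin_range := adjoin_range_ι
  yangBaxter := hτ
  isMulBraiding := tensorBraiding_isMulBraiding τ
  braiding := TensorProduct.ext' fun v w => tensorBraiding_ι_ι τ v w
  comul_one := tensorComul_one τ
  comul_gen_mul v x := by
    exact (tensorComul_ι_mul τ v x).trans (primitiveMul_eq τ v _)
  counit_one := map_one TensorAlgebra.algebraMapInv
  counit_mul := map_mul TensorAlgebra.algebraMapInv
  counit_gen v := by simp [tensorData, TensorAlgebra.algebraMapInv]
  antipode_one := tensorAntipode_one τ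
  antipode_gen_mul := tensorAntipode_ι_mul τ

end TensorAlgebra

/-! ### Uniqueness and the inverse of an induced braiding -/

section Uniqueness

variable {F V H H' : Type*} [Field F] [AddCommGroup V] [Module F V] [Ring H] [Algebra F H]
  [Ring H'] [Algebra F H']
variable {c d : H ⊗[F] H →ₗ[F] H ⊗[F] H} {c' : H' ⊗[F] H' →ₗ[F] H' ⊗[F] H'}
variable {j : V →ₗ[F] H} {τ : V ⊗[F] V →ₗ[F] V ⊗[F] V}

theorem mul'_map (f : H →ₐ[F] H') (t : H ⊗[F] H) :
    LinearMap.mul' F H' (TensorProduct.map f.toLinearMap f.toLinearMap t) =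
      f.toLinearMap (LinearMap.mul' F H t) := by
  induction t with
  | zero => simp
  | add a b ha hb => simp only [map_add, ha, hb]
  | tmul a b => simp

theorem mulHead_map {X Y : Type*} [AddCommGroup X] [Module F X] [AddCommGroup Y] [Module F Y]
    (f : H →ₐ[F] H') (g : X →ₗ[F] Y) (t : H ⊗[F] (H ⊗[F] X)) :
    mulHead F H' Y (TensorProduct.map f.toLinearMap (TensorProduct.map f.toLinearMap g) t) =
      TensorProduct.map f.toLinearMap g (mulHead F H X t) := by
  induction t with
  | zero => simp
  | add a b ha hb => simp only [map_add, ha, hb]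
  | tmul a t =>
    induction t with
    | zero => simp
    | add a b ha hb => simp only [map_add, TensorProduct.tmul_add, ha, hb]
    | tmul b x => simp [mulHead_tmul]

/-- Braidings compatible with the products are determined by their values on generators. -/
theorem IsMulBraiding.comp_map_eq (hj : Algebra.adjoin F (Set.range j) = ⊤)
    (hc : IsMulBraiding c) (hτ : c ∘ₗ TensorProduct.map j j = TensorProduct.map j j ∘ₗ τ)
    (hc' : IsMulBraiding c') (f : H →ₐ[F] H')
    (h : ∀ v w, c' (f (j v) ⊗ₜ f (j w)) =
      TensorProduct.map f.toLinearMap f.toLinearMap (c (j v ⊗ₜ j w))) :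
    c' ∘ₗ TensorProduct.map f.toLinearMap f.toLinearMap =
      TensorProduct.map f.toLinearMap f.toLinearMap ∘ₗ c := by
  -- A generator is first crossed with an arbitrary `y` by the right product rule; the left product
  -- rule then builds up an arbitrary left factor.
  have step : ∀ y v, c' (f (j v) ⊗ₜ f y) =
      TensorProduct.map f.toLinearMap f.toLinearMap (c (j v ⊗ₜ y)) := by
    intro y
    refine generated_induction hj (P := fun y => ∀ v, c' (f (j v) ⊗ₜ f y) =
      TensorProduct.map f.toLinearMap f.toLinearMap (c (j v ⊗ₜ y))) ?_ ?_ ?_ ?_ ?_ y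
    · intro v; simp [hc.one_right, hc'.one_right]
    · intro w v; exact h v w
    · intro a b ha hb v; simp only [map_add, TensorProduct.tmul_add, ha, hb]
    · intro r a ha v; simp only [map_smul, TensorProduct.tmul_smul, ha]
    · intro y y' hy hy' v
      have e := hc.mul_right (j v ⊗ₜ (y ⊗ₜ y'))
      have e' := hc'.mul_right (f (j v) ⊗ₜ (f y ⊗ₜ f y'))
      rw [LinearMap.lTensor_tmul, LinearMap.mul'_apply] at e e'
      have key : c'.lTensor H' (braidHead c' H' (f (j v) ⊗ₜ (f y ⊗ₜ f y'))) =
          TensorProduct.map f.toLinearMap (TensorProduct.map f.toLinearMap f.toLinearMap)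
            (c.lTensor H (braidHead c H (j v ⊗ₜ (y ⊗ₜ y')))) := by
        rw [braidHead_tmul, hy, braidHead_tmul]
        obtain ⟨z, hz⟩ := hc.apply_gen_mem_range hj hτ v y
        rw [← hz]
        clear hz
        induction z with
        | zero => simp
        | add a b ha hb => simp only [map_add, TensorProduct.add_tmul, ha, hb]
        | tmul a w => simp [hy']
      rw [map_mul, e, e', key, mulHead_map]
  have step' : ∀ v t, braidHead c' H' (f (j v) ⊗ₜ
      TensorProduct.map f.toLinearMap f.toLinearMap t) =
      TensorProduct.map f.toLinearMap (TensorProduct.map f.toLinearMap f.toLinearMap)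
        (braidHead c H (j v ⊗ₜ t)) := by
    intro v t
    induction t with
    | zero => simp
    | add a b ha hb => simp only [map_add, TensorProduct.tmul_add, ha, hb]
    | tmul a b =>
      rw [TensorProduct.map_tmul, braidHead_tmul, braidHead_tmul, map_map_assoc,
        AlgHom.toLinearMap_apply, AlgHom.toLinearMap_apply, step]
  refine TensorProduct.ext' fun x y => ?_
  refine generated_induction_left hj (P := fun x => ∀ y, c' (f x ⊗ₜ f y) =
      TensorProduct.map f.toLinearMap f.toLinearMap (c (x ⊗ₜ y))) ?_ ?_ ?_ ?_ x y
  · intro y; simp [hc.one_left, hc'.one_left]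
  · intro v x hx y
    have e := hc.mul_left (j v ⊗ₜ (x ⊗ₜ y))
    have e' := hc'.mul_left (f (j v) ⊗ₜ (f x ⊗ₜ f y))
    rw [LinearMap.lTensor_tmul, mulHead_tmul] at e e'
    rw [map_mul, e, e', hx, step']
    exact lTensor_map_shift f.toLinearMap (mul'_map f) _
  · intro a b ha hb y; simp only [TensorProduct.add_tmul, map_add, ha, hb]
  · intro r a ha y; simp only [← TensorProduct.smul_tmul', map_smul, ha]

/-- Braidings induced by inverse braidings of the generating space are inverse to each other. -/
theorem IsMulBraiding.comp_eq_id (hj : Algebra.adjoin F (Set.range j) = ⊤)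
    (hc : IsMulBraiding c) (hτ : c ∘ₗ TensorProduct.map j j = TensorProduct.map j j ∘ₗ τ)
    (hd : IsMulBraiding d) (h : ∀ v w, d (c (j v ⊗ₜ j w)) = j v ⊗ₜ j w) :
    d ∘ₗ c = LinearMap.id := by
  have step : ∀ y v, d (c (j v ⊗ₜ y)) = j v ⊗ₜ y := by
    intro y
    refine generated_induction hj (P := fun y => ∀ v, d (c (j v ⊗ₜ y)) = j v ⊗ₜ y)
      ?_ ?_ ?_ ?_ ?_ y
    · intro v; rw [hc.one_right, hd.one_left]
    · intro w v; exact h v w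
    · intro a b ha hb v; simp only [map_add, TensorProduct.tmul_add, ha, hb]
    · intro r a ha v; simp only [map_smul, TensorProduct.tmul_smul, ha]
    · intro y y' hy hy' v
      have e := hc.mul_right (j v ⊗ₜ (y ⊗ₜ y'))
      rw [LinearMap.lTensor_tmul, LinearMap.mul'_apply] at e
      have key : d.lTensor H (c.lTensor H (braidHead c H (j v ⊗ₜ (y ⊗ₜ y')))) =
          braidHead c H (j v ⊗ₜ (y ⊗ₜ y')) := by
        rw [braidHead_tmul]
        obtain ⟨z, hz⟩ := hc.apply_gen_mem_range hj hτ v y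
        rw [← hz]
        clear hz
        induction z with
        | zero => simp
        | add a b ha hb => simp only [map_add, TensorProduct.add_tmul, ha, hb]
        | tmul a w => simp [hy']
      -- `c` takes `v` past `y` and then past `y'`; the left product rule of `d` undoes these
      -- crossings in reverse order.
      rw [e, hd.mul_left, key, braidHead_tmul, braidHead_assoc, hy]
      simp
  have step' : ∀ v t, braidHead d H (braidHead c H (j v ⊗ₜ t)) = j v ⊗ₜ t := by
    intro v t
    induction t with
    | zero => simp
    | add a b ha hb => simp only [map_add, TensorProduct.tmul_add, ha, hb]
    | tmul a b => rw [braidHead_tmul, braidHead_assoc, step, TensorProduct.assoc_tmul]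
  refine TensorProduct.ext' fun x y => ?_
  refine generated_induction_left hj (P := fun x => ∀ y, d (c (x ⊗ₜ y)) = x ⊗ₜ y)
    ?_ ?_ ?_ ?_ x y
  · intro y; rw [hc.one_left, hd.one_right]
  · intro v x hx y
    have e := hc.mul_left (j v ⊗ₜ (x ⊗ₜ y))
    rw [LinearMap.lTensor_tmul, mulHead_tmul] at e
    rw [e, hd.mul_right, step', LinearMap.lTensor_tmul, hx, mulHead_tmul]
  · intro a b ha hb y; simp only [TensorProduct.add_tmul, map_add, ha, hb]
  · intro r a ha y; simp only [← TensorProduct.smul_tmul', map_smul, ha]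

/-- The braiding of `T(V)` induced by the inverse of `τ` is the inverse of that induced by `τ`. -/
theorem tensorBraiding_comp_eq_id {τ σ : V ⊗[F] V →ₗ[F] V ⊗[F] V} (h : σ ∘ₗ τ = LinearMap.id) :
    tensorBraiding σ ∘ₗ tensorBraiding τ = LinearMap.id := by
  have e : ∀ ρ : V ⊗[F] V →ₗ[F] V ⊗[F] V, tensorBraiding ρ ∘ₗ
      TensorProduct.map (TensorAlgebra.ι F) (TensorAlgebra.ι F) =
      TensorProduct.map (TensorAlgebra.ι F) (TensorAlgebra.ι F) ∘ₗ ρ :=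
    fun ρ => TensorProduct.ext' fun v w => tensorBraiding_ι_ι ρ v w
  refine (tensorBraiding_isMulBraiding τ).comp_eq_id adjoin_range_ι (e τ)
    (tensorBraiding_isMulBraiding σ) fun v w => ?_
  have hvw : σ (τ (v ⊗ₜ w)) = v ⊗ₜ w := LinearMap.congr_fun h (v ⊗ₜ w)
  have := LinearMap.congr_fun (e σ) (τ (v ⊗ₜ w))
  rw [LinearMap.comp_apply, LinearMap.comp_apply, hvw] at this
  rw [tensorBraiding_ι_ι, this, TensorProduct.map_tmul]

theorem tensorBraiding_bijective {τ : V ⊗[F] V →ₗ[F] V ⊗[F] V} (h : Function.Bijective τ) :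
    Function.Bijective (tensorBraiding τ) := by
  let e := LinearEquiv.ofBijective τ h
  have h₁ := tensorBraiding_comp_eq_id (τ := τ) (σ := e.symm.toLinearMap)
    (LinearMap.ext fun x => e.symm_apply_apply x)
  have h₂ := tensorBraiding_comp_eq_id (τ := e.symm.toLinearMap) (σ := τ)
    (LinearMap.ext fun x => e.apply_symm_apply x)
  exact Function.bijective_iff_has_inverse.2 ⟨tensorBraiding e.symm.toLinearMap,
    LinearMap.congr_fun h₁, LinearMap.congr_fun h₂⟩

/-- The axioms of a braided Hopf algebra hold for the tensor algebra of a braided vector space. -/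
theorem tensorData_isBraidedHopfAlgebra {τ : V ⊗[F] V →ₗ[F] V ⊗[F] V} (h : IsBraiding τ) :
    (tensorData τ).IsBraidedHopfAlgebra :=
  (tensorData_isPrimitivelyGenerated τ h.yangBaxter).isBraidedHopfAlgebra
    (tensorBraiding_bijective h.bijective)

/-- An algebra map that commutes with coproducts and counits commutes with antipodes. -/
theorem BraidedHopfData.IsBraidedHopfAlgebra.antipode_comp_algHom {D : BraidedHopfData F H}
    {D' : BraidedHopfData F H'} (hD : D.IsBraidedHopfAlgebra) (hD' : D'.IsBraidedHopfAlgebra)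
    (f : H →ₐ[F] H')
    (hcomul : D'.comul ∘ₗ f.toLinearMap =
      TensorProduct.map f.toLinearMap f.toLinearMap ∘ₗ D.comul)
    (hcounit : D'.counit ∘ₗ f.toLinearMap = D.counit) :
    D'.antipode ∘ₗ f.toLinearMap = f.toLinearMap ∘ₗ D.antipode := by
  -- An ordinary coalgebra structure is enough for the convolution product on `Hom(H, H')`. There
  -- `S' f` is a left inverse and `f S` a right inverse of `f`, so they agree.
  let : Coalgebra F H :=
    { comul := D.comul
      counit := D.counit
      coassoc := hD.coassoc
      rTensor_counit_comp_comul := LinearMap.ext fun x => (TensorProduct.lid F H).injective <| by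
        simpa using LinearMap.congr_fun hD.counit_left x
      lTensor_counit_comp_comul := LinearMap.ext fun x => (TensorProduct.rid F H).injective <| by
        simpa using LinearMap.congr_fun hD.counit_right x }
  have hl : WithConv.toConv (D'.antipode ∘ₗ f.toLinearMap) * WithConv.toConv f.toLinearMap = 1 := by
    refine WithConv.ext (LinearMap.ext fun x => ?_)
    have h₁ : TensorProduct.map (D'.antipode ∘ₗ f.toLinearMap) f.toLinearMap =
        D'.antipode.rTensor H' ∘ₗ TensorProduct.map f.toLinearMap f.toLinearMap := by
      ext; simp
    have h₂ := LinearMap.congr_fun hD'.antipode_left (f x)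
    have h₃ := LinearMap.congr_fun hcomul x
    have h₄ := LinearMap.congr_fun hcounit x
    simp only [LinearMap.comp_apply, AlgHom.toLinearMap_apply] at h₂ h₃ h₄
    rw [h₃, h₄] at h₂
    change LinearMap.mul' F H' (TensorProduct.map _ _ (D.comul x)) = _
    rw [h₁]
    exact h₂
  have hr : WithConv.toConv f.toLinearMap * WithConv.toConv (f.toLinearMap ∘ₗ D.antipode) = 1 := by
    refine WithConv.ext (LinearMap.ext fun x => ?_)
    have h₁ : TensorProduct.map f.toLinearMap (f.toLinearMap ∘ₗ D.antipode) =
        TensorProduct.map f.toLinearMap f.toLinearMap ∘ₗ D.antipode.lTensor H := by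
      ext; simp
    have h₂ := congrArg f (LinearMap.congr_fun hD.antipode_right x)
    simp only [LinearMap.comp_apply, Algebra.linearMap_apply, AlgHom.commutes] at h₂
    change LinearMap.mul' F H' (TensorProduct.map _ _ (D.comul x)) = _
    rw [h₁, LinearMap.comp_apply, mul'_map]
    exact h₂
  exact WithConv.toConv_injective (left_inv_eq_right_inv hl hr)

/-! Any structure induced by `τ` is the image of that of the tensor algebra. -/

section Induced

variable {D : BraidedHopfData F H}

/-- For a primitive `v` the counit axiom reads `ε(v) 1 + v = v`. -/
theorem BraidedHopfData.IsInducedBy.counit_gen (hD : D.IsInducedBy j τ) (v : V) :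
    D.counit (j v) = 0 := by
  have h := LinearMap.congr_fun hD.isBraidedHopfAlgebra.counit_left (j v)
  have hv : D.comul (j v) = j v ⊗ₜ[F] 1 + 1 ⊗ₜ[F] j v := hD.isPrimitive v
  simp only [LinearMap.comp_apply, hv, map_add, LinearMap.rTensor_tmul, LinearEquiv.coe_coe,
    TensorProduct.lid_tmul, hD.isBraidedHopfAlgebra.counit_one, one_smul, LinearMap.id_apply,
    add_eq_right] at h
  simpa [hD.isBraidedHopfAlgebra.counit_one] using congrArg D.counit h

/-- Multiplicativity of `Δ` with `Δ v = v ⊗ 1 + 1 ⊗ v` unwinds to the recursion that defines the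
coproduct of `T(V)`; this forces uniqueness. -/
theorem BraidedHopfData.IsInducedBy.comul_gen_mul (hD : D.IsInducedBy j τ) (v : V) (x : H) :
    D.comul (j v * x) = mulHead F H H (j v ⊗ₜ D.comul x) +
      (LinearMap.mul' F H).lTensor H (braidHead D.braiding H (j v ⊗ₜ D.comul x)) := by
  have h := LinearMap.congr_fun hD.isBraidedHopfAlgebra.comul_mul (j v ⊗ₜ x)
  have hv : D.comul (j v) = j v ⊗ₜ[F] 1 + 1 ⊗ₜ[F] j v := hD.isPrimitive v
  rw [LinearMap.comp_apply, LinearMap.mul'_apply, LinearMap.comp_apply, TensorProduct.map_tmul,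
    hv] at h
  rw [h]
  induction D.comul x with
  | zero => simp
  | add a b ha hb => simp only [map_add, TensorProduct.tmul_add, ha, hb]; abel
  | tmul a b =>
    simp only [TensorProduct.add_tmul, map_add]
    congr 1
    · simp [braidedMul, mulHead_tmul, hD.isBraidedHopfAlgebra.braiding_one_left]
    · simp only [braidedMul, LinearMap.comp_apply, LinearEquiv.coe_coe,
        TensorProduct.tensorTensorTensorAssoc_tmul, LinearMap.rTensor_tmul,
        LinearMap.lTensor_tmul, braidHead_tmul]
      induction D.braiding (j v ⊗ₜ a) with
      | zero => simp
      | add a b ha hb => simp only [map_add, TensorProduct.tmul_add, TensorProduct.add_tmul, ha, hb]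
      | tmul c d => simp

/-- The algebra map `T(V) → H` commutes with all structure maps. -/
theorem BraidedHopfData.IsInducedBy.lift_isHom (hτ : IsBraiding τ) (hD : D.IsInducedBy j τ) :
    (tensorData τ).IsHom D (TensorAlgebra.lift F j) := by
  have hT := tensorData_isPrimitivelyGenerated τ hτ.yangBaxter
  have hT' := tensorData_isBraidedHopfAlgebra hτ
  have hH := hD.isBraidedHopfAlgebra
  set f := TensorAlgebra.lift F j with hf
  have hfι : ∀ v, f (TensorAlgebra.ι F v) = j v := TensorAlgebra.lift_ι_apply j
  have hfj : f.toLinearMap ∘ₗ TensorAlgebra.ι F = j := LinearMap.ext hfι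
  have braiding : D.braiding ∘ₗ TensorProduct.map f.toLinearMap f.toLinearMap =
      TensorProduct.map f.toLinearMap f.toLinearMap ∘ₗ (tensorData τ).braiding := by
    refine hT.isMulBraiding.comp_map_eq hT.adjoin_range hT.braiding hH.isMulBraiding f
      fun v w => ?_
    have h₁ := LinearMap.congr_fun hD.braiding (v ⊗ₜ w)
    rw [LinearMap.comp_apply, LinearMap.comp_apply, TensorProduct.map_tmul] at h₁
    rw [hfι, hfι, h₁]
    have h₂ := tensorBraiding_ι_ι τ v w
    change _ = TensorProduct.map _ _ (tensorBraiding τ _)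
    rw [h₂]
    have h₃ : TensorProduct.map f.toLinearMap f.toLinearMap ∘ₗ
        TensorProduct.map (TensorAlgebra.ι F) (TensorAlgebra.ι F) = TensorProduct.map j j := by
      rw [← TensorProduct.map_comp, hfj]
    exact (LinearMap.congr_fun h₃ (τ (v ⊗ₜ w))).symm
  have comul : D.comul ∘ₗ f.toLinearMap =
      TensorProduct.map f.toLinearMap f.toLinearMap ∘ₗ (tensorData τ).comul := by
    refine LinearMap.ext fun x => ?_
    refine generated_induction_left hT.adjoin_range (P := fun x => D.comul (f x) =
      TensorProduct.map f.toLinearMap f.toLinearMap ((tensorData τ).comul x)) ?_ ?_ ?_ ?_ x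
    · rw [map_one, hT.comul_one, hH.comul_one]; simp
    · intro v x hx
      rw [map_mul, hfι, hD.comul_gen_mul, hx, hT.comul_gen_mul, map_add, ← mulHead_map,
        TensorProduct.map_tmul, AlgHom.toLinearMap_apply, hfι, ← hfι, ← AlgHom.toLinearMap_apply,
        ← TensorProduct.map_tmul, braidHead_map braiding,
        lTensor_map_shift f.toLinearMap (mul'_map f)]
    · intro a b ha hb; simp only [map_add, ha, hb]
    · intro r a ha; simp only [map_smul, ha]
  have counit : D.counit ∘ₗ f.toLinearMap = (tensorData τ).counit := by
    refine LinearMap.ext fun x => ?_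
    refine generated_induction_left hT.adjoin_range (P := fun x => D.counit (f x) =
      (tensorData τ).counit x) ?_ ?_ ?_ ?_ x
    · rw [map_one, hT.counit_one, hH.counit_one]
    · intro v x _
      rw [map_mul, hH.counit_mul, hT.counit_mul, hfι, hD.counit_gen, hT.counit_gen, zero_mul,
        zero_mul]
    · intro a b ha hb; simp only [map_add, ha, hb]
    · intro r a ha; simp only [map_smul, ha]
  exact ⟨braiding, comul, counit, hT'.antipode_comp_algHom hH f comul counit⟩

end Induced

end Uniqueness

/-! ### Images of braided Hopf algebras -/

section Image

variable {F V H H' : Type*} [Field F] [AddCommGroup V] [Module F V] [Ring H] [Algebra F H]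
  [Ring H'] [Algebra F H']

theorem map_algHom_surjective {f : H →ₐ[F] H'} (hf : Function.Surjective f) :
    Function.Surjective (TensorProduct.map f.toLinearMap f.toLinearMap) := by
  have hf' : Function.Surjective f.toLinearMap := hf
  exact TensorProduct.map_surjective hf' hf'

theorem ker_lTensor_algHom {f : H →ₐ[F] H'} (hf : Function.Surjective f) :
    LinearMap.ker (f.toLinearMap.lTensor H) = tensorRight F (RingHom.ker f) := by
  refine (lTensor_exact H (f := ((RingHom.ker f).restrictScalars F).subtype)
    (g := f.toLinearMap) (fun x => ?_) hf).linearMap_ker_eq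
  simp [RingHom.mem_ker]

theorem ker_rTensor_algHom {f : H →ₐ[F] H'} (hf : Function.Surjective f) :
    LinearMap.ker (f.toLinearMap.rTensor H) = tensorLeft F (RingHom.ker f) := by
  refine (rTensor_exact H (f := ((RingHom.ker f).restrictScalars F).subtype)
    (g := f.toLinearMap) (fun x => ?_) hf).linearMap_ker_eq
  simp [RingHom.mem_ker]

theorem ker_map_algHom {f : H →ₐ[F] H'} (hf : Function.Surjective f) :
    LinearMap.ker (TensorProduct.map f.toLinearMap f.toLinearMap) =
      tensorLeft F (RingHom.ker f) ⊔ tensorRight F (RingHom.ker f) := by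
  have hex : Function.Exact ((RingHom.ker f).restrictScalars F).subtype f.toLinearMap := by
    intro x
    simp [RingHom.mem_ker]
  rw [TensorProduct.map_ker hex hf hex hf, sup_comm]
  rfl

/-- `c` maps `J ⊗ H` into `H ⊗ J` if it does so on pure tensors. -/
theorem map_tensorLeft_le {J : Ideal H} {P : Type*} [AddCommGroup P] [Module F P]
    {c : H ⊗[F] H →ₗ[F] P} {N : Submodule F P} (h : ∀ x ∈ J, ∀ y, c (x ⊗ₜ y) ∈ N) :
    (tensorLeft F J).map c ≤ N := by
  rw [Submodule.map_le_iff_le_comap]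
  rintro _ ⟨z, rfl⟩
  rw [Submodule.mem_comap]
  induction z with
  | zero => simp
  | add a b ha hb => simp only [map_add]; exact N.add_mem ha hb
  | tmul x y => exact h x x.2 y

theorem map_tensorRight_le {J : Ideal H} {P : Type*} [AddCommGroup P] [Module F P]
    {c : H ⊗[F] H →ₗ[F] P} {N : Submodule F P} (h : ∀ x ∈ J, ∀ y, c (y ⊗ₜ x) ∈ N) :
    (tensorRight F J).map c ≤ N := by
  rw [Submodule.map_le_iff_le_comap]
  rintro _ ⟨z, rfl⟩
  rw [Submodule.mem_comap]
  induction z with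
  | zero => simp
  | add a b ha hb => simp only [map_add]; exact N.add_mem ha hb
  | tmul y x => exact h x x.2 y

/-- The image of a linear endomorphism of the tensor square. -/
theorem exists_map_descent {f : H →ₐ[F] H'} (hf : Function.Surjective f)
    {c : H ⊗[F] H →ₗ[F] H ⊗[F] H}
    (hl : (tensorLeft F (RingHom.ker f)).map c ≤ tensorRight F (RingHom.ker f))
    (hr : (tensorRight F (RingHom.ker f)).map c ≤ tensorLeft F (RingHom.ker f)) :
    ∃ c' : H' ⊗[F] H' →ₗ[F] H' ⊗[F] H', c' ∘ₗ TensorProduct.map f.toLinearMap f.toLinearMap =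
      TensorProduct.map f.toLinearMap f.toLinearMap ∘ₗ c := by
  have hle : LinearMap.ker (TensorProduct.map f.toLinearMap f.toLinearMap) ≤
      LinearMap.ker (TensorProduct.map f.toLinearMap f.toLinearMap ∘ₗ c) := by
    rw [LinearMap.ker_comp, ker_map_algHom hf, ← Submodule.map_le_iff_le_comap,
      Submodule.map_sup]
    exact sup_le (hl.trans le_sup_right) (hr.trans le_sup_left)
  exact ⟨descend _ (map_algHom_surjective hf) _ hle,
    LinearMap.ext fun t => descend_apply _ _ _ hle t⟩

theorem exists_descent {f : H →ₐ[F] H'} (hf : Function.Surjective f) {P : Type*} [AddCommGroup P]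
    [Module F P] {g : H →ₗ[F] P} (h : ∀ x ∈ RingHom.ker f, g x = 0) :
    ∃ g' : H' →ₗ[F] P, g' ∘ₗ f.toLinearMap = g := by
  have hle : LinearMap.ker f.toLinearMap ≤ LinearMap.ker g := fun x hx => h x hx
  have hf' : Function.Surjective f.toLinearMap := hf
  exact ⟨descend f.toLinearMap hf' g hle, LinearMap.ext fun t => descend_apply _ hf' _ hle t⟩

/-- The structure maps of `H` descend to the image of `H` under an algebra map whose kernel is a
Hopf ideal. -/
theorem IsHopfIdeal.exists_isHom {D : BraidedHopfData F H} {f : H →ₐ[F] H'}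
    (hf : Function.Surjective f) (hJ : IsHopfIdeal D (RingHom.ker f)) :
    ∃ D' : BraidedHopfData F H', D.IsHom D' f := by
  obtain ⟨c, hc⟩ := exists_map_descent hf hJ.map_braiding_left.le hJ.map_braiding_right.le
  obtain ⟨Δ, hΔ⟩ := exists_descent hf
    (g := TensorProduct.map f.toLinearMap f.toLinearMap ∘ₗ D.comul) fun x hx => by
      have := hJ.comul_mem x hx
      rwa [← ker_map_algHom hf] at this
  obtain ⟨ε, hε⟩ := exists_descent hf hJ.counit_eq_zero
  obtain ⟨S, hS⟩ := exists_descent hf (g := f.toLinearMap ∘ₗ D.antipode) fun x hx =>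
    hJ.antipode_mem x hx
  exact ⟨⟨c, Δ, ε, S⟩, hc, hΔ, hε, hS⟩

/-- A surjective map determines the structure maps of its target. -/
theorem BraidedHopfData.IsHom.eq_of_surjective {D : BraidedHopfData F H}
    {D₁ D₂ : BraidedHopfData F H'} {f : H →ₐ[F] H'} (hf : Function.Surjective f)
    (h₁ : D.IsHom D₁ f) (h₂ : D.IsHom D₂ f) : D₁ = D₂ := by
  have hff := map_algHom_surjective hf
  have hf' : Function.Surjective f.toLinearMap := hf
  refine BraidedHopfData.ext ?_ ?_ ?_ ?_
  · exact (LinearMap.cancel_right hff).1 (h₁.braiding.trans h₂.braiding.symm)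
  · exact (LinearMap.cancel_right hf').1 (h₁.comul.trans h₂.comul.symm)
  · exact (LinearMap.cancel_right hf').1 (h₁.counit.trans h₂.counit.symm)
  · exact (LinearMap.cancel_right hf').1 (h₁.antipode.trans h₂.antipode.symm)

theorem IsMulBraiding.of_surjective {c : H ⊗[F] H →ₗ[F] H ⊗[F] H}
    {c' : H' ⊗[F] H' →ₗ[F] H' ⊗[F] H'} {f : H →ₐ[F] H'} (hf : Function.Surjective f)
    (hc : IsMulBraiding c) (h : c' ∘ₗ TensorProduct.map f.toLinearMap f.toLinearMap =
      TensorProduct.map f.toLinearMap f.toLinearMap ∘ₗ c) : IsMulBraiding c' := by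
  have h' : ∀ x y, c' (f x ⊗ₜ f y) =
      TensorProduct.map f.toLinearMap f.toLinearMap (c (x ⊗ₜ y)) :=
    fun x y => LinearMap.congr_fun h (x ⊗ₜ y)
  have hl : ∀ t, c'.lTensor H' (TensorProduct.map f.toLinearMap
      (TensorProduct.map f.toLinearMap f.toLinearMap) t) = TensorProduct.map f.toLinearMap
      (TensorProduct.map f.toLinearMap f.toLinearMap) (c.lTensor H t) :=
    lTensor_map_shift f.toLinearMap (LinearMap.congr_fun h)
  have hf' : Function.Surjective f.toLinearMap := hf
  have hfff := TensorProduct.map_surjective hf' (map_algHom_surjective hf)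
  constructor
  · intro x
    obtain ⟨x, rfl⟩ := hf x
    rw [← map_one f, h', hc.one_left]; simp
  · intro x
    obtain ⟨x, rfl⟩ := hf x
    rw [← map_one f, h', hc.one_right]; simp
  · intro t
    obtain ⟨t, rfl⟩ := hfff t
    rw [mulHead_map, hl, braidHead_map h, lTensor_map_shift f.toLinearMap (mul'_map f),
      ← hc.mul_left]
    exact LinearMap.congr_fun h _
  · intro t
    obtain ⟨t, rfl⟩ := hfff t
    rw [braidHead_map h, hl, mulHead_map, lTensor_map_shift f.toLinearMap (mul'_map f),
      ← hc.mul_right]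
    exact LinearMap.congr_fun h _

/-- Apart from generation, which passes to images, and the hypothesis on τ, the clauses are
equations between structure maps, so they survive in a quotient. The Hopf axioms of a quotient then
need no separate check. -/
theorem BraidedHopfData.IsHom.isPrimitivelyGenerated {D : BraidedHopfData F H}
    {D' : BraidedHopfData F H'} {f : H →ₐ[F] H'} (hf : Function.Surjective f) (h : D.IsHom D' f)
    {j : V →ₗ[F] H} {τ : V ⊗[F] V →ₗ[F] V ⊗[F] V} (hD : IsPrimitivelyGenerated D j τ) :
    IsPrimitivelyGenerated D' (f.toLinearMap ∘ₗ j) τ := by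
  have hbr : ∀ t, D'.braiding (TensorProduct.map f.toLinearMap f.toLinearMap t) =
      TensorProduct.map f.toLinearMap f.toLinearMap (D.braiding t) := LinearMap.congr_fun h.braiding
  have hco : ∀ x, D'.comul (f x) = TensorProduct.map f.toLinearMap f.toLinearMap (D.comul x) :=
    LinearMap.congr_fun h.comul
  have hcu : ∀ x, D'.counit (f x) = D.counit x := LinearMap.congr_fun h.counit
  have hS : ∀ x, D'.antipode (f x) = f (D.antipode x) := LinearMap.congr_fun h.antipode
  constructor
  · rw [LinearMap.coe_comp, Set.range_comp]
    change Algebra.adjoin F (f '' _) = ⊤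
    rw [← AlgHom.map_adjoin, hD.adjoin_range, Algebra.map_top, AlgHom.range_eq_top]
    exact hf
  · exact hD.yangBaxter
  · exact hD.isMulBraiding.of_surjective hf h.braiding
  · rw [TensorProduct.map_comp, ← LinearMap.comp_assoc, h.braiding, LinearMap.comp_assoc,
      hD.braiding, LinearMap.comp_assoc]
  · rw [← map_one f, hco, hD.comul_one]; simp
  · intro v x
    obtain ⟨x, rfl⟩ := hf x
    have e : f (j v) ⊗ₜ TensorProduct.map f.toLinearMap f.toLinearMap (D.comul x) =
        TensorProduct.map f.toLinearMap (TensorProduct.map f.toLinearMap f.toLinearMap)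
          (j v ⊗ₜ D.comul x) := rfl
    rw [LinearMap.comp_apply, AlgHom.toLinearMap_apply, ← map_mul, hco, hco, hD.comul_gen_mul,
      map_add, ← mulHead_map, e, braidHead_map h.braiding,
      lTensor_map_shift f.toLinearMap (mul'_map f)]
  · rw [← map_one f, hcu, hD.counit_one]
  · intro x y
    obtain ⟨x, rfl⟩ := hf x
    obtain ⟨y, rfl⟩ := hf y
    rw [← map_mul, hcu, hcu, hcu, hD.counit_mul]
  · intro v; exact (hcu _).trans (hD.counit_gen v)
  · rw [← map_one f, hS, hD.antipode_one]
  · intro v x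
    obtain ⟨x, rfl⟩ := hf x
    have e : f (j v) ⊗ₜ[F] f (D.antipode x) =
        TensorProduct.map f.toLinearMap f.toLinearMap (j v ⊗ₜ D.antipode x) := rfl
    rw [LinearMap.comp_apply, AlgHom.toLinearMap_apply, ← map_mul, hS, hS, hD.antipode_gen_mul,
      e, hbr, mul'_map, map_neg, AlgHom.toLinearMap_apply]

/-- Injectivity uses that the braiding maps `J ⊗ H + H ⊗ J` onto itself; this is where equality,
rather than inclusion, in the definition of a Hopf ideal matters. -/
theorem IsHopfIdeal.braiding_bijective {D : BraidedHopfData F H} {D' : BraidedHopfData F H'}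
    {f : H →ₐ[F] H'} (hf : Function.Surjective f) (hJ : IsHopfIdeal D (RingHom.ker f))
    (h : D.IsHom D' f) (hD : Function.Bijective D.braiding) :
    Function.Bijective D'.braiding := by
  have hff := map_algHom_surjective hf
  have hbr : ∀ t, D'.braiding (TensorProduct.map f.toLinearMap f.toLinearMap t) =
      TensorProduct.map f.toLinearMap f.toLinearMap (D.braiding t) := LinearMap.congr_fun h.braiding
  constructor
  · rw [injective_iff_map_eq_zero]
    intro z hz
    obtain ⟨s, rfl⟩ := hff z
    have hsup : (tensorLeft F (RingHom.ker f) ⊔ tensorRight F (RingHom.ker f)).map D.braiding =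
        tensorLeft F (RingHom.ker f) ⊔ tensorRight F (RingHom.ker f) := by
      rw [Submodule.map_sup, hJ.map_braiding_left, hJ.map_braiding_right, sup_comm]
    rw [hbr, ← LinearMap.mem_ker, ker_map_algHom hf, ← hsup, ← ker_map_algHom hf] at hz
    obtain ⟨s', hs', e⟩ := hz
    rw [hD.1 e] at hs'
    exact hs'
  · intro z
    obtain ⟨s, rfl⟩ := hff z
    obtain ⟨s, rfl⟩ := hD.2 s
    exact ⟨_, hbr s⟩

theorem braidedMul_map {D : BraidedHopfData F H} {D' : BraidedHopfData F H'} {f : H →ₐ[F] H'}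
    (h : D'.braiding ∘ₗ TensorProduct.map f.toLinearMap f.toLinearMap =
      TensorProduct.map f.toLinearMap f.toLinearMap ∘ₗ D.braiding) (s t : H ⊗[F] H) :
    D'.braidedMul (TensorProduct.map f.toLinearMap f.toLinearMap s ⊗ₜ
      TensorProduct.map f.toLinearMap f.toLinearMap t) =
      TensorProduct.map f.toLinearMap f.toLinearMap (D.braidedMul (s ⊗ₜ t)) := by
  have h' : ∀ x y, D'.braiding (f x ⊗ₜ f y) =
      TensorProduct.map f.toLinearMap f.toLinearMap (D.braiding (x ⊗ₜ y)) :=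
    fun x y => LinearMap.congr_fun h (x ⊗ₜ y)
  induction s with
  | zero => simp
  | add a b ha hb => simp only [map_add, TensorProduct.add_tmul, ha, hb]
  | tmul a b =>
    induction t with
    | zero => simp
    | add a b ha hb => simp only [map_add, TensorProduct.tmul_add, ha, hb]
    | tmul e g =>
      simp only [BraidedHopfData.braidedMul, LinearMap.comp_apply, LinearEquiv.coe_coe,
        TensorProduct.tensorTensorTensorAssoc_tmul, LinearMap.rTensor_tmul,
        LinearMap.lTensor_tmul, TensorProduct.map_tmul, AlgHom.toLinearMap_apply, h']
      induction D.braiding (b ⊗ₜ e) with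
      | zero => simp
      | add a b ha hb => simp only [map_add, TensorProduct.tmul_add, TensorProduct.add_tmul, ha, hb]
      | tmul c d => simp

end Image

/-! ### Quadratic quotients of the tensor algebra -/

section Quadratic

open TensorAlgebra (ι)

variable {F V A : Type*} [Field F] [AddCommGroup V] [Module F V] [Ring A] [Algebra F A]

/-- The product `V ⊗ V → T(V)`. -/
def quadraticPart (F V : Type*) [Field F] [AddCommGroup V] [Module F V] :
    V ⊗[F] V →ₗ[F] TensorAlgebra F V :=
  LinearMap.mul' F (TensorAlgebra F V) ∘ₗ TensorProduct.map (ι F) (ι F)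

/-- The kernel of `π : T(V) → A` is the ideal generated by `ker (1 + τ) ⊆ V ⊗ V`, and does not
contain further elements of `V ⊗ V`. -/
structure IsQuadraticCover (τ : V ⊗[F] V →ₗ[F] V ⊗[F] V) (π : TensorAlgebra F V →ₐ[F] A) :
    Prop where
  surjective : Function.Surjective π
  -- A factorisation through `1 + τ` implies vanishing on its kernel and carries over directly to
  -- tensor products with `T(V)`.
  exists_factor : ∃ g : V ⊗[F] V →ₗ[F] A, ∀ r, π (quadraticPart F V r) = g (r + τ r)
  ker_induction : ∀ {P : TensorAlgebra F V → Prop}, P 0 → (∀ x y, P x → P y → P (x + y)) →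
    (∀ a x, P x → P (a * x)) → (∀ x a, P x → P (x * a)) →
    (∀ r, τ r = -r → P (quadraticPart F V r)) → ∀ x, π x = 0 → P x

namespace IsQuadraticCover

variable {τ : V ⊗[F] V →ₗ[F] V ⊗[F] V} {π : TensorAlgebra F V →ₐ[F] A}

local notation "T" => TensorAlgebra F V
local notation "c" => tensorBraiding τ

/-- Since `1 + τ = τ (1 + τ⁻¹)`, the inverse braiding has the same relations. This later turns
inclusions between images of the braiding into equalities. -/
theorem inverse (h : IsQuadraticCover τ π) {σ : V ⊗[F] V →ₗ[F] V ⊗[F] V}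
    (hστ : σ ∘ₗ τ = LinearMap.id) (hτσ : τ ∘ₗ σ = LinearMap.id) : IsQuadraticCover σ π where
  surjective := h.surjective
  exists_factor := by
    obtain ⟨g, hg⟩ := h.exists_factor
    refine ⟨g ∘ₗ τ, fun r => ?_⟩
    have : τ (σ r) = r := LinearMap.congr_fun hτσ r
    rw [hg, LinearMap.comp_apply, map_add τ, this, add_comm]
  ker_induction zero add mull mulr rel := by
    refine h.ker_induction zero add mull mulr fun r hr => rel r ?_
    have h₁ : σ (τ r) = r := LinearMap.congr_fun hστ r
    rw [hr, map_neg] at h₁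
    rw [← h₁, neg_neg, h₁]

theorem apply_eq_zero (h : IsQuadraticCover τ π) {r : V ⊗[F] V} (hr : τ r = -r) :
    π (quadraticPart F V r) = 0 := by
  obtain ⟨g, hg⟩ := h.exists_factor
  rw [hg, hr, add_neg_cancel, map_zero]

theorem map_ι_injective {X : Type*} [AddCommGroup X] [Module F X] : Function.Injective
    ((TensorProduct.map (ι F) (ι F) : V ⊗[F] V →ₗ[F] T ⊗[F] T).lTensor X) := by
  refine Module.Flat.lTensor_preserves_injective_linearMap _ ?_
  have hι : Function.Injective (ι F : V →ₗ[F] T) := TensorAlgebra.ι_leftInverse.injective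
  rw [← LinearMap.lTensor_comp_rTensor, LinearMap.coe_comp]
  exact (Module.Flat.lTensor_preserves_injective_linearMap _ hι).comp
    (Module.Flat.rTensor_preserves_injective_linearMap _ hι)

theorem map_ι_injective' {X : Type*} [AddCommGroup X] [Module F X] : Function.Injective
    ((TensorProduct.map (ι F) (ι F) : V ⊗[F] V →ₗ[F] T ⊗[F] T).rTensor X) := by
  refine Module.Flat.rTensor_preserves_injective_linearMap _ ?_
  have hι : Function.Injective (ι F : V →ₗ[F] T) := TensorAlgebra.ι_leftInverse.injective
  rw [← LinearMap.lTensor_comp_rTensor, LinearMap.coe_comp]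
  exact (Module.Flat.lTensor_preserves_injective_linearMap _ hι).comp
    (Module.Flat.rTensor_preserves_injective_linearMap _ hι)

theorem tensorBraiding_map_ι (r : V ⊗[F] V) :
    c (TensorProduct.map (ι F) (ι F) r) = TensorProduct.map (ι F) (ι F) (τ r) := by
  have : c ∘ₗ TensorProduct.map (ι F) (ι F) = TensorProduct.map (ι F) (ι F) ∘ₗ τ :=
    TensorProduct.ext' fun v w => tensorBraiding_ι_ι τ v w
  exact LinearMap.congr_fun this r

theorem yangBaxter_tensorBraiding (hτ : IsBraiding τ) (t : T ⊗[F] (T ⊗[F] T)) :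
    braidHead c T (LinearMap.lTensor T c (braidHead c T t)) =
      LinearMap.lTensor T c (braidHead c T (LinearMap.lTensor T c t)) :=
  (yangBaxter_iff _).1 (tensorData_isBraidedHopfAlgebra hτ).isBraiding.yangBaxter t

/-- By the Yang–Baxter equation, applying τ to the two factors of `r` commutes with moving both of
them across `y`. So relations emerge on the far side, and π kills them. -/
theorem relation_tmul (h : IsQuadraticCover τ π) (hτ : IsBraiding τ) {r : V ⊗[F] V}
    (hr : τ r = -r) (y : T) :
    π.toLinearMap.lTensor T (c (quadraticPart F V r ⊗ₜ y)) = 0 := by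
  have hc := tensorBraiding_isMulBraiding τ
  have hgen : c ∘ₗ TensorProduct.map (ι F) (ι F) = TensorProduct.map (ι F) (ι F) ∘ₗ τ :=
    LinearMap.ext tensorBraiding_map_ι
  have range : ∀ s : V ⊗[F] V, braidHead c T (LinearMap.lTensor T c
      (TensorProduct.assoc F T T T (TensorProduct.map (ι F) (ι F) s ⊗ₜ y))) ∈
      LinearMap.range ((TensorProduct.map (ι F) (ι F) : V ⊗[F] V →ₗ[F] T ⊗[F] T).lTensor T) := by
    intro s
    induction s with
    | zero => simp
    | add a b ha hb => simp only [map_add, TensorProduct.add_tmul]; exact add_mem ha hb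
    | tmul v w =>
      rw [TensorProduct.map_tmul, TensorProduct.assoc_tmul, LinearMap.lTensor_tmul]
      obtain ⟨z, hz⟩ := hc.apply_gen_mem_range adjoin_range_ι hgen w y
      rw [← hz]
      clear hz
      induction z with
      | zero => simp
      | add a b ha hb => simp only [map_add, TensorProduct.tmul_add]; exact add_mem ha hb
      | tmul a w =>
        obtain ⟨z, hz⟩ := hc.apply_gen_mem_range adjoin_range_ι hgen v a
        rw [LinearMap.lTensor_tmul, braidHead_tmul, ← hz]
        clear hz
        induction z with
        | zero => simp
        | add a b ha hb => simp only [map_add, TensorProduct.add_tmul]; exact add_mem ha hb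
        | tmul a v => exact ⟨a ⊗ₜ (v ⊗ₜ w), by simp⟩
  obtain ⟨g, hg⟩ := h.exists_factor
  obtain ⟨z, hz⟩ := range r
  -- `z` is the result of the two crossings, seen in `T(V) ⊗ (V ⊗ V)`; it inherits the eigenvalue
  -- `-1` from `r`.
  have hneg : LinearMap.lTensor T τ z = -z := by
    refine map_ι_injective ?_
    rw [← lTensor_shift₂₂ T (tensorBraiding_map_ι (F := F) (τ := τ)), hz, ← yangBaxter_tensorBraiding hτ,
      braidHead_assoc, tensorBraiding_map_ι, hr]
    rw [map_neg, TensorProduct.neg_tmul, map_neg (TensorProduct.assoc F T T T), map_neg, map_neg,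
      map_neg, hz]
  have e : quadraticPart F V r ⊗ₜ y = mulHead F T T
      (TensorProduct.assoc F T T T (TensorProduct.map (ι F) (ι F) r ⊗ₜ y)) := by
    rw [mulHead_assoc]; rfl
  have hg' : π.toLinearMap ∘ₗ quadraticPart F V = g ∘ₗ (LinearMap.id + τ) := LinearMap.ext hg
  rw [e, hc.mul_left, ← hz, ← LinearMap.comp_apply, ← LinearMap.comp_apply,
    ← LinearMap.lTensor_comp, ← LinearMap.lTensor_comp]
  change (LinearMap.lTensor T (π.toLinearMap ∘ₗ quadraticPart F V)) z = 0
  rw [hg', LinearMap.lTensor_comp, LinearMap.lTensor_add, LinearMap.comp_apply,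
    LinearMap.add_apply, LinearMap.lTensor_id, LinearMap.id_apply, hneg, add_neg_cancel, map_zero]

theorem tmul_relation (h : IsQuadraticCover τ π) (hτ : IsBraiding τ) {r : V ⊗[F] V}
    (hr : τ r = -r) (y : T) :
    π.toLinearMap.rTensor T (c (y ⊗ₜ quadraticPart F V r)) = 0 := by
  have hc := tensorBraiding_isMulBraiding τ
  have hgen : c ∘ₗ TensorProduct.map (ι F) (ι F) = TensorProduct.map (ι F) (ι F) ∘ₗ τ :=
    LinearMap.ext tensorBraiding_map_ι
  have range : ∀ s : V ⊗[F] V, ∃ z, LinearMap.lTensor T c (braidHead c T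
      (y ⊗ₜ TensorProduct.map (ι F) (ι F) s)) = TensorProduct.assoc F T T T
      ((TensorProduct.map (ι F) (ι F) : V ⊗[F] V →ₗ[F] T ⊗[F] T).rTensor T z) := by
    intro s
    induction s with
    | zero => exact ⟨0, by simp⟩
    | add a b ha hb =>
      obtain ⟨z, hz⟩ := ha
      obtain ⟨z', hz'⟩ := hb
      exact ⟨z + z', by simp only [map_add, TensorProduct.tmul_add, hz, hz']⟩
    | tmul v w =>
      rw [TensorProduct.map_tmul, braidHead_tmul]
      obtain ⟨z, hz⟩ := hc.apply_tmul_gen_mem_range adjoin_range_ι hgen y v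
      rw [← hz]
      clear hz
      induction z with
      | zero => exact ⟨0, by simp⟩
      | add a b ha hb =>
        obtain ⟨z, hz⟩ := ha
        obtain ⟨z', hz'⟩ := hb
        exact ⟨z + z', by simp only [map_add, TensorProduct.add_tmul, hz, hz']⟩
      | tmul v a =>
        obtain ⟨z, hz⟩ := hc.apply_tmul_gen_mem_range adjoin_range_ι hgen a w
        rw [LinearMap.rTensor_tmul, TensorProduct.assoc_tmul, LinearMap.lTensor_tmul, ← hz]
        clear hz
        induction z with
        | zero => exact ⟨0, by simp⟩
        | add a b ha hb =>
          obtain ⟨z, hz⟩ := ha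
          obtain ⟨z', hz'⟩ := hb
          exact ⟨z + z', by simp only [map_add, TensorProduct.tmul_add, hz, hz']⟩
        | tmul w a => exact ⟨(v ⊗ₜ w) ⊗ₜ a, by simp⟩
  obtain ⟨g, hg⟩ := h.exists_factor
  obtain ⟨z, hz⟩ := range r
  -- As before, with the two vectors emerging on the left of `y`.
  have hneg : LinearMap.rTensor T τ z = -z := by
    refine map_ι_injective' ((TensorProduct.assoc F T T T).injective ?_)
    have e : LinearMap.rTensor T (TensorProduct.map (ι F) (ι F)) (LinearMap.rTensor T τ z) =
        LinearMap.rTensor T c (LinearMap.rTensor T (TensorProduct.map (ι F) (ι F)) z) := by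
      rw [← LinearMap.comp_apply, ← LinearMap.comp_apply, ← LinearMap.rTensor_comp,
        ← LinearMap.rTensor_comp, hgen]
    have e' := congrArg (braidHead c T) hz
    rw [yangBaxter_tensorBraiding hτ, LinearMap.lTensor_tmul, tensorBraiding_map_ι, hr] at e'
    simp only [map_neg, TensorProduct.tmul_neg, hz] at e'
    rw [e, map_neg, map_neg, e']
    simp [braidHead]
  have e : y ⊗ₜ quadraticPart F V r =
      (LinearMap.mul' F T).lTensor T (y ⊗ₜ[F] TensorProduct.map (ι F) (ι F) r) := rfl
  have hg' : π.toLinearMap ∘ₗ quadraticPart F V = g ∘ₗ (LinearMap.id + τ) := LinearMap.ext hg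
  rw [e, hc.mul_right, hz, mulHead, LinearMap.comp_apply, LinearEquiv.coe_coe,
    LinearEquiv.symm_apply_apply, ← LinearMap.comp_apply, ← LinearMap.comp_apply,
    ← LinearMap.rTensor_comp, ← LinearMap.rTensor_comp]
  change (LinearMap.rTensor T (π.toLinearMap ∘ₗ quadraticPart F V)) z = 0
  rw [hg', LinearMap.rTensor_comp, LinearMap.rTensor_add, LinearMap.comp_apply,
    LinearMap.add_apply, LinearMap.rTensor_id, LinearMap.id_apply, hneg, add_neg_cancel, map_zero]

theorem mulHead_lTensor_algHom (t : T ⊗[F] (T ⊗[F] T)) :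
    π.toLinearMap.lTensor T ((LinearMap.mul' F T).lTensor T t) =
      (LinearMap.mul' F A).lTensor T
        ((TensorProduct.map π.toLinearMap π.toLinearMap).lTensor T t) :=
  lTensor_shift₂₂ T (fun t => (mul'_map π t).symm) t

/-- By the left product rule, the `x` with this property for all `y` form a two-sided ideal; it
contains the quadratic relations and therefore `ker π`. -/
theorem ker_tmul (h : IsQuadraticCover τ π) (hτ : IsBraiding τ) {x : T} (hx : π x = 0) (y : T) :
    π.toLinearMap.lTensor T (c (x ⊗ₜ y)) = 0 := by
  have hc := tensorBraiding_isMulBraiding τ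
  have hmul : ∀ a b y, π.toLinearMap.lTensor T (c ((a * b) ⊗ₜ y)) =
      (LinearMap.mul' F A).lTensor T ((TensorProduct.map π.toLinearMap π.toLinearMap).lTensor T
        (braidHead c T (a ⊗ₜ c (b ⊗ₜ y)))) := by
    intro a b y
    rw [← mulHead_lTensor_algHom, ← LinearMap.lTensor_tmul, ← hc.mul_left, mulHead_tmul]
  refine h.ker_induction (P := fun x => ∀ y, π.toLinearMap.lTensor T (c (x ⊗ₜ y)) = 0)
    ?_ ?_ ?_ ?_ ?_ x hx y
  · simp
  · intro a b ha hb y; rw [TensorProduct.add_tmul, map_add, map_add, ha, hb, add_zero]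
  · intro a b hb y
    rw [hmul, ← LinearMap.rTensor_comp_lTensor, LinearMap.lTensor_comp, LinearMap.comp_apply,
      ← braidHead_natural, LinearMap.lTensor_tmul, hb]
    simp
  · intro a b ha y
    rw [hmul]
    induction c (b ⊗ₜ y) with
    | zero => simp
    | add s t hs ht => simp only [TensorProduct.tmul_add, map_add, hs, ht, add_zero]
    | tmul z w =>
      have e : ∀ t : T ⊗[F] T, (TensorProduct.map π.toLinearMap π.toLinearMap).lTensor T
          (TensorProduct.assoc F T T T (t ⊗ₜ w)) =
          TensorProduct.assoc F T A A (π.toLinearMap.lTensor T t ⊗ₜ π w) := by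
        intro t
        induction t with
        | zero => simp
        | add s t hs ht => simp only [TensorProduct.add_tmul, map_add, hs, ht]
        | tmul a b => simp
      rw [braidHead_tmul, e, ha]
      simp
  · intro r hr y; exact h.relation_tmul hτ hr y

theorem mulHead_rTensor_algHom (t : T ⊗[F] (T ⊗[F] T)) :
    π.toLinearMap.rTensor T (mulHead F T T t) =
      mulHead F A T (TensorProduct.map π.toLinearMap (π.toLinearMap.rTensor T) t) := by
  exact (mulHead_map π LinearMap.id t).symm

theorem tmul_ker (h : IsQuadraticCover τ π) (hτ : IsBraiding τ) {x : T} (hx : π x = 0) (y : T) :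
    π.toLinearMap.rTensor T (c (y ⊗ₜ x)) = 0 := by
  have hc := tensorBraiding_isMulBraiding τ
  have hmul : ∀ a b y, π.toLinearMap.rTensor T (c (y ⊗ₜ (a * b))) =
      mulHead F A T (TensorProduct.map π.toLinearMap (π.toLinearMap.rTensor T)
        (LinearMap.lTensor T c (TensorProduct.assoc F T T T (c (y ⊗ₜ a) ⊗ₜ b)))) := by
    intro a b y
    rw [← mulHead_rTensor_algHom, ← braidHead_tmul, ← hc.mul_right, LinearMap.lTensor_tmul,
      LinearMap.mul'_apply]
  refine h.ker_induction (P := fun x => ∀ y, π.toLinearMap.rTensor T (c (y ⊗ₜ x)) = 0)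
    ?_ ?_ ?_ ?_ ?_ x hx y
  · simp
  · intro a b ha hb y; rw [TensorProduct.tmul_add, map_add, map_add, ha, hb, add_zero]
  · intro a b hb y
    rw [hmul]
    induction c (y ⊗ₜ a) with
    | zero => simp
    | add s t hs ht => simp only [TensorProduct.add_tmul, map_add, hs, ht, add_zero]
    | tmul z w => simp [hb]
  · intro a b ha y
    have e : ∀ t : T ⊗[F] T, TensorProduct.map π.toLinearMap (π.toLinearMap.rTensor T)
        (LinearMap.lTensor T c (TensorProduct.assoc F T T T (t ⊗ₜ b))) =
        (π.toLinearMap.rTensor T ∘ₗ c).lTensor A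
          (TensorProduct.assoc F A T T (π.toLinearMap.rTensor T t ⊗ₜ b)) := by
      intro t
      induction t with
      | zero => simp
      | add s t hs ht => simp only [TensorProduct.add_tmul, map_add, hs, ht]
      | tmul a b => simp
    rw [hmul, e, ha]
    simp
  · intro r hr y; exact h.tmul_relation hτ hr y

theorem map_tensorBraiding_tensorLeft_le (h : IsQuadraticCover τ π) (hτ : IsBraiding τ) :
    (tensorLeft F (RingHom.ker π)).map c ≤ tensorRight F (RingHom.ker π) := by
  refine map_tensorLeft_le fun x hx y => ?_
  rw [← ker_lTensor_algHom h.surjective]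
  exact h.ker_tmul hτ hx y

theorem map_tensorBraiding_tensorRight_le (h : IsQuadraticCover τ π) (hτ : IsBraiding τ) :
    (tensorRight F (RingHom.ker π)).map c ≤ tensorLeft F (RingHom.ker π) := by
  refine map_tensorRight_le fun x hx y => ?_
  rw [← ker_rTensor_algHom h.surjective]
  exact h.tmul_ker hτ hx y

end IsQuadraticCover

end Quadratic

/-! ### Hopf structure on a quadratic quotient -/

section QuadraticHopf

open TensorAlgebra (ι)

variable {F V A : Type*} [Field F] [AddCommGroup V] [Module F V] [Ring A] [Algebra F A]

theorem IsBraiding.exists_inverse {τ : V ⊗[F] V →ₗ[F] V ⊗[F] V} (hτ : IsBraiding τ) :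
    ∃ σ : V ⊗[F] V →ₗ[F] V ⊗[F] V, IsBraiding σ ∧ σ ∘ₗ τ = LinearMap.id ∧
      τ ∘ₗ σ = LinearMap.id := by
  let e := LinearEquiv.ofBijective τ hτ.bijective
  have hl : ∀ x, e.symm (τ x) = x := e.symm_apply_apply
  have hr : ∀ x, τ (e.symm x) = x := e.apply_symm_apply
  have hl' : e.symm.toLinearMap ∘ₗ τ = LinearMap.id := LinearMap.ext hl
  have hr' : τ ∘ₗ e.symm.toLinearMap = LinearMap.id := LinearMap.ext hr
  refine ⟨e.symm.toLinearMap, ⟨e.symm.bijective, ?_⟩, hl', hr'⟩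
  have h₁ : ∀ t, onFirst e.symm.toLinearMap (onFirst τ t) = t := fun t => by
    rw [onFirst, onFirst, ← LinearMap.comp_apply, ← LinearMap.rTensor_comp, hl']; simp
  have h₁' : ∀ t, onFirst τ (onFirst e.symm.toLinearMap t) = t := fun t => by
    rw [onFirst, onFirst, ← LinearMap.comp_apply, ← LinearMap.rTensor_comp, hr']; simp
  have h₂ : ∀ t, onSecond e.symm.toLinearMap (onSecond τ t) = t := fun t => by
    obtain ⟨t, rfl⟩ := (TensorProduct.assoc F V V V).symm.surjective t
    rw [onSecond_assoc_symm, onSecond_assoc_symm, ← LinearMap.comp_apply,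
      ← LinearMap.lTensor_comp, hl']; simp
  have h₂' : ∀ t, onSecond τ (onSecond e.symm.toLinearMap t) = t := fun t => by
    obtain ⟨t, rfl⟩ := (TensorProduct.assoc F V V V).symm.surjective t
    rw [onSecond_assoc_symm, onSecond_assoc_symm, ← LinearMap.comp_apply,
      ← LinearMap.lTensor_comp, hr']; simp
  refine LinearMap.ext fun t => ?_
  simp only [LinearMap.comp_apply]
  -- At `σ₂ σ₁ σ₂ t`, with `σ` the inverse, the right side of the equation for τ collapses to `t`;
  -- applying `σ₁ σ₂ σ₁` then gives the equation for `σ`.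
  have := LinearMap.congr_fun hτ.yangBaxter (onSecond e.symm.toLinearMap
    (onFirst e.symm.toLinearMap (onSecond e.symm.toLinearMap t)))
  simp only [LinearMap.comp_apply, h₁', h₂'] at this
  conv_lhs => rw [← this, h₁, h₂, h₁]

theorem IsPrimitivelyGenerated.antipode_mul {H : Type*} [Ring H] [Algebra F H]
    {D : BraidedHopfData F H} {j : V →ₗ[F] H} {τ : V ⊗[F] V →ₗ[F] V ⊗[F] V}
    (h : IsPrimitivelyGenerated D j τ) (x y : H) :
    D.antipode (x * y) = LinearMap.mul' F H (D.braiding (D.antipode x ⊗ₜ D.antipode y)) := by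
  refine append_one_injective (F := F) ?_
  have := h.antipode_mul_head (x ⊗ₜ (y ⊗ₜ (1 : F)))
  rw [mulHead_tmul, LinearMap.lTensor_tmul, LinearMap.rTensor_tmul, LinearMap.rTensor_tmul,
    LinearMap.rTensor_tmul, braidHead_tmul, mulHead_assoc] at this
  exact this

namespace IsQuadraticCover

variable {τ : V ⊗[F] V →ₗ[F] V ⊗[F] V} {π : TensorAlgebra F V →ₐ[F] A}

local notation "T" => TensorAlgebra F V

/-- One inclusion comes from τ; the other comes from the inverse of τ, transported by the braiding
itself. -/
theorem map_tensorBraiding_tensorLeft (h : IsQuadraticCover τ π) (hτ : IsBraiding τ) :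
    (tensorLeft F (RingHom.ker π)).map (tensorBraiding τ) = tensorRight F (RingHom.ker π) := by
  obtain ⟨σ, hσ, hστ, hτσ⟩ := hτ.exists_inverse
  refine le_antisymm (h.map_tensorBraiding_tensorLeft_le hτ) ?_
  have := Submodule.map_mono (f := tensorBraiding τ)
    ((h.inverse hστ hτσ).map_tensorBraiding_tensorRight_le hσ)
  rwa [← Submodule.map_comp, tensorBraiding_comp_eq_id hτσ, Submodule.map_id] at this

theorem map_tensorBraiding_tensorRight (h : IsQuadraticCover τ π) (hτ : IsBraiding τ) :
    (tensorRight F (RingHom.ker π)).map (tensorBraiding τ) = tensorLeft F (RingHom.ker π) := by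
  obtain ⟨σ, hσ, hστ, hτσ⟩ := hτ.exists_inverse
  refine le_antisymm (h.map_tensorBraiding_tensorRight_le hτ) ?_
  have := Submodule.map_mono (f := tensorBraiding τ)
    ((h.inverse hστ hτσ).map_tensorBraiding_tensorLeft_le hσ)
  rwa [← Submodule.map_comp, tensorBraiding_comp_eq_id hτσ, Submodule.map_id] at this

/-- Expanding `(v ⊗ 1 + 1 ⊗ v)(w ⊗ 1 + 1 ⊗ w)`, the mixed terms are `v ⊗ w` and `τ (v ⊗ w)`. Hence
elements of `ker (1 + τ)` are primitive. -/
theorem tensorComul_quadraticPart (r : V ⊗[F] V) :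
    tensorComul τ (quadraticPart F V r) = quadraticPart F V r ⊗ₜ 1 + 1 ⊗ₜ quadraticPart F V r +
      TensorProduct.map (ι F) (ι F) (r + τ r) := by
  induction r with
  | zero => simp
  | add a b ha hb =>
    simp only [map_add, ha, hb, TensorProduct.add_tmul, TensorProduct.tmul_add]; abel
  | tmul v w =>
    simp only [quadraticPart, LinearMap.comp_apply, TensorProduct.map_tmul, LinearMap.mul'_apply,
      tensorComul_ι_mul, tensorComul_ι, primitiveMul_eq, TensorProduct.tmul_add, map_add,
      mulHead_tmul, braidHead_tmul, tensorBraiding_one_right, tensorBraiding_ι_ι, mul_one,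
      TensorProduct.assoc_tmul, LinearMap.lTensor_tmul]
    have : ∀ s : T ⊗[F] T, LinearMap.lTensor T (LinearMap.mul' F T)
        (TensorProduct.assoc F T T T (s ⊗ₜ 1)) = s := by
      intro s
      induction s with
      | zero => simp
      | add a b ha hb => simp only [map_add, TensorProduct.add_tmul, ha, hb]
      | tmul a b => simp
    rw [this]
    abel

theorem tensorAntipode_quadraticPart (r : V ⊗[F] V) :
    tensorAntipode τ (quadraticPart F V r) = quadraticPart F V (τ r) := by
  induction r with
  | zero => simp
  | add a b ha hb => simp only [map_add, ha, hb]
  | tmul v w =>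
    have hw : tensorAntipode τ (ι F w) = -ι F w := by
      have := tensorAntipode_ι_mul τ w 1
      rwa [mul_one, tensorAntipode_one, tensorBraiding_one_right, LinearMap.mul'_apply,
        one_mul] at this
    rw [quadraticPart, LinearMap.comp_apply, TensorProduct.map_tmul, LinearMap.mul'_apply,
      tensorAntipode_ι_mul, hw, TensorProduct.tmul_neg, map_neg, map_neg, neg_neg,
      tensorBraiding_ι_ι]
    rfl

theorem counit_quadraticPart (r : V ⊗[F] V) :
    TensorAlgebra.algebraMapInv (quadraticPart F V r) = 0 := by
  induction r with
  | zero => simp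
  | add a b ha hb => simp only [map_add, ha, hb, add_zero]
  | tmul v w => simp [quadraticPart, TensorAlgebra.algebraMapInv]

/-- The kernel of a quadratic cover is a Hopf ideal. -/
theorem isHopfIdeal (h : IsQuadraticCover τ π) (hτ : IsBraiding τ) :
    IsHopfIdeal (tensorData τ) (RingHom.ker π) where
  isTwoSided := inferInstance
  comul_mem := by
    have hT := tensorData_isPrimitivelyGenerated τ hτ.yangBaxter
    obtain ⟨c', hc'⟩ := exists_map_descent h.surjective
      (h.map_tensorBraiding_tensorLeft_le hτ) (h.map_tensorBraiding_tensorRight_le hτ)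
    -- Only the braiding enters the twisted product on `A ⊗ A`; the zero entries are placeholders.
    let D' : BraidedHopfData F A := ⟨c', 0, 0, 0⟩
    have hmul : ∀ x y, TensorProduct.map π.toLinearMap π.toLinearMap (tensorComul τ (x * y)) =
        D'.braidedMul (TensorProduct.map π.toLinearMap π.toLinearMap (tensorComul τ x) ⊗ₜ
          TensorProduct.map π.toLinearMap π.toLinearMap (tensorComul τ y)) := by
      intro x y
      rw [braidedMul_map (D := tensorData τ) (D' := D') hc']
      exact congrArg _ (hT.comul_mul x y)
    rw [← ker_map_algHom h.surjective]
    refine h.ker_induction (P := fun x =>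
      TensorProduct.map π.toLinearMap π.toLinearMap (tensorComul τ x) = 0) ?_ ?_ ?_ ?_ ?_
    · simp
    · intro x y hx hy; rw [map_add, map_add, hx, hy, add_zero]
    · intro a x hx; rw [hmul, hx, TensorProduct.tmul_zero, map_zero]
    · intro x a hx; rw [hmul, hx, TensorProduct.zero_tmul, map_zero]
    · intro r hr
      rw [tensorComul_quadraticPart, hr, add_neg_cancel, map_zero, add_zero, map_add,
        TensorProduct.map_tmul, TensorProduct.map_tmul, AlgHom.toLinearMap_apply,
        h.apply_eq_zero hr]
      simp
  counit_eq_zero := by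
    refine h.ker_induction (P := fun x => TensorAlgebra.algebraMapInv x = 0) ?_ ?_ ?_ ?_ ?_
    · simp
    · intro x y hx hy; rw [map_add, hx, hy, add_zero]
    · intro a x hx; rw [map_mul, hx, mul_zero]
    · intro x a hx; rw [map_mul, hx, zero_mul]
    · intro r _; exact counit_quadraticPart r
  antipode_mem := by
    have hT := tensorData_isPrimitivelyGenerated τ hτ.yangBaxter
    obtain ⟨c', hc'⟩ := exists_map_descent h.surjective
      (h.map_tensorBraiding_tensorLeft_le hτ) (h.map_tensorBraiding_tensorRight_le hτ)
    have hmul : ∀ x y, π (tensorAntipode τ (x * y)) = LinearMap.mul' F A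
        (c' (π (tensorAntipode τ x) ⊗ₜ π (tensorAntipode τ y))) := by
      intro x y
      have h₁ := hT.antipode_mul x y
      have h₂ := LinearMap.congr_fun hc' (tensorAntipode τ x ⊗ₜ tensorAntipode τ y)
      rw [LinearMap.comp_apply, TensorProduct.map_tmul, AlgHom.toLinearMap_apply,
        AlgHom.toLinearMap_apply] at h₂
      rw [h₂, LinearMap.comp_apply, mul'_map]
      exact congrArg π h₁
    refine h.ker_induction (P := fun x => π (tensorAntipode τ x) = 0) ?_ ?_ ?_ ?_ ?_
    · simp
    · intro x y hx hy; rw [map_add, map_add, hx, hy, add_zero]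
    · intro a x hx; rw [hmul, hx, TensorProduct.tmul_zero, map_zero, map_zero]
    · intro x a hx; rw [hmul, hx, TensorProduct.zero_tmul, map_zero, map_zero]
    · intro r hr
      rw [tensorAntipode_quadraticPart, hr, map_neg, map_neg, h.apply_eq_zero hr, neg_zero]
  map_braiding_left := h.map_tensorBraiding_tensorLeft hτ
  map_braiding_right := h.map_tensorBraiding_tensorRight hτ

end IsQuadraticCover

theorem IsPrimitivelyGenerated.isInducedBy {H : Type*} [Ring H] [Algebra F H]
    {D : BraidedHopfData F H} {j : V →ₗ[F] H} {τ : V ⊗[F] V →ₗ[F] V ⊗[F] V}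
    (h : IsPrimitivelyGenerated D j τ) (hb : Function.Bijective D.braiding) :
    D.IsInducedBy j τ where
  isBraidedHopfAlgebra := h.isBraidedHopfAlgebra hb
  isPrimitive v := by
    have := h.comul_gen_mul v 1
    rw [mul_one, h.comul_one, mulHead_tmul, braidHead_tmul, h.isMulBraiding.one_right] at this
    simpa [BraidedHopfData.IsPrimitive] using this
  braiding := h.braiding

/-- The target of a quadratic cover has a unique braided Hopf algebra structure induced by `τ`. -/
theorem IsQuadraticCover.existsUnique_isInducedBy {τ : V ⊗[F] V →ₗ[F] V ⊗[F] V} {j : V →ₗ[F] A}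
    (h : IsQuadraticCover τ (TensorAlgebra.lift F j)) (hτ : IsBraiding τ) :
    ∃! L : BraidedHopfData F A, L.IsInducedBy j τ := by
  obtain ⟨L, hL⟩ := (h.isHopfIdeal hτ).exists_isHom h.surjective
  refine ⟨L, ?_, fun L' hL' => (hL'.lift_isHom hτ).eq_of_surjective h.surjective hL⟩
  have hg := hL.isPrimitivelyGenerated h.surjective
    (tensorData_isPrimitivelyGenerated τ hτ.yangBaxter)
  have hj : (TensorAlgebra.lift F j).toLinearMap ∘ₗ ι F = j :=
    LinearMap.ext (TensorAlgebra.lift_ι_apply j)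
  rw [hj] at hg
  exact hg.isInducedBy ((h.isHopfIdeal hτ).braiding_bijective h.surjective hL
    (tensorBraiding_bijective hτ.bijective))

end QuadraticHopf

/-! ### The exterior algebra as a quadratic quotient -/

section Exterior

variable {F V I : Type*} [Field F] [AddCommGroup V] [Module F V]

local notation "π" => TensorAlgebra.lift F (ExteriorAlgebra.ι F : V →ₗ[F] ExteriorAlgebra F V)

theorem lift_ι_surjective : Function.Surjective π := by
  rw [← AlgHom.range_eq_top, ← Algebra.map_top, ← adjoin_range_ι, AlgHom.map_adjoin,
    ← Set.range_comp]
  have : (π ∘ TensorAlgebra.ι F) = (ExteriorAlgebra.ι F : V →ₗ[F] ExteriorAlgebra F V) :=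
    funext fun v => TensorAlgebra.lift_ι_apply _ v
  rw [this]
  exact CliffordAlgebra.adjoin_range_ι

/-- The kernel of `T(V) → ⋀ V` is generated by the squares of the elements of `V`. -/
theorem ker_lift_ι_induction {P : TensorAlgebra F V → Prop} (zero : P 0)
    (add : ∀ x y, P x → P y → P (x + y)) (mul_left : ∀ a x, P x → P (a * x))
    (mul_right : ∀ x a, P x → P (x * a)) (sq : ∀ v, P (TensorAlgebra.ι F v * TensorAlgebra.ι F v))
    (x : TensorAlgebra F V) (hx : π x = 0) : P x := by
  let N : Ideal (TensorAlgebra F V) :=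
    { carrier := {x | P x}
      zero_mem' := zero
      add_mem' := fun ha hb => add _ _ ha hb
      smul_mem' := fun a x hx => mul_left a x hx }
  have hN : N.IsTwoSided := ⟨fun a hx => mul_right _ a hx⟩
  let f : ExteriorAlgebra F V →ₐ[F] TensorAlgebra F V ⧸ N := ExteriorAlgebra.lift F
    ⟨(Ideal.Quotient.mkₐ F N).toLinearMap ∘ₗ TensorAlgebra.ι F, fun v => by
      rw [LinearMap.comp_apply, AlgHom.toLinearMap_apply, ← map_mul]
      exact Ideal.Quotient.eq_zero_iff_mem.2 (sq v)⟩
  have hf : f.comp π = Ideal.Quotient.mkₐ F N := by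
    ext v
    simp [f]
  have := DFunLike.congr_fun hf x
  rw [AlgHom.comp_apply, hx, map_zero] at this
  exact Ideal.Quotient.eq_zero_iff_mem.1 this.symm

variable [LinearOrder I] (B : Module.Basis I F V) (p : F)

/-- For `a < b` the map `1 + τ` sends `a ⊗ b` to `a ⊗ b - p b ⊗ a` and `b ⊗ a` to its negative, and
it kills `a ⊗ a`; so it is alternating. -/
theorem heckeBraiding_tmul_self (v : V) : heckeBraiding B p (v ⊗ₜ v) = -(v ⊗ₜ v) := by
  let g : V ⊗[F] V →ₗ[F] V ⊗[F] V := LinearMap.id + heckeBraiding B p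
  have hg : ∀ a b, g (B a ⊗ₜ B b) + g (B b ⊗ₜ B a) = 0 := by
    intro a b
    simp only [g, LinearMap.add_apply, LinearMap.id_apply, heckeBraiding_apply]
    rcases lt_trichotomy a b with h | rfl | h
    · simp only [heaviside, h, h.not_gt, if_true, if_false]; module
    · simp only [heaviside, lt_irrefl, if_false]; module
    · simp only [heaviside, h, h.not_gt, if_true, if_false]; module
  -- Checked directly, since antisymmetry does not give it in characteristic two.
  have hself : ∀ a, g (B a ⊗ₜ B a) = 0 := by
    intro a
    simp only [g, LinearMap.add_apply, LinearMap.id_apply, heckeBraiding_apply, heaviside,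
      lt_irrefl, if_false]
    module
  have hsymm : ∀ v w, g (v ⊗ₜ w) + g (w ⊗ₜ v) = 0 := by
    have : g + g ∘ₗ (TensorProduct.comm F V V).toLinearMap = 0 :=
      (B.tensorProduct B).ext fun ⟨a, b⟩ => by
        rw [Module.Basis.tensorProduct_apply]
        simpa using hg a b
    intro v w
    simpa using LinearMap.congr_fun this (v ⊗ₜ w)
  have halt : ∀ v, g (v ⊗ₜ v) = 0 := by
    intro v
    induction B.mem_span v using Submodule.span_induction with
    | zero => simp
    | add v w _ _ hv hw =>
      have := hsymm v w
      simp only [TensorProduct.add_tmul, TensorProduct.tmul_add, map_add, hv, hw, zero_add,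
        add_zero]
      rwa [add_comm] at this
    | smul r v _ hv => simp [← TensorProduct.smul_tmul', hv]
    | mem _ h => obtain ⟨i, rfl⟩ := h; exact hself i
  exact (neg_eq_of_add_eq_zero_right (halt v)).symm

theorem isQuadraticCover_exterior : IsQuadraticCover (heckeBraiding B p) π where
  surjective := lift_ι_surjective
  exists_factor := by
    -- The image of `1 + τ` is spanned by the elements `a ⊗ b - p b ⊗ a` with `a < b`, which have to
    -- go to `a ∧ b`. Keeping only the increasing pairs achieves this for every `p`.
    refine ⟨(B.tensorProduct B).constr F fun ij : I × I =>
      if ij.1 < ij.2 then ExteriorAlgebra.ι F (B ij.1) * ExteriorAlgebra.ι F (B ij.2) else 0, ?_⟩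
    set g := (B.tensorProduct B).constr F fun ij : I × I =>
      if ij.1 < ij.2 then ExteriorAlgebra.ι F (B ij.1) * ExteriorAlgebra.ι F (B ij.2) else 0
      with hg
    have hg' : ∀ a b, g (B a ⊗ₜ B b) =
        if a < b then ExteriorAlgebra.ι F (B a) * ExteriorAlgebra.ι F (B b) else 0 := by
      intro a b
      have h := (B.tensorProduct B).constr_basis F (fun ij : I × I => if ij.1 < ij.2 then
        ExteriorAlgebra.ι F (B ij.1) * ExteriorAlgebra.ι F (B ij.2) else 0) (a, b)
      rwa [Module.Basis.tensorProduct_apply] at h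
    have : (TensorAlgebra.lift F (ExteriorAlgebra.ι F)).toLinearMap ∘ₗ quadraticPart F V =
        g ∘ₗ (LinearMap.id + heckeBraiding B p) := by
      refine (B.tensorProduct B).ext fun ij => ?_
      rcases ij with ⟨a, b⟩
      rw [Module.Basis.tensorProduct_apply]
      have hswap := ExteriorAlgebra.ι_add_mul_swap (R := F) (B a) (B b)
      simp only [quadraticPart, LinearMap.comp_apply, LinearMap.add_apply, LinearMap.id_apply,
        heckeBraiding_apply, map_add, map_sub, map_smul, hg', TensorProduct.map_tmul,
        LinearMap.mul'_apply, AlgHom.toLinearMap_apply, map_mul, TensorAlgebra.lift_ι_apply]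
      rcases lt_trichotomy a b with h | rfl | h
      · simp [heaviside, h, h.not_gt]
      · simp [heaviside]
      · simp [heaviside, h, h.not_gt, eq_neg_of_add_eq_zero_left hswap]
    exact LinearMap.congr_fun this
  ker_induction zero add mul_left mul_right rel x hx := by
    refine ker_lift_ι_induction zero add mul_left mul_right (fun v => ?_) x hx
    have := rel (v ⊗ₜ v) (heckeBraiding_tmul_self B p v)
    simpa [quadraticPart] using this

end Exterior

/-! ### The monomial basis of the exterior algebra -/

section Basis

variable {F V I : Type*} [Field F] [AddCommGroup V] [Module F V] [LinearOrder I]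
  (B : Module.Basis I F V)

theorem basis_empty : B.ExteriorAlgebra ∅ = 1 := by
  rw [ExteriorAlgebra.basis_apply_ofCard B Finset.card_empty, ExteriorAlgebra.ιMulti_family]
  exact ExteriorAlgebra.ιMulti_zero_apply _

/-- As `a` is the new minimum, it is the first factor of the increasing product and no sign appears.
-/
theorem basis_insert {a : I} {s : Finset I} (h : ∀ b ∈ s, a < b) :
    B.ExteriorAlgebra (insert a s) = ExteriorAlgebra.ι F (B a) * B.ExteriorAlgebra s := by
  have ha : a ∉ s := fun ha => lt_irrefl a (h a ha)
  have hcard : (insert a s).card = s.card + 1 := Finset.card_insert_of_notMem ha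
  rw [ExteriorAlgebra.basis_apply_ofCard B hcard, ExteriorAlgebra.basis_apply_ofCard B rfl,
    ExteriorAlgebra.ιMulti_family, ExteriorAlgebra.ιMulti_family,
    ExteriorAlgebra.ιMulti_succ_apply]
  have hf : Fin.cons (α := fun _ => I) a (s.orderEmbOfFin rfl) =
      (insert a s).orderEmbOfFin hcard := by
    refine Finset.orderEmbOfFin_unique hcard (fun i => ?_) (Fin.strictMono_cons.2
      ⟨fun i => h _ (Finset.orderEmbOfFin_mem _ _ _), (s.orderEmbOfFin rfl).strictMono⟩)
    refine Fin.cases ?_ (fun i => ?_) i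
    · simp
    · exact Finset.mem_insert_of_mem (Finset.orderEmbOfFin_mem _ _ _)
  have h₀ : (insert a s).orderEmbOfFin hcard 0 = a := by rw [← hf]; rfl
  have h₁ : ∀ i, (insert a s).orderEmbOfFin hcard (Fin.succ i) = s.orderEmbOfFin rfl i := by
    intro i; rw [← hf]; rfl
  congr 1
  · exact congrArg (fun i => ExteriorAlgebra.ι F (B i)) h₀
  · exact congrArg _ (funext fun i => congrArg B (h₁ i))

end Basis

/-! ### The linear part of the coproduct of the exterior algebra -/

section Differential

variable {F V I : Type*} [Field F] [AddCommGroup V] [Module F V]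

local notation "Λ" => ExteriorAlgebra F V
local notation "ι" => (ExteriorAlgebra.ι F : V →ₗ[F] ExteriorAlgebra F V)
local notation "q" => (ExteriorAlgebra.ιInv : ExteriorAlgebra F V →ₗ[F] V)

theorem ιInv_one : q 1 = 0 := by
  -- The degree-one projection is defined through the square-zero extension `F ⊕ V`, which requires
  -- a right action of `F` on `V`.
  let : Module Fᵐᵒᵖ V := Module.compHom _ ((RingHom.id F).fromOpposite mul_comm)
  have : IsCentralScalar F V := ⟨fun r m => rfl⟩
  have e : q 1 = (ExteriorAlgebra.toTrivSqZeroExt 1 : TrivSqZeroExt F V).snd := rfl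
  rw [e, map_one, TrivSqZeroExt.snd_one]

theorem ιInv_algebraMap (r : F) : q (algebraMap F Λ r) = 0 := by
  rw [Algebra.algebraMap_eq_smul_one, map_smul, ιInv_one, smul_zero]

/-- In the square-zero extension `F ⊕ V` one has `(0, v) (ε(x), q(x)) = (0, ε(x) v)`. -/
theorem ιInv_ι_mul (v : V) (x : Λ) :
    q (ι v * x) = ExteriorAlgebra.algebraMapInv x • v := by
  let : Module Fᵐᵒᵖ V := Module.compHom _ ((RingHom.id F).fromOpposite mul_comm)
  have : IsCentralScalar F V := ⟨fun r m => rfl⟩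
  have h : ∀ x : Λ, (ExteriorAlgebra.toTrivSqZeroExt x : TrivSqZeroExt F V).fst =
      ExteriorAlgebra.algebraMapInv x := by
    have : (TrivSqZeroExt.fstHom F F V).comp ExteriorAlgebra.toTrivSqZeroExt =
        (ExteriorAlgebra.algebraMapInv : Λ →ₐ[F] F) := by
      ext v; simp [ExteriorAlgebra.algebraMapInv]
    exact DFunLike.congr_fun this
  have e : q (ι v * x) = (ExteriorAlgebra.toTrivSqZeroExt (ι v * x) : TrivSqZeroExt F V).snd := rfl
  rw [e, map_mul, ExteriorAlgebra.toTrivSqZeroExt_ι, TrivSqZeroExt.snd_mul, h]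
  simp

theorem algebraMapInv_of_mem_exteriorPower {n : ℕ} {x : Λ} (hx : x ∈ ⋀[F]^(n + 1) V) :
    ExteriorAlgebra.algebraMapInv x = 0 := by
  rw [ExteriorAlgebra.exteriorPower, pow_succ'] at hx
  induction hx using Submodule.mul_induction_on' with
  | mem_mul_mem a ha b hb =>
    obtain ⟨v, rfl⟩ := ha
    simp [ExteriorAlgebra.algebraMapInv]
  | add a _ b _ ha hb => rw [map_add, ha, hb, add_zero]

theorem ιInv_of_mem_exteriorPower {n : ℕ} {x : Λ} (hx : x ∈ ⋀[F]^(n + 2) V) : q x = 0 := by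
  rw [ExteriorAlgebra.exteriorPower, pow_succ'] at hx
  induction hx using Submodule.mul_induction_on' with
  | mem_mul_mem a ha b hb =>
    obtain ⟨v, rfl⟩ := ha
    rw [ιInv_ι_mul, algebraMapInv_of_mem_exteriorPower hb, zero_smul]
  | add a _ b _ ha hb => rw [map_add, ha, hb, add_zero]

theorem exterior_adjoin_range_ι : Algebra.adjoin F (Set.range ι) = ⊤ :=
  CliffordAlgebra.adjoin_range_ι

/-- The component of the coproduct in `V ⊗ ⋀ V`. -/
def differential (L : BraidedHopfData F (ExteriorAlgebra F V)) :
    ExteriorAlgebra F V →ₗ[F] V ⊗[F] ExteriorAlgebra F V :=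
  ExteriorAlgebra.ιInv.rTensor _ ∘ₗ L.comul

/-- The product `V ⊗ ⋀ V → ⋀ V`. -/
def vectorMul (F V : Type*) [Field F] [AddCommGroup V] [Module F V] :
    V ⊗[F] ExteriorAlgebra F V →ₗ[F] ExteriorAlgebra F V :=
  LinearMap.mul' F (ExteriorAlgebra F V) ∘ₗ (ExteriorAlgebra.ι F).rTensor _

namespace BraidedHopfData.IsInducedBy

variable {L : BraidedHopfData F (ExteriorAlgebra F V)} {τ : V ⊗[F] V →ₗ[F] V ⊗[F] V}

theorem counit_eq_algebraMapInv (h : L.IsInducedBy ι τ) (x : Λ) :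
    L.counit x = ExteriorAlgebra.algebraMapInv x := by
  have hH := h.isBraidedHopfAlgebra
  refine generated_induction_left exterior_adjoin_range_ι
    (P := fun x => L.counit x = ExteriorAlgebra.algebraMapInv x) ?_ ?_ ?_ ?_ x
  · rw [hH.counit_one, map_one]
  · intro v x _
    rw [hH.counit_mul, h.counit_gen, map_mul]
    simp [ExteriorAlgebra.algebraMapInv]
  · intro a b ha hb; rw [map_add, map_add, ha, hb]
  · intro r a ha; rw [map_smul, map_smul, ha]

/-- For a product `w x` the projection keeps only what `x` contributes through `ε`, and the braiding
commutes with `ε`. This lets the Leibniz rule for the differential be written with τ alone. -/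
theorem ιInv_braiding (h : L.IsInducedBy ι τ) (x : Λ) (v : V) :
    LinearMap.rTensor Λ q (L.braiding (ι v ⊗ₜ x)) = LinearMap.lTensor V ι (τ (v ⊗ₜ q x)) := by
  have hH := h.isBraidedHopfAlgebra
  have hc := hH.isMulBraiding
  refine generated_induction_left exterior_adjoin_range_ι
    (P := fun x => ∀ v, LinearMap.rTensor Λ q (L.braiding (ι v ⊗ₜ x)) = LinearMap.lTensor V ι (τ (v ⊗ₜ q x)))
    ?_ ?_ ?_ ?_ x v
  · intro v; rw [hc.one_right, LinearMap.rTensor_tmul, ιInv_one]; simp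
  · intro w x _ v
    have e := hc.mul_right (ι v ⊗ₜ (ι w ⊗ₜ x))
    have hvw := LinearMap.congr_fun h.braiding (v ⊗ₜ w)
    rw [LinearMap.comp_apply, LinearMap.comp_apply, TensorProduct.map_tmul] at hvw
    rw [LinearMap.lTensor_tmul, LinearMap.mul'_apply, braidHead_tmul, hvw] at e
    rw [e, ιInv_ι_mul, TensorProduct.tmul_smul, map_smul, map_smul]
    induction τ (v ⊗ₜ w) with
    | zero => simp
    | add a b ha hb => simp only [map_add, TensorProduct.add_tmul, smul_add, ha, hb]
    | tmul a b =>
      have hε := LinearMap.congr_fun hH.braiding_counit_left (ι b ⊗ₜ x)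
      simp only [LinearMap.comp_apply, LinearEquiv.coe_coe, LinearMap.lTensor_tmul,
        TensorProduct.rid_tmul, h.counit_eq_algebraMapInv] at hε
      rw [TensorProduct.map_tmul, TensorProduct.assoc_tmul, LinearMap.lTensor_tmul,
        LinearMap.lTensor_tmul, ← TensorProduct.tmul_smul, ← hε]
      induction L.braiding (ι b ⊗ₜ x) with
      | zero => simp
      | add s t hs ht => simp only [map_add, TensorProduct.tmul_add, hs, ht]
      | tmul s t =>
        simp [mulHead_tmul, ιInv_ι_mul, h.counit_eq_algebraMapInv, TensorProduct.smul_tmul]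
  · intro a b ha hb v; simp only [map_add, TensorProduct.tmul_add, ha, hb]
  · intro r a ha v; simp only [map_smul, TensorProduct.tmul_smul, ha]

theorem differential_one (h : L.IsInducedBy ι τ) : differential L 1 = 0 := by
  rw [differential, LinearMap.comp_apply, h.isBraidedHopfAlgebra.comul_one,
    LinearMap.rTensor_tmul, ιInv_one, TensorProduct.zero_tmul]

/-- The twisted Leibniz rule. -/
theorem differential_ι_mul (h : L.IsInducedBy ι τ) (v : V) (x : Λ) :
    differential L (ι v * x) = v ⊗ₜ x + (vectorMul F V).lTensor V
      (TensorProduct.assoc F V V Λ (τ.rTensor Λ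
        ((TensorProduct.assoc F V V Λ).symm (v ⊗ₜ differential L x)))) := by
  have hH := h.isBraidedHopfAlgebra
  rw [differential, LinearMap.comp_apply, h.comul_gen_mul, map_add, LinearMap.comp_apply]
  congr 1
  · have hε := LinearMap.congr_fun hH.counit_left x
    simp only [LinearMap.comp_apply, LinearEquiv.coe_coe, LinearMap.id_apply] at hε
    conv_rhs => rw [← hε]
    induction L.comul x with
    | zero => simp
    | add s t hs ht => simp only [map_add, TensorProduct.tmul_add, hs, ht]
    | tmul s t =>
      simp [mulHead_tmul, ιInv_ι_mul, h.counit_eq_algebraMapInv, TensorProduct.smul_tmul]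
  · induction L.comul x with
    | zero => simp
    | add s t hs ht => simp only [map_add, TensorProduct.tmul_add, hs, ht]
    | tmul s t =>
      rw [braidHead_tmul, LinearMap.rTensor_tmul, TensorProduct.assoc_symm_tmul,
        LinearMap.rTensor_tmul]
      have e : ∀ r : Λ ⊗[F] Λ, LinearMap.rTensor Λ q ((LinearMap.mul' F Λ).lTensor Λ
          (TensorProduct.assoc F Λ Λ Λ (r ⊗ₜ t))) = (LinearMap.mul' F Λ).lTensor V
          (TensorProduct.assoc F V Λ Λ (LinearMap.rTensor Λ q r ⊗ₜ t)) := by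
        intro r
        induction r with
        | zero => simp
        | add s t hs ht => simp only [map_add, TensorProduct.add_tmul, hs, ht]
        | tmul s t => simp
      rw [e, h.ιInv_braiding]
      induction τ (v ⊗ₜ q s) with
      | zero => simp
      | add s t hs ht => simp only [map_add, TensorProduct.add_tmul, hs, ht]
      | tmul s t => simp [vectorMul]

end BraidedHopfData.IsInducedBy

theorem tensor_eq_zero_of_coord {X : Type*} [AddCommGroup X] [Module F X]
    (B : Module.Basis I F V) {t : V ⊗[F] X}
    (ht : ∀ i, TensorProduct.lid F X ((B.coord i).rTensor X t) = 0) : t = 0 := by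
  let C := Module.Basis.ofVectorSpace F X
  refine (B.tensorProduct C).repr.injective (Finsupp.ext fun ⟨i, k⟩ => ?_)
  have e : (B.tensorProduct C).repr t (i, k) =
      C.repr (TensorProduct.lid F X ((B.coord i).rTensor X t)) k := by
    clear ht
    induction t with
    | zero => simp
    | add s t hs ht => simp only [map_add, Finsupp.add_apply, hs, ht]
    | tmul v x => simp [mul_comm]
  rw [e, ht]; simp

/-! ### Recovering an element from its differential -/

variable [LinearOrder I] (B : Module.Basis I F V) (p : F)

/-- The left inverse of the differential on the augmentation ideal: `b ⊗ e_T ↦ e_{b ∪ T}` if `b`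
is smaller than all elements of `T`, and `b ⊗ e_T ↦ 0` otherwise. -/
def integral : V ⊗[F] ExteriorAlgebra F V →ₗ[F] ExteriorAlgebra F V :=
  (B.tensorProduct B.ExteriorAlgebra).constr F fun bT : I × Finset I =>
    if ∀ t ∈ bT.2, bT.1 < t then B.ExteriorAlgebra (insert bT.1 bT.2) else 0

theorem integral_apply (b : I) (t : Finset I) : integral B (B b ⊗ₜ B.ExteriorAlgebra t) =
    if ∀ x ∈ t, b < x then B.ExteriorAlgebra (insert b t) else 0 := by
  have h := (B.tensorProduct B.ExteriorAlgebra).constr_basis F (fun bT : I × Finset I =>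
    if ∀ t ∈ bT.2, bT.1 < t then B.ExteriorAlgebra (insert bT.1 bT.2) else 0) (b, t)
  rwa [Module.Basis.tensorProduct_apply] at h

variable {B p} {L : BraidedHopfData F (ExteriorAlgebra F V)}

/-- For `a < b` the coefficient of `a ⊗ b` is zero, so τ is a scaled flip. These are the only values
of τ that enter the differential of an increasing monomial. -/
theorem heckeBraiding_of_lt {a b : I} (h : a < b) :
    heckeBraiding B p (B a ⊗ₜ B b) = -(p • (B b ⊗ₜ[F] B a)) := by
  rw [heckeBraiding_apply]
  simp [heaviside, h, h.not_gt]

/-- The differential of `a ∧ x` for `x` in the span of monomials in larger variables. -/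
theorem differential_ι_mul_basis (h : L.IsInducedBy ι (heckeBraiding B p)) {a : I}
    {s : Finset I} (ha : ∀ b ∈ s, a < b) {n : ℕ} (hs : differential L (B.ExteriorAlgebra s) ∈
      Submodule.span F {t | ∃ b ∈ s, ∃ u ⊆ s, u.card < n ∧ t = B b ⊗ₜ B.ExteriorAlgebra u}) :
    differential L (ι (B a) * B.ExteriorAlgebra s) - B a ⊗ₜ B.ExteriorAlgebra s ∈
      Submodule.span F {t | ∃ b ∈ s, ∃ u ⊆ s, u.card < n ∧
        t = B b ⊗ₜ B.ExteriorAlgebra (insert a u)} := by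
  rw [h.differential_ι_mul, add_sub_cancel_left]
  generalize differential L (B.ExteriorAlgebra s) = d at hs
  induction hs using Submodule.span_induction with
  | zero => simp
  | add x y _ _ hx hy => simp only [TensorProduct.tmul_add, map_add]; exact add_mem hx hy
  | smul r x _ hx =>
    simp only [TensorProduct.tmul_smul, map_smul]; exact Submodule.smul_mem _ _ hx
  | mem x hx =>
    obtain ⟨b, hb, u, hu, hn, rfl⟩ := hx
    have e : vectorMul F V (B a ⊗ₜ B.ExteriorAlgebra u) = B.ExteriorAlgebra (insert a u) := by
      rw [basis_insert B fun x hx => ha x (hu hx)]; simp [vectorMul]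
    rw [TensorProduct.assoc_symm_tmul, LinearMap.rTensor_tmul, heckeBraiding_of_lt (ha b hb),
      TensorProduct.neg_tmul, ← TensorProduct.smul_tmul', map_neg, map_neg, map_smul, map_smul,
      TensorProduct.assoc_tmul, LinearMap.lTensor_tmul, e]
    exact neg_mem (Submodule.smul_mem _ _ (Submodule.subset_span ⟨b, hb, u, hu, hn, rfl⟩))

/-- A new minimum is adjoined at each step, so it only ever crosses larger basis vectors. The bound
on the cardinality is what makes partial derivatives lower the degree. -/
theorem differential_basis_mem (h : L.IsInducedBy ι (heckeBraiding B p)) (s : Finset I) :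
    differential L (B.ExteriorAlgebra s) ∈ Submodule.span F
      {t | ∃ b ∈ s, ∃ u ⊆ s, u.card < s.card ∧ t = B b ⊗ₜ B.ExteriorAlgebra u} := by
  induction s using Finset.induction_on_min with
  | empty => rw [basis_empty, h.differential_one]; exact zero_mem _
  | insert a s ha hs =>
    have has : a ∉ s := fun hx => lt_irrefl a (ha a hx)
    have hd := differential_ι_mul_basis h ha hs
    rw [basis_insert B ha, ← sub_add_cancel (differential L _) (B a ⊗ₜ B.ExteriorAlgebra s)]
    refine add_mem (Submodule.span_mono ?_ hd) (Submodule.subset_span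
      ⟨a, Finset.mem_insert_self a s, s, Finset.subset_insert a s, ?_, rfl⟩)
    · rintro _ ⟨b, hb, u, hu, hn, rfl⟩
      refine ⟨b, Finset.mem_insert_of_mem hb, _, Finset.insert_subset_insert a hu, ?_, rfl⟩
      rw [Finset.card_insert_of_notMem has, Finset.card_insert_of_notMem fun hx => has (hu hx)]
      omega
    · rw [Finset.card_insert_of_notMem has]; omega

/-- Elements of the augmentation ideal can be recovered from their differentials. -/
theorem eq_algebraMap_add_integral (h : L.IsInducedBy ι (heckeBraiding B p)) (x : Λ) :
    x = algebraMap F Λ (L.counit x) + integral B (differential L x) := by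
  have key : LinearMap.id = Algebra.linearMap F Λ ∘ₗ L.counit + integral B ∘ₗ differential L := by
    refine B.ExteriorAlgebra.ext fun s => ?_
    simp only [LinearMap.add_apply, LinearMap.comp_apply, LinearMap.id_apply,
      Algebra.linearMap_apply]
    induction s using Finset.induction_on_min with
    | empty =>
      rw [basis_empty, h.differential_one, h.isBraidedHopfAlgebra.counit_one]; simp
    | insert a s ha _ =>
      have hd := differential_ι_mul_basis h ha (differential_basis_mem h s)
      rw [basis_insert B ha, h.isBraidedHopfAlgebra.counit_mul, h.counit_gen, zero_mul, map_zero,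
        zero_add, ← sub_add_cancel (differential L _) (B a ⊗ₜ B.ExteriorAlgebra s), map_add,
        integral_apply, if_pos ha, basis_insert B ha, eq_comm, add_eq_right]
      -- The leading term `a ⊗ e_s` has been integrated to `e_{a ∪ s}`. Every other term is `b ⊗
      -- e_{a ∪ u}` with `a < b`, where `b` is not below all of `a ∪ u`, so the integral kills it.
      generalize differential L _ - B a ⊗ₜ B.ExteriorAlgebra s = d at hd
      induction hd using Submodule.span_induction with
      | zero => simp
      | add x y _ _ hx hy => rw [map_add, hx, hy, add_zero]
      | smul r x _ hx => rw [map_smul, hx, smul_zero]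
      | mem x hx =>
        obtain ⟨b, hb, u, hu, -, rfl⟩ := hx
        rw [integral_apply, if_neg]
        exact fun hlt => lt_asymm (ha b hb) (hlt a (Finset.mem_insert_self a u))
  exact LinearMap.congr_fun key x

theorem eq_zero_of_differential_eq_zero (h : L.IsInducedBy ι (heckeBraiding B p)) {x : Λ}
    (hε : L.counit x = 0) (hx : differential L x = 0) : x = 0 := by
  rw [eq_algebraMap_add_integral h x, hε, hx]; simp

/-- There are no nonzero primitive elements of degree at least two. -/
theorem eq_zero_of_isPrimitive (h : L.IsInducedBy ι (heckeBraiding B p)) {n : ℕ} {x : Λ}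
    (hn : x ∈ ⋀[F]^(n + 2) V) (hx : L.IsPrimitive x) : x = 0 := by
  refine eq_zero_of_differential_eq_zero h ?_ ?_
  · rw [h.counit_eq_algebraMapInv, algebraMapInv_of_mem_exteriorPower (n := n + 1) hn]
  · have hx' : L.comul x = x ⊗ₜ[F] 1 + 1 ⊗ₜ[F] x := hx
    rw [differential, LinearMap.comp_apply, hx', map_add, LinearMap.rTensor_tmul,
      LinearMap.rTensor_tmul, ιInv_of_mem_exteriorPower hn, ιInv_one]
    simp

/-- The span of the monomials of degree less than `n`. -/
def degreeLT (B : Module.Basis I F V) (n : ℕ) : Submodule F (ExteriorAlgebra F V) :=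
  Submodule.span F (B.ExteriorAlgebra '' {s | s.card < n})

theorem degreeLT_mono (B : Module.Basis I F V) : Monotone (degreeLT B) := by
  intro m n h
  refine Submodule.span_mono (Set.image_mono fun s hs => ?_)
  exact lt_of_lt_of_le hs h

theorem exists_mem_degreeLT (B : Module.Basis I F V) (x : Λ) : ∃ n, x ∈ degreeLT B n := by
  induction B.ExteriorAlgebra.mem_span x using Submodule.span_induction with
  | zero => exact ⟨0, zero_mem _⟩
  | add x y _ _ hx hy =>
    obtain ⟨m, hm⟩ := hx
    obtain ⟨n, hn⟩ := hy
    exact ⟨max m n, add_mem (degreeLT_mono B (le_max_left m n) hm)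
      (degreeLT_mono B (le_max_right m n) hn)⟩
  | smul r x _ hx =>
    obtain ⟨n, hn⟩ := hx
    exact ⟨n, Submodule.smul_mem _ _ hn⟩
  | mem x hx =>
    obtain ⟨s, rfl⟩ := hx
    exact ⟨s.card + 1, Submodule.subset_span ⟨s, Nat.lt_succ_self _, rfl⟩⟩

/-- The partial derivative with respect to a basis vector. -/
def partialDerivative (B : Module.Basis I F V) (L : BraidedHopfData F (ExteriorAlgebra F V))
    (i : I) : ExteriorAlgebra F V →ₗ[F] ExteriorAlgebra F V :=
  (TensorProduct.lid F _).toLinearMap ∘ₗ (B.coord i).rTensor _ ∘ₗ differential L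

theorem partialDerivative_mem_degreeLT (h : L.IsInducedBy ι (heckeBraiding B p)) (i : I) {n : ℕ}
    {x : Λ} (hx : x ∈ degreeLT B (n + 1)) : partialDerivative B L i x ∈ degreeLT B n := by
  induction hx using Submodule.span_induction with
  | zero => simp
  | add x y _ _ hx hy => rw [map_add]; exact add_mem hx hy
  | smul r x _ hx => rw [map_smul]; exact Submodule.smul_mem _ _ hx
  | mem x hx =>
    obtain ⟨s, hs, rfl⟩ := hx
    have hd := differential_basis_mem h s
    rw [partialDerivative, LinearMap.comp_apply, LinearMap.comp_apply, LinearEquiv.coe_coe]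
    generalize differential L (B.ExteriorAlgebra s) = d at hd
    induction hd using Submodule.span_induction with
    | zero => simp
    | add x y _ _ hx hy => simp only [map_add]; exact add_mem hx hy
    | smul r x _ hx => simp only [map_smul]; exact Submodule.smul_mem _ _ hx
    | mem x hx =>
      obtain ⟨b, hb, u, hu, hn, rfl⟩ := hx
      rw [LinearMap.rTensor_tmul, TensorProduct.lid_tmul]
      have hs' : s.card < n + 1 := hs
      exact Submodule.smul_mem _ _ (Submodule.subset_span ⟨u, by simp; omega, rfl⟩)

/-- A subspace of the augmentation ideal that is stable under all partial derivatives is zero. -/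
theorem eq_bot_of_partialDerivative_mem (h : L.IsInducedBy ι (heckeBraiding B p))
    {K : Submodule F (ExteriorAlgebra F V)} (hε : ∀ x ∈ K, L.counit x = 0)
    (hK : ∀ i, ∀ x ∈ K, partialDerivative B L i x ∈ K) : K = ⊥ := by
  -- The partial derivatives of `x` stay in `K` and satisfy a smaller degree bound, so they vanish
  -- by induction; then `∂ x = 0` and `ε(x) = 0` force `x = 0`.
  have key : ∀ n, ∀ x ∈ K, x ∈ degreeLT B n → x = 0 := by
    intro n
    induction n with
    | zero => intro x _ hx; simpa [degreeLT] using hx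
    | succ n ih =>
      intro x hx hn
      exact eq_zero_of_differential_eq_zero h (hε x hx) (tensor_eq_zero_of_coord B fun i =>
        ih _ (hK i x hx) (partialDerivative_mem_degreeLT h i hn))
  rw [Submodule.eq_bot_iff]
  intro x hx
  obtain ⟨n, hn⟩ := exists_mem_degreeLT B x
  exact key n x hx hn

end Differential

/-! ### The exterior algebra as a Nichols algebra -/

section Nichols

variable {F V I : Type*} [Field F] [AddCommGroup V] [Module F V] [LinearOrder I]
  {B : Module.Basis I F V} {p : F}

local notation "Λ" => ExteriorAlgebra F V
local notation "T" => TensorAlgebra F V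
local notation "π" => TensorAlgebra.lift F (ExteriorAlgebra.ι F : V →ₗ[F] ExteriorAlgebra F V)

theorem lift_ι_mem_exteriorPower {n : ℕ} {x : TensorAlgebra F V} (hx : x ∈ tensorGrading F V n) :
    π x ∈ ⋀[F]^n V := by
  have h := Submodule.mem_map_of_mem (f := (π).toLinearMap) hx
  have hι : (π).toLinearMap ∘ₗ TensorAlgebra.ι F = ExteriorAlgebra.ι F :=
    LinearMap.ext fun v => TensorAlgebra.lift_ι_apply _ v
  rw [tensorGrading, Submodule.map_pow, ← LinearMap.range_comp, hι] at h
  exact h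

theorem ker_lift_ι_isHomogeneous : (RingHom.ker π).IsHomogeneous (tensorGrading F V) := by
  let 𝒜 : ℕ → Submodule F (ExteriorAlgebra F V) := fun n => ⋀[F]^n V
  intro n x hx
  rw [RingHom.mem_ker] at hx ⊢
  -- The projection to the exterior algebra is graded, so its kernel contains the homogeneous
  -- components of each of its elements.
  have key : ∀ x : T, π (DirectSum.decompose (tensorGrading F V) x n) =
      (DirectSum.decompose 𝒜 (π x) n : Λ) := by
    intro x
    induction x using DirectSum.Decomposition.inductionOn (tensorGrading F V) with
    | zero => simp
    | @homogeneous i m =>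
      have hm : π (m : T) ∈ 𝒜 i := lift_ι_mem_exteriorPower m.2
      by_cases hin : i = n
      · subst hin
        rw [DirectSum.decompose_of_mem_same _ m.2, DirectSum.decompose_of_mem_same _ hm]
      · rw [DirectSum.decompose_of_mem_ne _ m.2 hin, DirectSum.decompose_of_mem_ne _ hm hin,
          map_zero]
    | add a b ha hb =>
      simp only [DirectSum.decompose_add, DirectSum.add_apply, Submodule.coe_add, map_add, ha, hb]
  rw [key, hx]; simp

theorem isNicholsCandidate_ker_lift_ι (hp : p ≠ 0) :
    IsNicholsCandidate (heckeBraiding B p) (RingHom.ker π) where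
  isHopfIdeal := (isQuadraticCover_exterior B p).isHopfIdeal (heckeBraiding_isBraiding B p hp)
  isHomogeneous := ker_lift_ι_isHomogeneous
  trivial_inter v hv := by
    rw [RingHom.mem_ker, TensorAlgebra.lift_ι_apply, ExteriorAlgebra.ι_eq_zero_iff] at hv
    rw [hv, map_zero]

/-- Only the component of degree one can survive; by homogeneity it lies in `J`, hence is zero. Here
the homogeneity of `J` and its trivial intersection with `V` enter the upper bound on `J`. -/
theorem ιInv_lift_ι_of_mem {τ : V ⊗[F] V →ₗ[F] V ⊗[F] V} {J : Ideal (TensorAlgebra F V)}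
    (hJ : IsNicholsCandidate τ J) {x : T} (hx : x ∈ J) :
    ExteriorAlgebra.ιInv (π x) = 0 := by
  classical
  rw [← DirectSum.sum_support_decompose (tensorGrading F V) x, map_sum, map_sum]
  refine Finset.sum_eq_zero fun n _ => ?_
  have hn := hJ.isHomogeneous n hx
  have hm : (DirectSum.decompose (tensorGrading F V) x n : T) ∈ tensorGrading F V n :=
    SetLike.coe_mem _
  generalize (DirectSum.decompose (tensorGrading F V) x n : T) = y at hn hm
  match n with
  | 0 =>
    rw [tensorGrading, pow_zero] at hm
    obtain ⟨r, rfl⟩ := Submodule.mem_one.1 hm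
    rw [AlgHom.commutes, ιInv_algebraMap]
  | 1 =>
    rw [tensorGrading, pow_one] at hm
    obtain ⟨v, rfl⟩ := hm
    rw [hJ.trivial_inter v hn, map_zero, map_zero]
  | n + 2 => exact ιInv_of_mem_exteriorPower (lift_ι_mem_exteriorPower hm)

variable {L : BraidedHopfData F (ExteriorAlgebra F V)}

/-- The image `K` of `J` in `⋀ V` is killed by `ε` and, as `Δ J ⊆ J ⊗ T(V) + T(V) ⊗ J`, stable under
partial derivatives; such a subspace is zero. -/
theorem IsNicholsCandidate.le_ker_lift_ι (hp : p ≠ 0)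
    (hL : L.IsInducedBy (ExteriorAlgebra.ι F) (heckeBraiding B p)) {J : Ideal (TensorAlgebra F V)}
    (hJ : IsNicholsCandidate (heckeBraiding B p) J) : J ≤ RingHom.ker π := by
  have hπ := hL.lift_isHom (heckeBraiding_isBraiding B p hp)
  let K : Submodule F Λ := (J.restrictScalars F).map (π).toLinearMap
  have hK : K = ⊥ := by
    refine eq_bot_of_partialDerivative_mem hL ?_ ?_
    · rintro _ ⟨x, hx, rfl⟩
      exact (LinearMap.congr_fun hπ.counit x).trans (hJ.isHopfIdeal.counit_eq_zero x hx)
    · rintro i _ ⟨x, hx, rfl⟩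
      have hΔ := hJ.isHopfIdeal.comul_mem x hx
      have e : partialDerivative B L i (π x) = TensorProduct.lid F Λ ((B.coord i).rTensor Λ
          (ExteriorAlgebra.ιInv.rTensor Λ (TensorProduct.map (π).toLinearMap (π).toLinearMap
            ((tensorData (heckeBraiding B p)).comul x)))) :=
        congrArg (fun t => TensorProduct.lid F Λ ((B.coord i).rTensor Λ
          (ExteriorAlgebra.ιInv.rTensor Λ t))) (LinearMap.congr_fun hπ.comul x)
      rw [AlgHom.toLinearMap_apply, e]
      let f : T ⊗[F] T →ₗ[F] Λ := (TensorProduct.lid F Λ).toLinearMap ∘ₗ (B.coord i).rTensor Λ ∘ₗ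
        ExteriorAlgebra.ιInv.rTensor Λ ∘ₗ TensorProduct.map (π).toLinearMap (π).toLinearMap
      -- On `J ⊗ T(V)` the partial derivative sees only the degree-one part of an element of `J`,
      -- which is zero.
      have hl : (tensorLeft F J).map f ≤ K := by
        refine map_tensorLeft_le fun y hy z => ?_
        simp only [f, LinearMap.comp_apply, TensorProduct.map_tmul, AlgHom.toLinearMap_apply,
          LinearMap.rTensor_tmul, ιInv_lift_ι_of_mem hJ hy]
        simp
      -- On `T(V) ⊗ J` the first leg contributes a scalar and the second leg stays in `K`.
      have hr : (tensorRight F J).map f ≤ K := by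
        refine map_tensorRight_le fun y hy z => ?_
        simp only [f, LinearMap.comp_apply, TensorProduct.map_tmul, LinearMap.rTensor_tmul,
          LinearEquiv.coe_coe, TensorProduct.lid_tmul]
        exact K.smul_mem _ (Submodule.mem_map_of_mem hy)
      have hlr : (tensorLeft F J ⊔ tensorRight F J).map f ≤ K := by
        rw [Submodule.map_sup]; exact sup_le hl hr
      exact hlr (Submodule.mem_map_of_mem hΔ)
  intro x hx
  have : π x ∈ K := Submodule.mem_map_of_mem (f := (π).toLinearMap) hx
  rw [hK] at this
  exact this

/-- The ideal defining the Nichols algebra is the kernel of `T(V) → ⋀ V`. -/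
theorem nicholsIdeal_heckeBraiding (hp : p ≠ 0)
    (hL : L.IsInducedBy (ExteriorAlgebra.ι F) (heckeBraiding B p)) :
    nicholsIdeal (heckeBraiding B p) = RingHom.ker π :=
  le_antisymm (IsNicholsCandidate.le_ker_lift_ι hp hL (nicholsIdeal_isGreatest _).1)
    ((nicholsIdeal_isGreatest _).2 (isNicholsCandidate_ker_lift_ι hp))

/-- A map commutes with the structure maps if its composite with a surjective such map does. -/
theorem BraidedHopfData.IsHom.of_comp {H H' H'' : Type*} [Ring H] [Algebra F H] [Ring H']
    [Algebra F H'] [Ring H''] [Algebra F H''] {D : BraidedHopfData F H} {D' : BraidedHopfData F H'}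
    {D'' : BraidedHopfData F H''} {f : H →ₐ[F] H'} {g : H' →ₐ[F] H''}
    (hf : Function.Surjective f) (h : D.IsHom D' f) (hgf : D.IsHom D'' (g.comp f)) :
    D'.IsHom D'' g := by
  have hf' : Function.Surjective f.toLinearMap := hf
  have hff := map_algHom_surjective hf
  have hcomp : TensorProduct.map (g.comp f).toLinearMap (g.comp f).toLinearMap =
      TensorProduct.map g.toLinearMap g.toLinearMap ∘ₗ
        TensorProduct.map f.toLinearMap f.toLinearMap := by
    rw [AlgHom.comp_toLinearMap, TensorProduct.map_comp]
  constructor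
  · rw [← LinearMap.cancel_right hff, LinearMap.comp_assoc, ← hcomp, hgf.braiding,
      LinearMap.comp_assoc, h.braiding, ← LinearMap.comp_assoc, hcomp]
  · rw [← LinearMap.cancel_right hf', LinearMap.comp_assoc, ← AlgHom.comp_toLinearMap, hgf.comul,
      LinearMap.comp_assoc, h.comul, ← LinearMap.comp_assoc, hcomp]
  · rw [← LinearMap.cancel_right hf', LinearMap.comp_assoc, ← AlgHom.comp_toLinearMap,
      hgf.counit, h.counit]
  · rw [← LinearMap.cancel_right hf', LinearMap.comp_assoc, ← AlgHom.comp_toLinearMap,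
      hgf.antipode, LinearMap.comp_assoc, h.antipode, ← LinearMap.comp_assoc,
      AlgHom.comp_toLinearMap]

/-- The exterior algebra is isomorphic to the Nichols algebra. -/
theorem exists_algEquiv_nicholsAlgebra (hp : p ≠ 0)
    (hL : L.IsInducedBy (ExteriorAlgebra.ι F) (heckeBraiding B p)) :
    ∃ e : ExteriorAlgebra F V ≃ₐ[F] NicholsAlgebra (heckeBraiding B p),
      L.IsHom (nicholsData (heckeBraiding B p)) e.toAlgHom ∧
      ∀ v : V, e (ExteriorAlgebra.ι F v) =
        Ideal.Quotient.mk (nicholsIdeal (heckeBraiding B p)) (TensorAlgebra.ι F v) := by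
  have hker := nicholsIdeal_heckeBraiding hp hL
  let J := nicholsIdeal (heckeBraiding B p)
  let f : Λ →ₐ[F] NicholsAlgebra (heckeBraiding B p) := ExteriorAlgebra.lift F
    ⟨(Ideal.Quotient.mkₐ F J).toLinearMap ∘ₗ TensorAlgebra.ι F, fun v => by
      rw [LinearMap.comp_apply, AlgHom.toLinearMap_apply, ← map_mul]
      refine Ideal.Quotient.eq_zero_iff_mem.2 (hker.ge ?_)
      rw [RingHom.mem_ker, map_mul, TensorAlgebra.lift_ι_apply, ExteriorAlgebra.ι_sq_zero]⟩
  have hfι : ∀ v, f (ExteriorAlgebra.ι F v) = Ideal.Quotient.mk J (TensorAlgebra.ι F v) :=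
    fun v => ExteriorAlgebra.lift_ι_apply _ _ _ v
  have hfπ : f.comp π = Ideal.Quotient.mkₐ F J := by
    ext v
    simpa using hfι v
  have hbij : Function.Bijective f := by
    constructor
    · rw [injective_iff_map_eq_zero]
      intro y hy
      obtain ⟨x, rfl⟩ := lift_ι_surjective y
      have hx : Ideal.Quotient.mk J x = 0 := (DFunLike.congr_fun hfπ x).symm.trans hy
      rw [Ideal.Quotient.eq_zero_iff_mem] at hx
      exact hker.le hx
    · intro y
      obtain ⟨x, rfl⟩ := Ideal.Quotient.mk_surjective y
      exact ⟨π x, DFunLike.congr_fun hfπ x⟩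
  refine ⟨AlgEquiv.ofBijective f hbij, ?_, hfι⟩
  have hf : (AlgEquiv.ofBijective f hbij).toAlgHom = f := AlgHom.ext fun _ => rfl
  rw [hf]
  refine (hL.lift_isHom (heckeBraiding_isBraiding B p hp)).of_comp lift_ι_surjective ?_
  rw [hfπ]
  exact quotientData_isHom _ _ _

end Nichols

end BraidedHopf

theorem mainTheorem3 {F V I : Type*} [Field F] [AddCommGroup V] [Module F V] [LinearOrder I]
    (B : Module.Basis I F V) (p : F) (hp : p ≠ 0) :
    -- the braided Hopf algebra `Λ_p(V)` exists and is unique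
    (∃! L : BraidedHopf.BraidedHopfData F (ExteriorAlgebra F V),
      L.IsInducedBy (ExteriorAlgebra.ι F) (BraidedHopf.heckeBraiding B p)) ∧
    ∀ L : BraidedHopf.BraidedHopfData F (ExteriorAlgebra F V),
      L.IsInducedBy (ExteriorAlgebra.ι F) (BraidedHopf.heckeBraiding B p) →
      -- it is isomorphic to the Nichols algebra, by an isomorphism that is the identity on `V`
      (∃ e : ExteriorAlgebra F V ≃ₐ[F]
          BraidedHopf.NicholsAlgebra (BraidedHopf.heckeBraiding B p),
        BraidedHopf.BraidedHopfData.IsHom L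
          (BraidedHopf.nicholsData (BraidedHopf.heckeBraiding B p)) e.toAlgHom ∧
        ∀ v : V, e (ExteriorAlgebra.ι F v) =
          Ideal.Quotient.mk (BraidedHopf.nicholsIdeal (BraidedHopf.heckeBraiding B p))
            (TensorAlgebra.ι F v)) ∧
      -- it has no nontrivial primitive elements of degree at least two
      (∀ n : ℕ, 2 ≤ n → ∀ x ∈ ⋀[F]^n V, L.IsPrimitive x → x = 0) := by
  refine ⟨(BraidedHopf.isQuadraticCover_exterior B p).existsUnique_isInducedBy
    (BraidedHopf.heckeBraiding_isBraiding B p hp), fun L hL =>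
    ⟨BraidedHopf.exists_algEquiv_nicholsAlgebra hp hL, fun n hn x hx hprim => ?_⟩⟩
  obtain ⟨m, rfl⟩ := Nat.exists_eq_add_of_le' hn
  exact BraidedHopf.eq_zero_of_isPrimitive hL hx hprim
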